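/- Fix integers $N,k\ge 1$, numbers $0=m_0<m_1<\dots<m_k<1$ and $0=q_0<q_1<\dots<q_{k+1}=1$, and a function $\xi$ that is smooth at every point of $[-1,1]$ and convex on $[-1,1]$, with $\xi(0)=0$. Write $\Sigma_N=\{-1,+1\}^N$. On one probability space let the following be given. (a) A centered Gaussian family $(H_N(\sigma))_{\sigma\in\Sigma_N}$ with $\mathbb E\,H_N(\sigma)H_N(\tau)=\xi\bigl(\tfrac1N\sum_{i\le N}\sigma_i\tau_i\bigr)$. (b) Independent centered Gaussian variables $z_{i,a}$, for $1\le i\le N$ and $a\in\mathbb N^l$, $0\le l\le k$, with variance $\xi'(q_{l+1})-\xi'(q_l)$ for $a\in\mathbb N^l$. For $\alpha=(n_1,\dots,n_k)\in\mathbb N^k$ put $s_i^\alpha=\sum_{0\le l\le k}z_{i,(n_1,\dots,n_l)}$, where $l=0$ gives the empty index, common to all $\alpha$. (c) A Derrida–Ruelle cascade: for $1\le l\le k$ and $(n_1,\dots,n_{l-1})\in\mathbb N^{l-1}$, the sequence $(u_{n_1\dots n_{l-1}n})_{n\ge1}$ is a decreasing enumeration of a Poisson point process on $(0,\infty)$ with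 intensity measure $x^{-1-m_l}\,dx$, and all these processes are independent. Put $v_\alpha=\prod_{1\le l\le k}u_{n_1\dots n_l}$ and $w_\alpha=v_\alpha/\sum_\beta v_\beta$. The three families (a), (b), (c) are independent of each other. For $0\le t\le1$ let $$H_t(\sigma,\alpha)=\sqrt t\,H_N(\sigma)+\sqrt{1-t}\,\sum_{i\le N}s_i^\alpha\sigma_i ,$$ and let $\Gamma$ be the random Gibbs measure on $\Sigma_N\times\mathbb N^k$ with $\Gamma\{(\sigma,\alpha)\}$ proportional to $w_\alpha\exp H_t(\sigma,\alpha)$. Let $\langle\cdot\rangle$ denote the average with respect to $\Gamma^{\otimes2}$, whose points are written $\bigl((\sigma^1,\alpha),(\sigma^2,\beta)\bigr)$. For $\alpha,\beta\in\mathbb N^k$ let $\alpha\wedge\beta=\min\{l\ge1:\alpha_l\ne\beta_l\}$ if $\alpha\ne\beta$, and $\alpha\wedge\beta=k+1$ if $\alpha=\beta$. Then for every $0\le t\le1$ the measure $\Gamma$ is almost surely a well-defined probability measure, and for all $1\le r\le k$, $$\mathbb E\langle I(\alpha\wedge\beta=r)\rangle=\mathbb E\,\Gamma^{\otimes2}\{\alpha\wedge\beta=r\}=m_r-m_{r-1}.$$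 -/

import Mathlib

open MeasureTheory ProbabilityTheory
open scoped ENNReal

namespace RuelleCascade

noncomputable section

variable {Ω : Type*} [MeasurableSpace Ω]

/-! ### Poisson point processes -/

/-- The number of points of the family `x` that lie in `A`, counted with multiplicity. -/
def pointCount {E : Type*} (x : ℕ → Ω → E) (A : Set E) (ω : Ω) : ℕ∞ :=
  {n : ℕ | x n ω ∈ A}.encard

/-- The points `x 0, x 1, …` form a Poisson point process with intensity measure `μ`: the number
of points in a measurable set `A` is Poisson distributed with mean `μ A` (almost surely infinite
if `μ A = ∞`), and the numbers of points in pairwise disjoint sets are independent. -/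
structure IsPoissonPointProcess {E : Type*} [MeasurableSpace E] (P : Measure Ω) (μ : Measure E)
    (x : ℕ → Ω → E) : Prop where
  measurable : ∀ n, Measurable (x n)
  law_count : ∀ A, MeasurableSet A → μ A ≠ ∞ →
    HasLaw (pointCount x A) ((poissonMeasure (μ A).toNNReal).map (fun j : ℕ => (j : ℕ∞))) P
  count_top : ∀ A, MeasurableSet A → μ A = ∞ → ∀ᵐ ω ∂P, pointCount x A ω = ⊤
  indep_count : ∀ (j : ℕ) (A : Fin j → Set E), (∀ i, MeasurableSet (A i)) →
    Pairwise (fun i i' => Disjoint (A i) (A i')) → iIndepFun (fun i => pointCount x (A i)) P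

/-- The measure `x ^ (-1 - m) dx` on `(0, ∞)`, as a measure on `ℝ`. -/
def powerIntensity (m : ℝ) : Measure ℝ :=
  (volume.restrict (Set.Ioi 0)).withDensity (fun x => ENNReal.ofReal (x ^ (-1 - m)))

/-! ### The tree of indices -/

/-- The initial segment `(α₁, …, α_l)` of `α = (α₁, …, α_k)`; coordinates are numbered from `0`
in the code. -/
def pre {k : ℕ} (α : Fin k → ℕ) (l : ℕ) (h : l ≤ k) : Fin l → ℕ :=
  fun i => α (Fin.castLE h i)

/-- `α ∧ β`: the first place (numbered from `1`) where `α` and `β` differ, and `k + 1` if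
`α = β`. -/
def wedge {k : ℕ} (α β : Fin k → ℕ) : ℕ :=
  if α = β then k + 1 else sInf {l : ℕ | ∃ i : Fin k, l = (i : ℕ) + 1 ∧ α i ≠ β i}

/-! ### Derrida–Ruelle cascades -/

/-- The family `u l a n` stands for `u_{a₁ … a_l n}`, where `a ∈ ℕ^l` and `0 ≤ l < k`. For each
`a ∈ ℕ^l` the sequence `u l a` is a decreasing enumeration of a Poisson point process with
intensity `x ^ (-1 - m_{l+1}) dx` on `(0, ∞)`, and all these processes are independent. -/
structure IsCascade {k : ℕ} (P : Measure Ω) (m : ℕ → ℝ)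
    (u : (l : Fin k) → (Fin l → ℕ) → ℕ → Ω → ℝ) : Prop where
  poisson : ∀ (l : Fin k) (a : Fin l → ℕ),
    IsPoissonPointProcess P (powerIntensity (m ((l : ℕ) + 1))) (u l a)
  decreasing : ∀ (l : Fin k) (a : Fin l → ℕ), ∀ᵐ ω ∂P, Antitone (fun n => u l a n ω)
  indep : iIndepFun
    (fun (p : (l : Fin k) × (Fin l → ℕ)) (ω : Ω) (n : ℕ) => u p.1 p.2 n ω) P

/-- `v_α = ∏_{1 ≤ l ≤ k} u_{α₁ … α_l}`. -/
def cascadeProd {k : ℕ} (u : (l : Fin k) → (Fin l → ℕ) → ℕ → Ω → ℝ) (α : Fin k → ℕ)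
    (ω : Ω) : ℝ :=
  ∏ l : Fin k, u l (pre α l l.isLt.le) (α l) ω

/-- `w_α = v_α / ∑_β v_β`. -/
def cascadeWeight {k : ℕ} (u : (l : Fin k) → (Fin l → ℕ) → ℕ → Ω → ℝ) (α : Fin k → ℕ)
    (ω : Ω) : ℝ :=
  cascadeProd u α ω / ∑' β : Fin k → ℕ, cascadeProd u β ω

/-! ### Spins, Gaussian Hamiltonian and Gaussian fields on the tree -/

/-- Spin configurations; a Boolean codes the spin `±1` through `spin`. -/
abbrev Config (N : ℕ) : Type := Fin N → Bool

/-- The value `+1` or `-1` of a spin. -/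
def spin (b : Bool) : ℝ := if b then 1 else -1

/-- The overlap `N⁻¹ ∑ σ_i τ_i`. -/
def overlap {N : ℕ} (σ τ : Config N) : ℝ :=
  (∑ i, spin (σ i) * spin (τ i)) / N

/-- A centered Gaussian family indexed by the configurations, with covariance `ξ (R(σ, τ))`. -/
structure IsGaussianHamiltonian {N : ℕ} (P : Measure Ω) (ξ : ℝ → ℝ)
    (HN : Config N → Ω → ℝ) : Prop where
  measurable : ∀ σ, Measurable (HN σ)
  gaussian : IsGaussianProcess HN P
  centered : ∀ σ, ∫ ω, HN σ ω ∂P = 0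
  covariance : ∀ σ τ, ∫ ω, HN σ ω * HN τ ω ∂P = ξ (overlap σ τ)

/-- The family `z l a i` stands for the `i`-th coordinate of `z_{a₁ … a_l}`, where `a ∈ ℕ^l` and
`0 ≤ l ≤ k` (for `l = 0` this is the common column `z_0`). All these variables are independent
centered Gaussians, with variance `ξ'(q_{l+1}) - ξ'(q_l)` at level `l`; this number is nonnegative
when `ξ` is convex and `q` is increasing. -/
structure IsGaussianTree {k N : ℕ} (P : Measure Ω) (ξ : ℝ → ℝ) (q : ℕ → ℝ)
    (z : (l : Fin (k + 1)) → (Fin l → ℕ) → Fin N → Ω → ℝ) : Prop where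
  measurable : ∀ l a i, Measurable (z l a i)
  law : ∀ (l : Fin (k + 1)) (a : Fin l → ℕ) (i : Fin N),
    HasLaw (z l a i)
      (gaussianReal 0 (deriv ξ (q ((l : ℕ) + 1)) - deriv ξ (q (l : ℕ))).toNNReal) P
  indep : iIndepFun
    (fun (p : ((l : Fin (k + 1)) × (Fin l → ℕ)) × Fin N) => z p.1.1 p.1.2 p.2) P

/-- `s_i^α = ∑_{0 ≤ l ≤ k} z_{i, α₁ … α_l}`. -/
def field {k N : ℕ} (z : (l : Fin (k + 1)) → (Fin l → ℕ) → Fin N → Ω → ℝ) (α : Fin k → ℕ)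
    (i : Fin N) (ω : Ω) : ℝ :=
  ∑ l : Fin (k + 1), z l (pre α l (Nat.lt_succ_iff.mp l.isLt)) i ω

/-- `H_t(σ, α) = √t H_N(σ) + √(1 - t) s^α · σ`. -/
def hamiltonian {k N : ℕ} (HN : Config N → Ω → ℝ)
    (z : (l : Fin (k + 1)) → (Fin l → ℕ) → Fin N → Ω → ℝ) (t : ℝ) (σ : Config N)
    (α : Fin k → ℕ) (ω : Ω) : ℝ :=
  √t * HN σ ω + √(1 - t) * ∑ i, field z α i ω * spin (σ i)

/-! ### The Gibbs measure -/

/-- The measure on `Σ_N × ℕ^k` that gives the point `(σ, α)` mass `w_α exp H_t(σ, α)`. -/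
def gibbsUnnormalized {k N : ℕ} (HN : Config N → Ω → ℝ)
    (z : (l : Fin (k + 1)) → (Fin l → ℕ) → Fin N → Ω → ℝ)
    (u : (l : Fin k) → (Fin l → ℕ) → ℕ → Ω → ℝ) (t : ℝ) (ω : Ω) :
    Measure (Config N × (Fin k → ℕ)) :=
  Measure.sum fun x => ENNReal.ofReal
    (cascadeWeight u x.2 ω * Real.exp (hamiltonian HN z t x.1 x.2 ω)) • Measure.dirac x

/-- The Gibbs measure `Γ`: the normalization of `gibbsUnnormalized`. -/
def gibbs {k N : ℕ} (HN : Config N → Ω → ℝ)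
    (z : (l : Fin (k + 1)) → (Fin l → ℕ) → Fin N → Ω → ℝ)
    (u : (l : Fin k) → (Fin l → ℕ) → ℕ → Ω → ℝ) (t : ℝ) (ω : Ω) :
    Measure (Config N × (Fin k → ℕ)) :=
  (gibbsUnnormalized HN z u t ω Set.univ)⁻¹ • gibbsUnnormalized HN z u t ω

/-- The product measure `Γ ⊗ Γ`. -/
def gibbsTwo {k N : ℕ} (HN : Config N → Ω → ℝ)
    (z : (l : Fin (k + 1)) → (Fin l → ℕ) → Fin N → Ω → ℝ)
    (u : (l : Fin k) → (Fin l → ℕ) → ℕ → Ω → ℝ) (t : ℝ) (ω : Ω) :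
    Measure ((Config N × (Fin k → ℕ)) × (Config N × (Fin k → ℕ))) :=
  (gibbs HN z u t ω).prod (gibbs HN z u t ω)

/-- The event `α ∧ β = r` for two replicas `(σ, α)`, `(τ, β)`. -/
def overlapEvent (N k r : ℕ) : Set ((Config N × (Fin k → ℕ)) × (Config N × (Fin k → ℕ))) :=
  {p | wedge p.1.2 p.2.2 = r}

end

end RuelleCascade

namespace RuelleCascade

noncomputable section

section

/-! ### The function `y ↦ exp (-y)` on `[0, ∞]` -/

/-! Attach to each node of the index tree a mark in `Config N → ℝ`, the contribution of its Gaussian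
variables to the Hamiltonian, with `H_N` included at the root. The marks along a path add up to
`H_t(·, α)`, so after summation over the spins the leaf `α` has mass `v_α F(state of α)` with `F =
partition`. Let `S` be the total mass and `Q_d` the sum of the products of masses over pairs of
leaves that agree on the first `d` levels. The normalization of the weights cancels, so the two
replicas agree on `d` levels with Gibbs probability `Q_d / S²`. It suffices that `E[Q_d / S²] = 1 -
m_d`; the claim is the difference for `d = r - 1` and `d = r`.

Suppose the weights `u_n` at the root form a Poisson process of intensity `e^(-1-θ) de`, and `S = ∑
u_n S_n` with `S_n` the sums of the subtrees. For a functional `A` of the subtree, the Mecke formula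
and a Gamma integral in `e` give `E[∑ u_n^b A_n exp(-lS)] = Γ(b-θ) l^(θ-b) E[A S'^(θ-b)]
E[exp(-lS)]`, where `S'` is the sum of one marked subtree. Integration against `l^(b-p-1) dl` yields
`Γ(b-p) E[∑ u_n^b A_n S^(p-b)] = Γ(b-θ) E[A S'^(θ-b)] J`, where `J` depends neither on `A` nor on
`b` (`gamma_mul_lintegral_lift`). Compare `b = 2`, `A = Q_(d-1)` with `b = 1`, `A = S'`. As `Γ(2-x)
= (1-x) Γ(1-x)`, the ratio of `(1-p) E[Q_d S^(p-2)]` to `E[S S^(p-1)]` is that of the subtree with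
`d - 1` for `d` and `θ` for `p`. After `d` steps from `p = 0` the exponent is `m_d`, `Q_0 = S²`, and
the ratio is `1 - m_d` (`lintegral_treeSq_mul_rpow`). These identities hold in `[0, ∞]`, without
integrability.

Two points remain. First, `0 < S < ∞` almost surely; finiteness comes from fractional moments
(`lintegral_treeSum_rpow_le`). Second, the Mecke formula does not fix the numbering of the points,
so `TreeLaw` allows the subtrees of different children to have different laws. The expectations used
are nevertheless equal, which is `LawInvariant`. -/

/-- The function `y ↦ exp (-y)` on `[0, ∞]`. -/
def nexp (y : ℝ≥0∞) : ℝ≥0∞ := (EReal.exp (y : EReal))⁻¹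

@[simp] lemma nexp_zero : nexp 0 = 1 := by simp [nexp]

@[simp] lemma nexp_top : nexp ⊤ = 0 := by simp [nexp]

lemma nexp_add (x y : ℝ≥0∞) : nexp (x + y) = nexp x * nexp y := by
  rw [nexp, nexp, nexp, EReal.coe_ennreal_add, EReal.exp_add, ENNReal.mul_inv]
  · left; simp
  · right; simp

lemma nexp_ofReal {y : ℝ} (hy : 0 ≤ y) : nexp (ENNReal.ofReal y) = ENNReal.ofReal (Real.exp (-y)) := by
  rw [nexp, EReal.coe_ennreal_ofReal, max_eq_left hy, EReal.exp_coe, Real.exp_neg,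
    ENNReal.ofReal_inv_of_pos (Real.exp_pos y)]

lemma nexp_antitone : Antitone nexp := fun _ _ h =>
  ENNReal.inv_le_inv.2 (EReal.exp_monotone (EReal.coe_ennreal_le_coe_ennreal_iff.2 h))

lemma nexp_le_one (y : ℝ≥0∞) : nexp y ≤ 1 := by
  simpa using nexp_antitone (zero_le : 0 ≤ y)

lemma nexp_ne_top (y : ℝ≥0∞) : nexp y ≠ ⊤ := ne_top_of_le_ne_top (by simp) (nexp_le_one y)

lemma continuous_nexp : Continuous nexp :=
  continuous_inv.comp (ENNReal.continuous_exp.comp continuous_coe_ennreal_ereal)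

@[fun_prop] lemma measurable_nexp : Measurable nexp := continuous_nexp.measurable

lemma nexp_sum {ι : Type*} (s : Finset ι) (f : ι → ℝ≥0∞) :
    nexp (∑ i ∈ s, f i) = ∏ i ∈ s, nexp (f i) := by
  induction s using Finset.cons_induction with
  | empty => simp
  | cons a s h ih => rw [Finset.sum_cons, Finset.prod_cons, nexp_add, ih]

lemma tendsto_nexp_sum_range (f : ℕ → ℝ≥0∞) :
    Filter.Tendsto (fun n => ∏ i ∈ Finset.range n, nexp (f i)) Filter.atTop
      (nhds (nexp (∑' i, f i))) := by
  simp_rw [← nexp_sum]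
  exact (continuous_nexp.tendsto _).comp (ENNReal.tendsto_nat_tsum f)

/-- The inverse of `nexp` on `[0, 1]`. -/
def nlog (h : ℝ≥0∞) : ℝ≥0∞ := (ENNReal.log h⁻¹).toENNReal

@[fun_prop] lemma measurable_nlog : Measurable nlog := by
  unfold nlog
  exact measurable_ereal_toENNReal.comp (ENNReal.measurable_log.comp measurable_inv)

lemma nexp_nlog {h : ℝ≥0∞} (hh : h ≤ 1) : nexp (nlog h) = h := by
  rw [nexp, nlog, EReal.coe_toENNReal, ENNReal.exp_log, inv_inv]
  rw [ENNReal.zero_le_log_iff]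
  exact ENNReal.one_le_inv.2 hh

/-- The Gamma integral `∫ t ^ (a - 1) exp (- t s) dt = Γ(a) s ^ (-a)` for `s ∈ [0, ∞]`. -/
lemma lintegral_rpow_mul_nexp {a : ℝ} (ha : 0 < a) (s : ℝ≥0∞) :
    ∫⁻ t in Set.Ioi (0 : ℝ), ENNReal.ofReal (t ^ (a - 1)) * nexp (ENNReal.ofReal t * s)
      = ENNReal.ofReal (Real.Gamma a) * s ^ (-a) := by
  have hG : 0 < Real.Gamma a := Real.Gamma_pos_of_pos ha
  have key : ∀ r : ℝ, 0 < r →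
      ∫⁻ t in Set.Ioi (0 : ℝ), ENNReal.ofReal (t ^ (a - 1)) * nexp (ENNReal.ofReal t * ENNReal.ofReal r)
      = ENNReal.ofReal (Real.Gamma a) * (ENNReal.ofReal r) ^ (-a) := by
    intro r hr
    have h1 := Real.integral_rpow_mul_exp_neg_mul_Ioi ha hr
    have h2 : ∀ t ∈ Set.Ioi (0 : ℝ), ENNReal.ofReal (t ^ (a - 1)) * nexp (ENNReal.ofReal t * ENNReal.ofReal r)
        = ENNReal.ofReal (t ^ (a - 1) * Real.exp (-(r * t))) := by
      intro t ht
      have ht' : 0 < t := ht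
      rw [← ENNReal.ofReal_mul ht'.le, nexp_ofReal (by positivity), ← ENNReal.ofReal_mul (by positivity),
        mul_comm t r]
    rw [setLIntegral_congr_fun measurableSet_Ioi h2, ← ofReal_integral_eq_lintegral_ofReal, h1,
      ENNReal.ofReal_rpow_of_pos hr, ← ENNReal.ofReal_mul hG.le, mul_comm, Real.rpow_neg hr.le,
      Real.div_rpow zero_le_one hr.le, Real.one_rpow, one_div]
    -- A non-integrable function would have Bochner integral `0`, but the Gamma formula gives a
    -- positive value.
    · by_contra hcon
      rw [integral_undef hcon] at h1
      have : 0 < (1 / r) ^ a * Real.Gamma a := by positivity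
      linarith
    · refine (ae_restrict_iff' measurableSet_Ioi).2 (Filter.Eventually.of_forall fun t ht => ?_)
      have ht' : 0 < t := ht
      simp only [Pi.zero_apply]
      positivity
  rcases eq_or_ne s 0 with rfl | h0
  -- For `s = 0` both sides are infinite: the left side dominates its values at `r = 1 / (n + 1)`,
  -- and these tend to `∞`.
  · rw [ENNReal.zero_rpow_of_neg (by linarith), ENNReal.mul_top (by simpa using hG), eq_top_iff]
    refine le_of_tendsto' (f := fun n : ℕ => ENNReal.ofReal (Real.Gamma a) *
      (ENNReal.ofReal (1 / ((n : ℝ) + 1))) ^ (-a)) (x := Filter.atTop) ?_ fun n => ?_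
    · have h3 : Filter.Tendsto (fun n : ℕ => ENNReal.ofReal (1 / ((n : ℝ) + 1))) Filter.atTop (nhds 0) := by
        simpa using ENNReal.tendsto_ofReal tendsto_one_div_add_atTop_nhds_zero_nat
      have h4 := ENNReal.Tendsto.const_mul (a := ENNReal.ofReal (Real.Gamma a))
        (((ENNReal.continuous_rpow_const (y := -a)).tendsto 0).comp h3) (Or.inr ENNReal.ofReal_ne_top)
      rwa [ENNReal.zero_rpow_of_neg (by linarith), ENNReal.mul_top (by simpa using hG)] at h4
    · rw [← key _ (by positivity)]
      refine lintegral_mono fun t => ?_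
      gcongr
      exact nexp_antitone (by simp)
  rcases eq_or_ne s ⊤ with rfl | h1
  · rw [ENNReal.top_rpow_of_neg (by linarith), mul_zero]
    refine (setLIntegral_congr_fun measurableSet_Ioi fun t ht => ?_).trans lintegral_zero
    have ht' : 0 < t := ht
    rw [ENNReal.mul_top (by simpa using ht'), nexp_top, mul_zero]
  · have := key s.toReal (ENNReal.toReal_pos h0 h1)
    rwa [ENNReal.ofReal_toReal h1] at this

end

section

/-! ### Laplace functional and Mecke formula of a Poisson point process -/

lemma lintegral_poissonMeasure (r : NNReal) (f : ℕ → ℝ≥0∞) :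
    ∫⁻ n, f n ∂(poissonMeasure r) =
      ∑' n, ENNReal.ofReal (Real.exp (-r) * r ^ n / n.factorial) * f n := by
  rw [poissonMeasure, lintegral_sum_measure]
  simp [lintegral_smul_measure]

lemma lintegral_pow_poissonMeasure (r : NNReal) {h : ℝ≥0∞} (hh : h ≤ 1) :
    ∫⁻ n, h ^ n ∂(poissonMeasure r) = nexp ((1 - h) * r) := by
  lift h to NNReal using ne_top_of_le_ne_top (by simp) hh
  have hh' : (h : ℝ) ≤ 1 := by exact_mod_cast hh
  have h1 : (1 - (h : ℝ≥0∞)) * r = ENNReal.ofReal ((1 - h) * r) := by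
    rw [ENNReal.ofReal_mul (by linarith), ENNReal.ofReal_sub _ h.coe_nonneg]
    simp
  have h2 : ∀ n : ℕ, ENNReal.ofReal (Real.exp (-r) * r ^ n / n.factorial) * (h : ℝ≥0∞) ^ n
      = ENNReal.ofReal (Real.exp (-r) * ((r * h) ^ n / n.factorial)) := by
    intro n
    rw [← ENNReal.ofReal_coe_nnreal (p := h), ← ENNReal.ofReal_pow h.coe_nonneg,
      ← ENNReal.ofReal_mul (by positivity)]
    congr 1
    rw [mul_pow]; ring
  have h3 := (NormedSpace.expSeries_div_hasSum_exp ((r : ℝ) * h)).mul_left (Real.exp (-r))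
  rw [lintegral_poissonMeasure, h1, nexp_ofReal (mul_nonneg (by linarith) r.coe_nonneg)]
  simp_rw [h2]
  rw [← ENNReal.ofReal_tsum_of_nonneg (fun n => by positivity) h3.summable, h3.tsum_eq,
    ← Real.exp_eq_exp_ℝ, ← Real.exp_add]
  congr 2; ring

/-- Size biasing: `n r^n / n! = r · r^(n-1) / (n-1)!` shifts the Poisson sum by one. This shift is
the source of the Mecke formula. -/
lemma lintegral_mul_pow_poissonMeasure (r : NNReal) {h : ℝ≥0∞} (hh : h ≤ 1) :
    ∫⁻ n, n * h ^ n ∂(poissonMeasure r) = r * h * nexp ((1 - h) * r) := by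
  rw [← lintegral_pow_poissonMeasure r hh, lintegral_poissonMeasure, lintegral_poissonMeasure,
    tsum_eq_zero_add' ENNReal.summable, ← ENNReal.tsum_mul_left]
  simp only [Nat.cast_zero, zero_mul, mul_zero, zero_add]
  congr 1
  ext n
  have : ENNReal.ofReal (Real.exp (-r) * r ^ (n + 1) / (n + 1).factorial) * ((n + 1 : ℕ) : ℝ≥0∞)
      = r * ENNReal.ofReal (Real.exp (-r) * r ^ n / n.factorial) := by
    rw [← ENNReal.ofReal_coe_nnreal (p := r), ← ENNReal.ofReal_natCast,
      ← ENNReal.ofReal_mul (by positivity), ← ENNReal.ofReal_mul r.coe_nonneg]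
    congr 1
    rw [Nat.factorial_succ]
    push_cast
    have : ((n : ℝ) + 1) ≠ 0 := by positivity
    field_simp
    ring
  rw [← mul_assoc, this, pow_succ]
  ring

lemma tsum_indicator_eq_pointCount {Ω E : Type*} (x : ℕ → Ω → E) (A : Set E) (c : ℝ≥0∞) (ω : Ω) :
    ∑' n, A.indicator (fun _ => c) (x n ω) = (pointCount x A ω : ℝ≥0∞) * c := by
  rw [pointCount, ← ENNReal.tsum_set_const, tsum_subtype _ (fun _ => c)]
  rfl

variable {Ω E : Type*} [MeasurableSpace Ω] [MeasurableSpace E]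

namespace IsPoissonPointProcess

variable {P : Measure Ω} {μ : Measure E} {x : ℕ → Ω → E}

lemma measurable_pointCount (hx : IsPoissonPointProcess P μ x) {A : Set E}
    (hA : MeasurableSet A) : Measurable (fun ω => (pointCount x A ω : ℝ≥0∞)) := by
  have : (fun ω => (pointCount x A ω : ℝ≥0∞))
      = fun ω => ∑' n, A.indicator (fun _ => (1 : ℝ≥0∞)) (x n ω) := by
    ext ω; rw [tsum_indicator_eq_pointCount, mul_one]
  rw [this]
  exact Measurable.tsum fun n => (measurable_const.indicator hA).comp (hx.measurable n)

lemma lintegral_pointCount (hx : IsPoissonPointProcess P μ x) {A : Set E}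
    (hA : MeasurableSet A) (hA' : μ A ≠ ⊤) (f : ℝ≥0∞ → ℝ≥0∞) :
    ∫⁻ ω, f (pointCount x A ω) ∂P = ∫⁻ n : ℕ, f n ∂(poissonMeasure (μ A).toNNReal) := by
  have h := hx.law_count A hA hA'
  have := h.map_eq
  calc ∫⁻ ω, f (pointCount x A ω) ∂P
      = ∫⁻ j : ℕ∞, f j ∂(P.map (pointCount x A)) := by
        rw [lintegral_map' (Measurable.of_discrete).aemeasurable h.aemeasurable]
    _ = _ := by
        rw [this, lintegral_map Measurable.of_discrete Measurable.of_discrete]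
        simp

lemma lintegral_nexp_pointCount (hx : IsPoissonPointProcess P μ x) {A : Set E}
    (hA : MeasurableSet A) (hA' : μ A ≠ ⊤) (c : ℝ≥0∞) :
    ∫⁻ ω, nexp (pointCount x A ω * c) ∂P = nexp ((1 - nexp c) * μ A) := by
  rw [hx.lintegral_pointCount hA hA' (fun y => nexp (y * c))]
  have : ∀ n : ℕ, nexp (n * c) = nexp c ^ n := by
    intro n
    simpa using nexp_sum (Finset.range n) (fun _ => c)
  simp_rw [this]
  rw [lintegral_pow_poissonMeasure _ (nexp_le_one c), ENNReal.coe_toNNReal hA']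

lemma lintegral_pointCount_mul_nexp (hx : IsPoissonPointProcess P μ x) {A : Set E}
    (hA : MeasurableSet A) (hA' : μ A ≠ ⊤) (c : ℝ≥0∞) :
    ∫⁻ ω, pointCount x A ω * nexp (pointCount x A ω * c) ∂P
      = μ A * nexp c * nexp ((1 - nexp c) * μ A) := by
  rw [hx.lintegral_pointCount hA hA' (fun y => y * nexp (y * c))]
  have : ∀ n : ℕ, nexp (n * c) = nexp c ^ n := by
    intro n
    simpa using nexp_sum (Finset.range n) (fun _ => c)
  simp_rw [this]
  rw [lintegral_mul_pow_poissonMeasure _ (nexp_le_one c), ENNReal.coe_toNNReal hA']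

lemma iIndepFun_pointCount (hx : IsPoissonPointProcess P μ x) {ι : Type*} [Fintype ι]
    {A : ι → Set E} (hA : ∀ i, MeasurableSet (A i))
    (hd : Pairwise (fun i j => Disjoint (A i) (A j))) :
    iIndepFun (fun i ω => pointCount x (A i) ω) P := by
  let e := Fintype.equivFin ι
  have h := hx.indep_count (Fintype.card ι) (fun i => A (e.symm i)) (fun i => hA _)
    (fun i j hij => hd (fun h => hij (e.symm.injective h)))
  have h2 := h.precomp e.injective
  simpa using h2

/-- Laplace functional and Mecke formula for step functions. -/
lemma lintegral_step (hx : IsPoissonPointProcess P μ x) {ι : Type*} [Fintype ι]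
    {A : ι → Set E} (hA : ∀ i, MeasurableSet (A i)) (hA' : ∀ i, μ (A i) ≠ ⊤)
    (hd : Pairwise (fun i j => Disjoint (A i) (A j))) (b c : ι → ℝ≥0∞) :
    ∫⁻ ω, nexp (∑ i, pointCount x (A i) ω * c i) ∂P = nexp (∑ i, (1 - nexp (c i)) * μ (A i)) ∧
    ∫⁻ ω, (∑ i, pointCount x (A i) ω * b i) * nexp (∑ i, pointCount x (A i) ω * c i) ∂P =
      (∑ i, b i * nexp (c i) * μ (A i)) * nexp (∑ i, (1 - nexp (c i)) * μ (A i)) := by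
  classical
  have hind := hx.iIndepFun_pointCount hA hd
  have hm := fun i => hx.measurable_pointCount (hA i)
  constructor
  · simp_rw [nexp_sum]
    rw [lintegral_prod_eq_prod_lintegral_of_indepFun Finset.univ
      (fun i ω => nexp (pointCount x (A i) ω * c i))
      (hind.comp (fun i (y : ℕ∞) => nexp (y * c i)) (fun i => Measurable.of_discrete))
      (fun i => measurable_nexp.comp ((hm i).mul_const _))]
    exact Finset.prod_congr rfl fun i _ => hx.lintegral_nexp_pointCount (hA i) (hA' i) (c i)
  · have key : ∀ i₀, ∫⁻ ω, pointCount x (A i₀) ω * nexp (∑ i, pointCount x (A i) ω * c i) ∂P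
        = nexp (c i₀) * μ (A i₀) * nexp (∑ i, (1 - nexp (c i)) * μ (A i)) := by
      intro i₀
      -- The extra count is absorbed into the factor of index `i₀`, so that the integrand is a
      -- product over independent counts.
      have h1 : ∀ ω, (pointCount x (A i₀) ω : ℝ≥0∞) * nexp (∑ i, pointCount x (A i) ω * c i)
          = ∏ i, (if i = i₀ then (pointCount x (A i) ω : ℝ≥0∞) else 1)
              * nexp (pointCount x (A i) ω * c i) := by
        intro ω
        rw [Finset.prod_mul_distrib, Finset.prod_ite_eq' , nexp_sum]
        simp
      simp_rw [h1]
      rw [lintegral_prod_eq_prod_lintegral_of_indepFun Finset.univ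
        (fun i ω => (if i = i₀ then (pointCount x (A i) ω : ℝ≥0∞) else 1)
              * nexp (pointCount x (A i) ω * c i))
        (hind.comp (fun i (y : ℕ∞) => (if i = i₀ then (y : ℝ≥0∞) else 1) * nexp (y * c i))
          (fun i => Measurable.of_discrete))
        (fun i => ?_)]
      · have h2 : ∀ i, ∫⁻ ω, (if i = i₀ then (pointCount x (A i) ω : ℝ≥0∞) else 1)
              * nexp (pointCount x (A i) ω * c i) ∂P
            = (if i = i₀ then nexp (c i) * μ (A i) else 1) * nexp ((1 - nexp (c i)) * μ (A i)) := by
          intro i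
          split_ifs with h
          · rw [hx.lintegral_pointCount_mul_nexp (hA i) (hA' i) (c i), mul_comm (μ (A i))]
          · simp_rw [one_mul]
            exact hx.lintegral_nexp_pointCount (hA i) (hA' i) (c i)
        simp_rw [h2]
        rw [Finset.prod_mul_distrib, Finset.prod_ite_eq', nexp_sum]
        simp
      · refine Measurable.mul ?_ (measurable_nexp.comp ((hm i).mul_const _))
        split_ifs
        exacts [hm i, measurable_const]
    simp_rw [Finset.sum_mul]
    rw [lintegral_finsetSum]
    · refine Finset.sum_congr rfl fun i _ => ?_
      have : ∀ ω, (pointCount x (A i) ω : ℝ≥0∞) * b i * nexp (∑ i, pointCount x (A i) ω * c i)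
          = b i * (pointCount x (A i) ω * nexp (∑ i, pointCount x (A i) ω * c i)) := by
        intro ω; ring
      simp_rw [this]
      rw [lintegral_const_mul, key i]
      · ring
      · exact (hm i).mul (measurable_nexp.comp (Finset.measurable_sum _ fun j _ => (hm j).mul_const _))
    · intro i _
      exact ((hm i).mul_const _).mul
        (measurable_nexp.comp (Finset.measurable_sum _ fun j _ => (hm j).mul_const _))

/-- Laplace functional and Mecke formula for simple functions with support of finite measure. -/
lemma lintegral_simple (hx : IsPoissonPointProcess P μ x) (φ : SimpleFunc E (ℝ≥0∞ × ℝ≥0∞))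
    {K : Set E} (hK : MeasurableSet K) (hK' : μ K ≠ ⊤) :
    ∫⁻ ω, nexp (∑' n, K.indicator (fun y => (φ y).2) (x n ω)) ∂P
      = nexp (∫⁻ y, 1 - nexp (K.indicator (fun y => (φ y).2) y) ∂μ) ∧
    ∫⁻ ω, (∑' n, K.indicator (fun y => (φ y).1) (x n ω))
        * nexp (∑' n, K.indicator (fun y => (φ y).2) (x n ω)) ∂P
      = (∫⁻ y, K.indicator (fun y => (φ y).1) y * nexp (K.indicator (fun y => (φ y).2) y) ∂μ)
        * nexp (∫⁻ y, 1 - nexp (K.indicator (fun y => (φ y).2) y) ∂μ) := by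
  classical
  -- The level sets of the pair are disjoint cells on which both coordinates are constant.
  let A : φ.range → Set E := fun v => φ ⁻¹' {v.1} ∩ K
  have hA : ∀ v, MeasurableSet (A v) := fun v => (φ.measurableSet_fiber _).inter hK
  have hA' : ∀ v, μ (A v) ≠ ⊤ := fun v => ne_top_of_le_ne_top hK' (measure_mono Set.inter_subset_right)
  have hd : Pairwise (fun i j => Disjoint (A i) (A j)) := by
    intro v w hvw
    refine Set.disjoint_left.2 fun y hy hy' => hvw (Subtype.ext ?_)
    exact hy.1.symm.trans hy'.1
  have expand : ∀ (g : ℝ≥0∞ × ℝ≥0∞ → ℝ≥0∞) (y : E), K.indicator (fun y => g (φ y)) y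
      = ∑ v, (A v).indicator (fun _ => g v.1) y := by
    intro g y
    by_cases hy : y ∈ K
    · rw [Finset.sum_eq_single_of_mem (⟨φ y, φ.mem_range_self y⟩ : φ.range) (Finset.mem_univ _)]
      · simp [A, hy]
      · intro w _ hw
        refine Set.indicator_of_notMem (fun h => hw (Subtype.ext ?_)) _
        exact h.1.symm
    · rw [Set.indicator_of_notMem hy]
      symm
      refine Finset.sum_eq_zero fun v _ => Set.indicator_of_notMem (fun h => hy h.2) _
  have hsum : ∀ (g : ℝ≥0∞ × ℝ≥0∞ → ℝ≥0∞) (ω : Ω), ∑' n, K.indicator (fun y => g (φ y)) (x n ω)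
      = ∑ v, pointCount x (A v) ω * g v.1 := by
    intro g ω
    simp_rw [expand g]
    rw [Summable.tsum_finsetSum (fun _ _ => ENNReal.summable)]
    simp_rw [tsum_indicator_eq_pointCount]
  have hint : ∀ (g : ℝ≥0∞ × ℝ≥0∞ → ℝ≥0∞), ∫⁻ y, K.indicator (fun y => g (φ y)) y ∂μ
      = ∑ v, g v.1 * μ (A v) := by
    intro g
    simp_rw [expand g]
    rw [lintegral_finsetSum _ (fun v _ => measurable_const.indicator (hA v))]
    simp_rw [lintegral_indicator_const (hA _)]
  obtain ⟨h1, h2⟩ := hx.lintegral_step hA hA' hd (fun v => v.1.1) (fun v => v.1.2)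
  have e1 : ∫⁻ y, 1 - nexp (K.indicator (fun y => (φ y).2) y) ∂μ
      = ∑ v : φ.range, (1 - nexp v.1.2) * μ (A v) := by
    rw [← hint (fun p => 1 - nexp p.2)]
    refine lintegral_congr fun y => ?_
    by_cases hy : y ∈ K <;> simp [hy]
  have e2 : ∫⁻ y, K.indicator (fun y => (φ y).1) y * nexp (K.indicator (fun y => (φ y).2) y) ∂μ
      = ∑ v : φ.range, v.1.1 * nexp v.1.2 * μ (A v) := by
    rw [← hint (fun p => p.1 * nexp p.2)]
    refine lintegral_congr fun y => ?_
    by_cases hy : y ∈ K <;> simp [hy]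
  rw [e1, e2]
  simp_rw [hsum (fun p => p.1), hsum (fun p => p.2)]
  exact ⟨h1, h2⟩

end IsPoissonPointProcess

end

/-! ### From step functions to the Mecke formula -/

section

/-- The law `ρ` of a random sequence satisfies the formulas for the Laplace functional and the
reduced Campbell measure of a Poisson point process with intensity `μ`. -/
structure IsMecke {E : Type*} [MeasurableSpace E] (μ : Measure E) (ρ : Measure (ℕ → E)) :
    Prop where
  prob : IsProbabilityMeasure ρ
  laplace : ∀ ψ : E → ℝ≥0∞, Measurable ψ →
    ∫⁻ y, nexp (∑' n, ψ (y n)) ∂ρ = nexp (∫⁻ e, 1 - nexp (ψ e) ∂μ)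
  mecke : ∀ f ψ : E → ℝ≥0∞, Measurable f → Measurable ψ →
    ∫⁻ y, (∑' n, f (y n)) * nexp (∑' n, ψ (y n)) ∂ρ
      = (∫⁻ e, f e * nexp (ψ e) ∂μ) * ∫⁻ y, nexp (∑' n, ψ (y n)) ∂ρ

lemma tendsto_tsum_of_monotone {f : ℕ → ℕ → ℝ≥0∞} {g : ℕ → ℝ≥0∞}
    (hf : ∀ n, Monotone fun k => f k n)
    (hg : ∀ n, Filter.Tendsto (fun k => f k n) Filter.atTop (nhds (g n))) :
    Filter.Tendsto (fun k => ∑' n, f k n) Filter.atTop (nhds (∑' n, g n)) := by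
  simp_rw [← lintegral_count]
  exact lintegral_tendsto_of_tendsto_of_monotone (fun k => Measurable.of_discrete.aemeasurable)
    (Filter.Eventually.of_forall hf) (Filter.Eventually.of_forall hg)

section Approximation

variable {E : Type*} [MeasurableSpace E]

/-- A monotone approximation of `f` by simple functions with support of finite measure. -/
def finApprox (μ : Measure E) [SigmaFinite μ] (f : E → ℝ≥0∞) (k : ℕ) : E → ℝ≥0∞ :=
  (spanningSets μ k).indicator (SimpleFunc.eapprox f k)

variable (μ : Measure E) [SigmaFinite μ] (f : E → ℝ≥0∞)

lemma finApprox_mono (e : E) : Monotone fun k => finApprox μ f k e := by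
  intro j k hjk
  refine (Set.indicator_le_indicator_of_subset (monotone_spanningSets μ hjk)
    (fun _ => zero_le) e).trans ?_
  exact Set.indicator_le_indicator (SimpleFunc.monotone_eapprox f hjk e)

lemma measurable_finApprox (k : ℕ) : Measurable (finApprox μ f k) :=
  (SimpleFunc.measurable _).indicator (measurableSet_spanningSets μ k)

lemma tendsto_finApprox (hf : Measurable f) (e : E) :
    Filter.Tendsto (fun k => finApprox μ f k e) Filter.atTop (nhds (f e)) := by
  have h1 : Filter.Tendsto (fun k => SimpleFunc.eapprox f k e) Filter.atTop (nhds (f e)) := by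
    have := tendsto_atTop_iSup (fun j k hjk => SimpleFunc.monotone_eapprox f hjk e :
      Monotone fun k => SimpleFunc.eapprox f k e)
    rwa [SimpleFunc.iSup_eapprox_apply hf] at this
  refine h1.congr' ?_
  filter_upwards [Filter.eventually_ge_atTop (spanningSetsIndex μ e)] with k hk
  rw [finApprox, Set.indicator_of_mem]
  exact monotone_spanningSets μ hk (mem_spanningSetsIndex μ e)

lemma lintegral_finApprox_ne_top (k : ℕ) : ∫⁻ e, finApprox μ f k e ∂μ ≠ ⊤ := by
  set g := SimpleFunc.eapprox f k
  set C := g.range.sup id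
  have hC : C < ⊤ := by
    refine (Finset.sup_lt_iff ENNReal.zero_lt_top).2 fun v hv => ?_
    obtain ⟨e, rfl⟩ := SimpleFunc.mem_range.1 hv
    exact SimpleFunc.eapprox_lt_top f k e
  have hle : ∀ e, finApprox μ f k e ≤ (spanningSets μ k).indicator (fun _ => C) e := fun e =>
    Set.indicator_le_indicator (Finset.le_sup (f := id) (g.mem_range_self e))
  refine ne_top_of_le_ne_top ?_ (lintegral_mono hle)
  rw [lintegral_indicator_const (measurableSet_spanningSets μ k)]
  exact ENNReal.mul_ne_top hC.ne (measure_spanningSets_lt_top μ k).ne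

end Approximation

namespace IsPoissonPointProcess

variable {Ω E : Type*} [MeasurableSpace Ω] [MeasurableSpace E]
  {P : Measure Ω} {μ : Measure E} {x : ℕ → Ω → E}

lemma measurable_tsum_comp (hx : IsPoissonPointProcess P μ x) {f : E → ℝ≥0∞} (hf : Measurable f) :
    Measurable fun ω => ∑' n, f (x n ω) :=
  Measurable.tsum fun n => hf.comp (hx.measurable n)

variable [SigmaFinite μ]

/-- The two cut-offs are kept separate because the limit in `k` is taken before the limit in `j`.
Since `j ≤ k`, both functions live on the `k`-th spanning set. -/
lemma lintegral_finApprox (hx : IsPoissonPointProcess P μ x) (f ψ : E → ℝ≥0∞) {j k : ℕ}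
    (hjk : j ≤ k) :
    ∫⁻ ω, nexp (∑' n, finApprox μ ψ k (x n ω)) ∂P
      = nexp (∫⁻ y, 1 - nexp (finApprox μ ψ k y) ∂μ) ∧
    ∫⁻ ω, (∑' n, finApprox μ f j (x n ω)) * nexp (∑' n, finApprox μ ψ k (x n ω)) ∂P
      = (∫⁻ y, finApprox μ f j y * nexp (finApprox μ ψ k y) ∂μ)
        * nexp (∫⁻ y, 1 - nexp (finApprox μ ψ k y) ∂μ) := by
  have h := hx.lintegral_simple
    (((SimpleFunc.eapprox f j).restrict (spanningSets μ j)).pair (SimpleFunc.eapprox ψ k))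
    (measurableSet_spanningSets μ k) (measure_spanningSets_lt_top μ k).ne
  have e1 : (spanningSets μ k).indicator
      (fun y => ((((SimpleFunc.eapprox f j).restrict (spanningSets μ j)).pair
        (SimpleFunc.eapprox ψ k)) y).1) = finApprox μ f j := by
    have : (fun y => ((((SimpleFunc.eapprox f j).restrict (spanningSets μ j)).pair
        (SimpleFunc.eapprox ψ k)) y).1) = (spanningSets μ j).indicator (SimpleFunc.eapprox f j) := by
      ext y
      simp [SimpleFunc.restrict_apply _ (measurableSet_spanningSets μ j)]
    rw [this, Set.indicator_indicator, Set.inter_eq_right.2 (monotone_spanningSets μ hjk)]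
    rfl
  have e2 : (spanningSets μ k).indicator
      (fun y => ((((SimpleFunc.eapprox f j).restrict (spanningSets μ j)).pair
        (SimpleFunc.eapprox ψ k)) y).2) = finApprox μ ψ k := rfl
  rw [e1, e2] at h
  exact h

lemma lintegral_nexp_tsum [IsProbabilityMeasure P] (hx : IsPoissonPointProcess P μ x)
    {ψ : E → ℝ≥0∞} (hψ : Measurable ψ) :
    ∫⁻ ω, nexp (∑' n, ψ (x n ω)) ∂P = nexp (∫⁻ y, 1 - nexp (ψ y) ∂μ) := by
  refine tendsto_nhds_unique
    (f := fun k => ∫⁻ ω, nexp (∑' n, finApprox μ ψ k (x n ω)) ∂P) (l := Filter.atTop) ?_ ?_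
  · refine tendsto_lintegral_of_dominated_convergence (fun _ => 1) (fun k => ?_) (fun k => ?_) ?_ ?_
    · exact measurable_nexp.comp (hx.measurable_tsum_comp (measurable_finApprox μ ψ k))
    · exact Filter.Eventually.of_forall fun ω => nexp_le_one _
    · simp
    · refine Filter.Eventually.of_forall fun ω => (continuous_nexp.tendsto _).comp ?_
      exact tendsto_tsum_of_monotone (fun n => finApprox_mono μ ψ _)
        (fun n => tendsto_finApprox μ ψ hψ _)
  · simp_rw [fun k => (hx.lintegral_finApprox ψ ψ (le_refl k)).1]
    refine (continuous_nexp.tendsto _).comp ?_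
    refine lintegral_tendsto_of_tendsto_of_monotone (fun k => ?_)
      (Filter.Eventually.of_forall fun e j k hjk => ?_) (Filter.Eventually.of_forall fun e => ?_)
    · exact (measurable_const.sub (measurable_nexp.comp (measurable_finApprox μ ψ k))).aemeasurable
    · exact tsub_le_tsub_left (nexp_antitone (finApprox_mono μ ψ e hjk)) _
    · exact ENNReal.Tendsto.sub tendsto_const_nhds
        ((continuous_nexp.tendsto _).comp (tendsto_finApprox μ ψ hψ e)) (Or.inl (by simp))

lemma lintegral_tsum_finApprox (hx : IsPoissonPointProcess P μ x) (f : E → ℝ≥0∞) (j : ℕ) :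
    ∫⁻ ω, ∑' n, finApprox μ f j (x n ω) ∂P = ∫⁻ y, finApprox μ f j y ∂μ := by
  have h := (hx.lintegral_finApprox f (fun _ => 0) (le_refl j)).2
  have h0 : finApprox μ (fun _ : E => (0 : ℝ≥0∞)) j = fun _ => 0 := by
    ext e
    refine le_antisymm ?_ zero_le
    have := (finApprox_mono μ (fun _ => 0) e).ge_of_tendsto
      (tendsto_finApprox μ (fun _ => 0) measurable_const e) j
    exact this
  simpa [h0] using h

lemma lintegral_tsum_mul_nexp_tsum [IsProbabilityMeasure P] (hx : IsPoissonPointProcess P μ x)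
    {f ψ : E → ℝ≥0∞} (hf : Measurable f) (hψ : Measurable ψ) :
    ∫⁻ ω, (∑' n, f (x n ω)) * nexp (∑' n, ψ (x n ω)) ∂P
      = (∫⁻ y, f y * nexp (ψ y) ∂μ) * nexp (∫⁻ y, 1 - nexp (ψ y) ∂μ) := by
  -- The limit in `ψ` is not monotone increasing for the integrand, so it is taken by domination.
  -- The bound is the sum for `finApprox μ f j`, which has finite mean. Monotone convergence then
  -- handles `j`.
  have step : ∀ j, ∫⁻ ω, (∑' n, finApprox μ f j (x n ω)) * nexp (∑' n, ψ (x n ω)) ∂P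
      = (∫⁻ y, finApprox μ f j y * nexp (ψ y) ∂μ) * nexp (∫⁻ y, 1 - nexp (ψ y) ∂μ) := by
    intro j
    have hfin : ∫⁻ ω, ∑' n, finApprox μ f j (x n ω) ∂P ≠ ⊤ := by
      rw [hx.lintegral_tsum_finApprox]
      exact lintegral_finApprox_ne_top μ f j
    have hmf := hx.measurable_tsum_comp (measurable_finApprox μ f j)
    refine tendsto_nhds_unique (f := fun k => ∫⁻ ω, (∑' n, finApprox μ f j (x n ω)) *
      nexp (∑' n, finApprox μ ψ k (x n ω)) ∂P) (l := Filter.atTop) ?_ ?_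
    · refine tendsto_lintegral_of_dominated_convergence
        (fun ω => ∑' n, finApprox μ f j (x n ω)) (fun k => ?_) (fun k => ?_) hfin ?_
      · exact hmf.mul (measurable_nexp.comp (hx.measurable_tsum_comp (measurable_finApprox μ ψ k)))
      · exact Filter.Eventually.of_forall fun ω => mul_le_of_le_one_right' (nexp_le_one _)
      · filter_upwards [ae_lt_top hmf hfin] with ω hω
        refine ENNReal.Tendsto.const_mul ((continuous_nexp.tendsto _).comp ?_) (Or.inr hω.ne)
        exact tendsto_tsum_of_monotone (fun n => finApprox_mono μ ψ _)
          (fun n => tendsto_finApprox μ ψ hψ _)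
    · have hlim1 : Filter.Tendsto (fun k => ∫⁻ y, finApprox μ f j y * nexp (finApprox μ ψ k y) ∂μ)
          Filter.atTop (nhds (∫⁻ y, finApprox μ f j y * nexp (ψ y) ∂μ)) := by
        refine tendsto_lintegral_of_dominated_convergence (finApprox μ f j)
          (fun k => ?_) (fun k => ?_) (lintegral_finApprox_ne_top μ f j) ?_
        · exact (measurable_finApprox μ f j).mul (measurable_nexp.comp (measurable_finApprox μ ψ k))
        · exact Filter.Eventually.of_forall fun ω => mul_le_of_le_one_right' (nexp_le_one _)
        · filter_upwards [ae_lt_top (measurable_finApprox μ f j)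
            (lintegral_finApprox_ne_top μ f j)] with e he
          exact ENNReal.Tendsto.const_mul
            ((continuous_nexp.tendsto _).comp (tendsto_finApprox μ ψ hψ e)) (Or.inr he.ne)
      have hlim2 : Filter.Tendsto (fun k => nexp (∫⁻ y, 1 - nexp (finApprox μ ψ k y) ∂μ))
          Filter.atTop (nhds (nexp (∫⁻ y, 1 - nexp (ψ y) ∂μ))) := by
        refine (continuous_nexp.tendsto _).comp ?_
        refine lintegral_tendsto_of_tendsto_of_monotone (fun k => ?_)
          (Filter.Eventually.of_forall fun e j k hjk => ?_) (Filter.Eventually.of_forall fun e => ?_)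
        · exact (measurable_const.sub
            (measurable_nexp.comp (measurable_finApprox μ ψ k))).aemeasurable
        · exact tsub_le_tsub_left (nexp_antitone (finApprox_mono μ ψ e hjk)) _
        · exact ENNReal.Tendsto.sub tendsto_const_nhds
            ((continuous_nexp.tendsto _).comp (tendsto_finApprox μ ψ hψ e)) (Or.inl (by simp))
      have hne : ∫⁻ y, finApprox μ f j y * nexp (ψ y) ∂μ ≠ ⊤ :=
        ne_top_of_le_ne_top (lintegral_finApprox_ne_top μ f j)
          (lintegral_mono fun e => mul_le_of_le_one_right' (nexp_le_one _))
      refine (ENNReal.Tendsto.mul hlim1 (Or.inr (nexp_ne_top _)) hlim2 (Or.inr hne)).congr' ?_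
      filter_upwards [Filter.eventually_ge_atTop j] with k hk
      exact (hx.lintegral_finApprox f ψ hk).2.symm
  refine tendsto_nhds_unique (f := fun j => ∫⁻ ω, (∑' n, finApprox μ f j (x n ω)) *
      nexp (∑' n, ψ (x n ω)) ∂P) (l := Filter.atTop) ?_ ?_
  · refine lintegral_tendsto_of_tendsto_of_monotone (fun k => ?_)
      (Filter.Eventually.of_forall fun ω j k hjk => ?_) (Filter.Eventually.of_forall fun ω => ?_)
    · exact ((hx.measurable_tsum_comp (measurable_finApprox μ f k)).mul
        (measurable_nexp.comp (hx.measurable_tsum_comp hψ))).aemeasurable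
    · exact mul_le_mul_left (ENNReal.tsum_le_tsum fun n => finApprox_mono μ f _ hjk) _
    · exact ENNReal.Tendsto.mul_const (tendsto_tsum_of_monotone (fun n => finApprox_mono μ f _)
          (fun n => tendsto_finApprox μ f hf _)) (Or.inr (nexp_ne_top _))
  · simp_rw [step]
    refine ENNReal.Tendsto.mul_const ?_ (Or.inr (nexp_ne_top _))
    refine lintegral_tendsto_of_tendsto_of_monotone (fun k => ?_)
      (Filter.Eventually.of_forall fun e j k hjk => ?_) (Filter.Eventually.of_forall fun e => ?_)
    · exact ((measurable_finApprox μ f k).mul (measurable_nexp.comp hψ)).aemeasurable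
    · exact mul_le_mul_left (finApprox_mono μ f _ hjk) _
    · exact ENNReal.Tendsto.mul_const (tendsto_finApprox μ f hf _) (Or.inr (nexp_ne_top _))

/-- The law of an enumeration of a Poisson point process satisfies the Mecke formula. -/
theorem isMecke_map [IsProbabilityMeasure P] (hx : IsPoissonPointProcess P μ x) :
    IsMecke μ (P.map fun ω n => x n ω) := by
  have hm : Measurable fun ω n => x n ω := measurable_pi_lambda _ hx.measurable
  have hs : ∀ f : E → ℝ≥0∞, Measurable f → Measurable fun y : ℕ → E => ∑' n, f (y n) :=
    fun f hf => Measurable.tsum fun n => hf.comp (measurable_pi_apply n)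
  have hl : ∀ ψ : E → ℝ≥0∞, Measurable ψ →
      ∫⁻ y, nexp (∑' n, ψ (y n)) ∂(P.map fun ω n => x n ω) = nexp (∫⁻ e, 1 - nexp (ψ e) ∂μ) := by
    intro ψ hψ
    rw [lintegral_map (f := fun y => nexp (∑' n, ψ (y n))) (measurable_nexp.comp (hs ψ hψ)) hm]
    exact hx.lintegral_nexp_tsum hψ
  refine ⟨Measure.isProbabilityMeasure_map hm.aemeasurable, hl, fun f ψ hf hψ => ?_⟩
  rw [hl ψ hψ, lintegral_map
    (f := fun y => (∑' n, f (y n)) * nexp (∑' n, ψ (y n))) ((hs f hf).mul (measurable_nexp.comp (hs ψ hψ))) hm]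
  exact hx.lintegral_tsum_mul_nexp_tsum hf hψ

end IsPoissonPointProcess

end

section

/-! ### Independent marks -/

section Marks

variable {Y : Type*} [MeasurableSpace Y] (ν : ℕ → Measure Y) [∀ n, IsProbabilityMeasure (ν n)]

lemma lintegral_infinitePi_prod (s : Finset ℕ) {F : ℕ → Y → ℝ≥0∞} (hF : ∀ n, Measurable (F n)) :
    ∫⁻ y, ∏ n ∈ s, F n (y n) ∂(Measure.infinitePi ν) = ∏ n ∈ s, ∫⁻ y, F n y ∂(ν n) := by
  rw [lintegral_prod_eq_prod_lintegral_of_indepFun s (fun n (y : ℕ → Y) => F n (y n))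
    (iIndepFun_infinitePi (P := ν) (X := F) hF) (fun n => (hF n).comp (measurable_pi_apply n))]
  refine Finset.prod_congr rfl fun n _ => ?_
  rw [← lintegral_map (hF n) (measurable_pi_apply n), Measure.infinitePi_map_eval]

lemma lintegral_infinitePi_eval (n : ℕ) {f : Y → ℝ≥0∞} (hf : Measurable f) :
    ∫⁻ y, f (y n) ∂(Measure.infinitePi ν) = ∫⁻ y, f y ∂(ν n) := by
  rw [← lintegral_map hf (measurable_pi_apply n), Measure.infinitePi_map_eval]

lemma lintegral_nexp_le_one {α : Type*} [MeasurableSpace α] (P : Measure α)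
    [IsProbabilityMeasure P] (g : α → ℝ≥0∞) : ∫⁻ a, nexp (g a) ∂P ≤ 1 :=
  (lintegral_mono fun _ => nexp_le_one _).trans (by simp)

/-- The infinite product of the factors is written as `nexp` of a sum of values of `nlog`. After the
marks are integrated out, the Laplace functional of the points thus applies again. -/
lemma lintegral_infinitePi_nexp {g : ℕ → Y → ℝ≥0∞} (hg : ∀ n, Measurable (g n)) :
    ∫⁻ y, nexp (∑' n, g n (y n)) ∂(Measure.infinitePi ν)
      = nexp (∑' n, nlog (∫⁻ y, nexp (g n y) ∂(ν n))) := by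
  refine tendsto_nhds_unique (f := fun k => ∫⁻ y, ∏ n ∈ Finset.range k, nexp (g n (y n))
    ∂(Measure.infinitePi ν)) (l := Filter.atTop) ?_ ?_
  · refine tendsto_lintegral_of_dominated_convergence (fun _ => 1) (fun k => ?_) (fun k => ?_) ?_ ?_
    · exact Finset.measurable_prod _ fun n _ =>
        measurable_nexp.comp ((hg n).comp (measurable_pi_apply n))
    · exact Filter.Eventually.of_forall fun y => Finset.prod_le_one' fun n _ => nexp_le_one _
    · simp
    · exact Filter.Eventually.of_forall fun y => tendsto_nexp_sum_range _
  · refine (tendsto_nexp_sum_range _).congr fun k => ?_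
    rw [lintegral_infinitePi_prod ν _ (F := fun n y => nexp (g n y))
      (fun n => measurable_nexp.comp (hg n))]
    exact Finset.prod_congr rfl fun n _ => nexp_nlog (lintegral_nexp_le_one _ _)

/-- By independence only the factor of index `n` is changed, and the quotient records this change.
If the denominator vanishes, so does the numerator, and `0 / 0 = 0` is the right value. The bound on
`f` serves dominated convergence. -/
lemma lintegral_infinitePi_mul_nexp_of_le {g : ℕ → Y → ℝ≥0∞} (hg : ∀ n, Measurable (g n))
    (n : ℕ) {f : Y → ℝ≥0∞} (hf : Measurable f) {K : ℝ≥0∞}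
    (hK : K ≠ ⊤) (hfK : ∀ y, f y ≤ K) :
    ∫⁻ y, f (y n) * nexp (∑' m, g m (y m)) ∂(Measure.infinitePi ν)
      = (∫⁻ y, f y * nexp (g n y) ∂(ν n)) / (∫⁻ y, nexp (g n y) ∂(ν n))
        * nexp (∑' m, nlog (∫⁻ y, nexp (g m y) ∂(ν m))) := by
  set h : ℕ → ℝ≥0∞ := fun m => ∫⁻ y, nexp (g m y) ∂(ν m) with hh
  have h1 : ∀ m, h m ≤ 1 := fun m => lintegral_nexp_le_one _ _
  set F : ℕ → Y → ℝ≥0∞ := fun m y => (if m = n then f y else 1) * nexp (g m y)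
  have hF : ∀ m, Measurable (F m) := by
    intro m
    refine Measurable.mul ?_ (measurable_nexp.comp (hg m))
    split_ifs
    exacts [hf, measurable_const]
  have hprod : ∀ k, n < k → ∀ y : ℕ → Y, ∏ m ∈ Finset.range k, F m (y m)
      = f (y n) * ∏ m ∈ Finset.range k, nexp (g m (y m)) := by
    intro k hk y
    rw [Finset.prod_mul_distrib, Finset.prod_ite_eq', if_pos (Finset.mem_range.2 hk)]
  refine tendsto_nhds_unique (f := fun k => ∫⁻ y, f (y n) * ∏ m ∈ Finset.range k, nexp (g m (y m))
    ∂(Measure.infinitePi ν)) (l := Filter.atTop) ?_ ?_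
  · refine tendsto_lintegral_of_dominated_convergence (fun _ => K) (fun k => ?_) (fun k => ?_) ?_ ?_
    · exact (hf.comp (measurable_pi_apply n)).mul (Finset.measurable_prod _ fun n _ =>
        measurable_nexp.comp ((hg n).comp (measurable_pi_apply n)))
    · exact Filter.Eventually.of_forall fun y =>
        (mul_le_of_le_one_right' (Finset.prod_le_one' fun n _ => nexp_le_one _)).trans (hfK _)
    · simpa using hK
    · exact Filter.Eventually.of_forall fun y => ENNReal.Tendsto.const_mul
        (tendsto_nexp_sum_range _) (Or.inr (ne_top_of_le_ne_top hK (hfK _)))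
  · have hfin : (∫⁻ y, f y * nexp (g n y) ∂(ν n)) / h n ≠ ⊤ := by
      have hle : ∫⁻ y, f y * nexp (g n y) ∂(ν n) ≤ K * h n := by
        rw [← lintegral_const_mul K (f := fun y => nexp (g n y)) (measurable_nexp.comp (hg n))]
        exact lintegral_mono fun y => mul_le_mul_left (hfK y) _
      exact ne_top_of_le_ne_top hK (ENNReal.div_le_of_le_mul hle)
    refine (ENNReal.Tendsto.const_mul (tendsto_nexp_sum_range fun m => nlog (h m))
      (Or.inr hfin)).congr' ?_
    filter_upwards [Filter.eventually_gt_atTop n] with k hk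
    simp_rw [← hprod k hk]
    rw [lintegral_infinitePi_prod ν _ hF]
    have hsplit : ∀ a : ℕ → ℝ≥0∞, ∏ m ∈ Finset.range k, a m
        = a n * ∏ m ∈ (Finset.range k).erase n, a m := fun a =>
      (Finset.mul_prod_erase _ a (Finset.mem_range.2 hk)).symm
    rw [hsplit, hsplit, nexp_nlog (h1 n), ← mul_assoc]
    congr 1
    · simp only [F, if_true]
      by_cases h0 : h n = 0
      · have : ∫⁻ y, f y * nexp (g n y) ∂(ν n) = 0 := by
          refine (lintegral_eq_zero_iff (hf.mul (measurable_nexp.comp (hg n)))).2 ?_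
          filter_upwards [(lintegral_eq_zero_iff (measurable_nexp.comp (hg n))).1 h0] with y hy
          simp only [Function.comp_apply, Pi.zero_apply] at hy
          simp [hy]
        rw [this, h0]; simp
      · exact ENNReal.div_mul_cancel h0 (ne_top_of_le_ne_top (by simp) (h1 n))
    · refine Finset.prod_congr rfl fun m hm => ?_
      rw [nexp_nlog (h1 m)]
      simp [F, hh, Finset.ne_of_mem_erase hm]

lemma lintegral_infinitePi_mul_nexp {g : ℕ → Y → ℝ≥0∞} (hg : ∀ n, Measurable (g n))
    (n : ℕ) {f : Y → ℝ≥0∞} (hf : Measurable f) :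
    ∫⁻ y, f (y n) * nexp (∑' m, g m (y m)) ∂(Measure.infinitePi ν)
      = (∫⁻ y, f y * nexp (g n y) ∂(ν n)) / (∫⁻ y, nexp (g n y) ∂(ν n))
        * nexp (∑' m, nlog (∫⁻ y, nexp (g m y) ∂(ν m))) := by
  -- Truncation at height `k` reduces to bounded `f`.
  have hlim : ∀ y, Filter.Tendsto (fun k : ℕ => min (f y) k) Filter.atTop (nhds (f y)) := by
    intro y
    have := (tendsto_const_nhds (x := f y)).min ENNReal.tendsto_nat_nhds_top
    simpa using this
  have hmono : ∀ y, Monotone (fun k : ℕ => min (f y) k) := fun y j k hjk =>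
    min_le_min le_rfl (by exact_mod_cast hjk)
  have hmeas : ∀ k : ℕ, Measurable fun y => min (f y) k := fun k => hf.min measurable_const
  have hms : Measurable fun y : ℕ → Y => ∑' m, g m (y m) :=
    Measurable.tsum fun m => (hg m).comp (measurable_pi_apply m)
  refine tendsto_nhds_unique (f := fun k : ℕ => ∫⁻ y, min (f (y n)) k * nexp (∑' m, g m (y m))
    ∂(Measure.infinitePi ν)) (l := Filter.atTop) ?_ ?_
  · refine lintegral_tendsto_of_tendsto_of_monotone (fun k => ?_)
      (Filter.Eventually.of_forall fun y j k hjk => ?_) (Filter.Eventually.of_forall fun y => ?_)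
    · exact (((hmeas k).comp (measurable_pi_apply n)).mul (measurable_nexp.comp hms)).aemeasurable
    · exact mul_le_mul_left (hmono _ hjk) _
    · exact ENNReal.Tendsto.mul_const (hlim _) (Or.inr (nexp_ne_top _))
  · simp_rw [fun k : ℕ => lintegral_infinitePi_mul_nexp_of_le ν hg n (hmeas k)
      (ENNReal.natCast_ne_top k) (fun y => min_le_right _ _)]
    refine ENNReal.Tendsto.mul_const ?_ (Or.inr (nexp_ne_top _))
    by_cases h0 : ∫⁻ y, nexp (g n y) ∂(ν n) = 0
    · have : ∀ k : Y → ℝ≥0∞, Measurable k → ∫⁻ y, k y * nexp (g n y) ∂(ν n) = 0 := by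
        intro k hk
        refine (lintegral_eq_zero_iff (hk.mul (measurable_nexp.comp (hg n)))).2 ?_
        filter_upwards [(lintegral_eq_zero_iff (measurable_nexp.comp (hg n))).1 h0] with y hy
        simp only [Function.comp_apply, Pi.zero_apply] at hy
        simp [hy]
      simp_rw [this f hf, fun k : ℕ => this _ (hmeas k)]
      exact tendsto_const_nhds
    · refine ENNReal.Tendsto.div_const ?_ (Or.inr h0)
      refine lintegral_tendsto_of_tendsto_of_monotone (fun k => ?_)
        (Filter.Eventually.of_forall fun y j k hjk => ?_) (Filter.Eventually.of_forall fun y => ?_)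
      · exact ((hmeas k).mul (measurable_nexp.comp (hg n))).aemeasurable
      · exact mul_le_mul_left (hmono _ hjk) _
      · exact ENNReal.Tendsto.mul_const (hlim _) (Or.inr (nexp_ne_top _))

end Marks

/-! ### Marked Poisson point processes -/

namespace IsMecke

variable {E : Type*} [MeasurableSpace E] {μ : Measure E} {ρ : Measure (ℕ → E)}

lemma campbell (hρ : IsMecke μ ρ) {f : E → ℝ≥0∞} (hf : Measurable f) :
    ∫⁻ y, ∑' n, f (y n) ∂ρ = ∫⁻ e, f e ∂μ := by
  have := hρ.prob
  simpa using hρ.mecke f (fun _ => 0) hf measurable_const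

/-- By `campbell` the expected number of points in `A` is zero. This will give positivity of the
cascade weights. -/
lemma ae_forall_notMem (hρ : IsMecke μ ρ) {A : Set E} (hA : MeasurableSet A) (hA0 : μ A = 0) :
    ∀ᵐ y ∂ρ, ∀ n, y n ∉ A := by
  have h1 : Measurable (A.indicator (fun _ => (1 : ℝ≥0∞))) := measurable_const.indicator hA
  have h := hρ.campbell h1
  rw [lintegral_indicator_const hA, hA0, mul_zero, lintegral_eq_zero_iff
    (f := fun y : ℕ → E => ∑' n, A.indicator (fun _ => (1 : ℝ≥0∞)) (y n))
    (Measurable.tsum fun n => h1.comp (measurable_pi_apply n))] at h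
  filter_upwards [h] with y hy n hn
  have := ENNReal.tsum_eq_zero.1 hy n
  simp [hn] at this

variable {Y : Type*} [MeasurableSpace Y] {ν : ℕ → Measure Y} [∀ n, IsProbabilityMeasure (ν n)]

/-- The mark laws `ν n` may depend on `n`; only the Laplace transform `h` of a mark must be the same
for every `n`. Then the marks integrate to the Laplace functional of the points at `nlog ∘ h`. -/
lemma lintegral_marked_nexp (hρ : IsMecke μ ρ) {g : E → Y → ℝ≥0∞}
    (hg : Measurable (Function.uncurry g)) {h : E → ℝ≥0∞}
    (hh : ∀ n e, ∫⁻ y, nexp (g e y) ∂(ν n) = h e) :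
    ∫⁻ p, nexp (∑' n, g (p.1 n) (p.2 n)) ∂(ρ.prod (Measure.infinitePi ν))
      = nexp (∫⁻ e, 1 - h e ∂μ) := by
  have := hρ.prob
  have hmg : ∀ e, Measurable (g e) := fun e => hg.comp measurable_prodMk_left
  have hm : Measurable h := by
    simp_rw [funext fun e => (hh 0 e).symm]
    exact Measurable.lintegral_prod_right' (f := fun p : E × Y => nexp (g p.1 p.2))
      (measurable_nexp.comp hg)
  have h1 : ∀ e, h e ≤ 1 := fun e => by
    rw [← hh 0 e]; exact lintegral_nexp_le_one _ _
  rw [lintegral_prod (fun p : (ℕ → E) × (ℕ → Y) => nexp (∑' n, g (p.1 n) (p.2 n)))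
    (measurable_nexp.comp (Measurable.tsum fun n => hg.comp
    (((measurable_pi_apply n).comp measurable_fst).prodMk
      ((measurable_pi_apply n).comp measurable_snd)))).aemeasurable]
  simp_rw [fun x : ℕ → E => lintegral_infinitePi_nexp ν (fun n => hmg (x n)), hh]
  rw [hρ.laplace (fun e => nlog (h e)) (measurable_nlog.comp hm)]
  simp_rw [fun e => nexp_nlog (h1 e)]

/-- Integrating the marks turns the sum into `∑ k/h` and the exponential into that of `nlog ∘ h`.
The Mecke formula for the points weights `k/h` by `h`, and the denominator cancels. -/
lemma lintegral_marked_mul_nexp (hρ : IsMecke μ ρ) {f g : E → Y → ℝ≥0∞}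
    (hf : Measurable (Function.uncurry f)) (hg : Measurable (Function.uncurry g))
    {k h : E → ℝ≥0∞} (hh : ∀ n e, ∫⁻ y, nexp (g e y) ∂(ν n) = h e)
    (hk : ∀ n e, ∫⁻ y, f e y * nexp (g e y) ∂(ν n) = k e) :
    ∫⁻ p, (∑' n, f (p.1 n) (p.2 n)) * nexp (∑' n, g (p.1 n) (p.2 n))
        ∂(ρ.prod (Measure.infinitePi ν))
      = (∫⁻ e, k e ∂μ) * ∫⁻ p, nexp (∑' n, g (p.1 n) (p.2 n))
        ∂(ρ.prod (Measure.infinitePi ν)) := by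
  have := hρ.prob
  have hmf : ∀ e, Measurable (f e) := fun e => hf.comp measurable_prodMk_left
  have hmg : ∀ e, Measurable (g e) := fun e => hg.comp measurable_prodMk_left
  have hm : Measurable h := by
    simp_rw [funext fun e => (hh 0 e).symm]
    exact Measurable.lintegral_prod_right' (f := fun p : E × Y => nexp (g p.1 p.2))
      (measurable_nexp.comp hg)
  have hmk : Measurable k := by
    simp_rw [funext fun e => (hk 0 e).symm]
    exact Measurable.lintegral_prod_right' (f := fun p : E × Y => f p.1 p.2 * nexp (g p.1 p.2))
      (hf.mul (measurable_nexp.comp hg))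
  have h1 : ∀ e, h e ≤ 1 := fun e => by
    rw [← hh 0 e]; exact lintegral_nexp_le_one _ _
  have hkh : ∀ e, k e / h e * h e = k e := by
    intro e
    by_cases h0 : h e = 0
    · have : k e = 0 := by
        rw [← hk 0 e]
        refine (lintegral_eq_zero_iff ((hmf e).mul (measurable_nexp.comp (hmg e)))).2 ?_
        rw [← hh 0 e] at h0
        filter_upwards [(lintegral_eq_zero_iff (measurable_nexp.comp (hmg e))).1 h0] with y hy
        simp only [Function.comp_apply, Pi.zero_apply] at hy
        simp [hy]
      simp [this]
    · exact ENNReal.div_mul_cancel h0 (ne_top_of_le_ne_top (by simp) (h1 e))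
  have hpair : ∀ n, Measurable fun p : (ℕ → E) × (ℕ → Y) => (p.1 n, p.2 n) := fun n =>
    ((measurable_pi_apply n).comp measurable_fst).prodMk
      ((measurable_pi_apply n).comp measurable_snd)
  have hmF : Measurable fun p : (ℕ → E) × (ℕ → Y) => ∑' n, f (p.1 n) (p.2 n) :=
    Measurable.tsum fun n => hf.comp (hpair n)
  have hmG : Measurable fun p : (ℕ → E) × (ℕ → Y) => nexp (∑' n, g (p.1 n) (p.2 n)) :=
    measurable_nexp.comp (Measurable.tsum fun n => hg.comp (hpair n))
  have inner : ∀ x : ℕ → E, ∫⁻ y, (∑' n, f (x n) (y n)) * nexp (∑' n, g (x n) (y n))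
      ∂(Measure.infinitePi ν)
      = (∑' n, k (x n) / h (x n)) * nexp (∑' n, nlog (h (x n))) := by
    intro x
    simp_rw [← ENNReal.tsum_mul_right]
    have hms : Measurable fun y : ℕ → Y => nexp (∑' m, g (x m) (y m)) :=
      measurable_nexp.comp (Measurable.tsum fun m => (hmg (x m)).comp (measurable_pi_apply m))
    rw [lintegral_tsum (f := fun n (y : ℕ → Y) => f (x n) (y n) * nexp (∑' m, g (x m) (y m)))
      fun n => (((hmf (x n)).comp (measurable_pi_apply n)).mul hms).aemeasurable]
    simp_rw [fun n => lintegral_infinitePi_mul_nexp ν (fun m => hmg (x m)) n (hmf (x n)), hh, hk]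
  rw [lintegral_prod _ hmG.aemeasurable, lintegral_prod (fun p : (ℕ → E) × (ℕ → Y) =>
    (∑' n, f (p.1 n) (p.2 n)) * nexp (∑' n, g (p.1 n) (p.2 n))) (hmF.mul hmG).aemeasurable]
  simp_rw [inner, fun x : ℕ → E => lintegral_infinitePi_nexp ν (fun n => hmg (x n)), hh]
  rw [hρ.mecke (fun e => k e / h e) (fun e => nlog (h e)) (hmk.div hm) (measurable_nlog.comp hm)]
  simp_rw [fun e => nexp_nlog (h1 e), hkh]

/-- Campbell's inequality for a marked process. -/
lemma lintegral_marked_tsum_le (hρ : IsMecke μ ρ) {f : E → ℝ≥0∞} (hf : Measurable f)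
    {a : Y → ℝ≥0∞} (ha : Measurable a) {K : ℝ≥0∞} (hK : ∀ n, ∫⁻ y, a y ∂(ν n) ≤ K) :
    ∫⁻ p, ∑' n, f (p.1 n) * a (p.2 n) ∂(ρ.prod (Measure.infinitePi ν))
      ≤ (∫⁻ e, f e ∂μ) * K := by
  have := hρ.prob
  have hm : ∀ n, Measurable fun p : (ℕ → E) × (ℕ → Y) => f (p.1 n) * a (p.2 n) := fun n =>
    (hf.comp ((measurable_pi_apply n).comp measurable_fst)).mul
      (ha.comp ((measurable_pi_apply n).comp measurable_snd))
  rw [lintegral_prod _ (Measurable.tsum hm).aemeasurable, ← hρ.campbell hf,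
    ← lintegral_mul_const _ (f := fun y : ℕ → E => ∑' n, f (y n)) (Measurable.tsum fun n => hf.comp (measurable_pi_apply n))]
  refine lintegral_mono fun x => ?_
  have hm' : ∀ n, Measurable fun y : ℕ → Y => f (x n) * a (y n) := fun n =>
    (ha.comp (measurable_pi_apply n)).const_mul _
  rw [lintegral_tsum fun n => (hm' n).aemeasurable, ← ENNReal.tsum_mul_right]
  refine ENNReal.tsum_le_tsum fun n => ?_
  rw [lintegral_const_mul _ (f := fun y : ℕ → Y => a (y n)) (ha.comp (measurable_pi_apply n)),
    lintegral_infinitePi_eval ν n ha]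
  exact mul_le_mul_right (hK n) _

end IsMecke

end

/-! ### The intensity `e ^ (-1 - m) de` and random trees -/

section

lemma sigmaFinite_powerIntensity (m : ℝ) : SigmaFinite (powerIntensity m) := by
  unfold powerIntensity; infer_instance

lemma measurable_ofReal_rpow (a : ℝ) : Measurable fun e : ℝ => ENNReal.ofReal (e ^ a) :=
  ENNReal.measurable_ofReal.comp (measurable_id.pow_const a)

lemma lintegral_powerIntensity (m : ℝ) {f : ℝ → ℝ≥0∞} (hf : Measurable f) :
    ∫⁻ e, f e ∂(powerIntensity m)
      = ∫⁻ e in Set.Ioi (0 : ℝ), ENNReal.ofReal (e ^ (-1 - m)) * f e := by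
  rw [powerIntensity, lintegral_withDensity_eq_lintegral_mul _ (measurable_ofReal_rpow _) hf]
  rfl

lemma powerIntensity_Iic_zero (m : ℝ) : powerIntensity m (Set.Iic 0) = 0 := by
  rw [← lintegral_indicator_one measurableSet_Iic,
    lintegral_powerIntensity m (measurable_one.indicator measurableSet_Iic)]
  refine (setLIntegral_congr_fun measurableSet_Ioi fun e he => ?_).trans lintegral_zero
  have : e ∉ Set.Iic (0 : ℝ) := by simpa using he
  simp [this]

/-- `∫ e ^ b exp (- l e s) e ^ (-1 - m) de = Γ(b - m) (l s) ^ (m - b)`. -/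
lemma lintegral_powerIntensity_nexp {m : ℝ} {b : ℕ} (hb : m < b) {l : ℝ} (hl : 0 < l)
    (s : ℝ≥0∞) :
    ∫⁻ e, ENNReal.ofReal e ^ b * nexp (ENNReal.ofReal l * ENNReal.ofReal e * s)
        ∂(powerIntensity m)
      = ENNReal.ofReal (Real.Gamma (b - m)) * ENNReal.ofReal (l ^ (m - b)) * s ^ (m - b) := by
  rw [lintegral_powerIntensity]
  · have h1 := lintegral_rpow_mul_nexp (a := b - m) (by linarith) (ENNReal.ofReal l * s)
    have h2 : (ENNReal.ofReal l * s) ^ (-((b : ℝ) - m))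
        = ENNReal.ofReal (l ^ (m - b)) * s ^ (m - b) := by
      rw [neg_sub, ENNReal.mul_rpow_eq_ite, if_neg, ENNReal.ofReal_rpow_of_pos hl]
      simp [hl]
    rw [h2, ← mul_assoc] at h1
    rw [← h1]
    refine setLIntegral_congr_fun measurableSet_Ioi fun e he => ?_
    have he' : 0 < e := he
    have h3 : ENNReal.ofReal (e ^ (-1 - m)) * ENNReal.ofReal e ^ b
        = ENNReal.ofReal (e ^ ((b : ℝ) - m - 1)) := by
      rw [← ENNReal.ofReal_pow he'.le, ← ENNReal.ofReal_mul (by positivity), ← Real.rpow_natCast,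
        ← Real.rpow_add he']
      congr 2; ring
    rw [← mul_assoc, h3]
    congr 2
    ring
  · fun_prop

/-- Small points have finite moments of order above `m`; the next lemma says that large points have
finite moments of order below `m`. Both are needed to bound fractional moments of the cascade. -/
lemma lintegral_powerIntensity_Iic_ne_top {m p : ℝ} (hp : m < p) :
    ∫⁻ e, (Set.Iic (1 : ℝ)).indicator (fun e => ENNReal.ofReal (e ^ p)) e ∂(powerIntensity m)
      ≠ ⊤ := by
  rw [lintegral_powerIntensity _ ((measurable_ofReal_rpow p).indicator measurableSet_Iic)]
  have h1 : ∀ e ∈ Set.Ioi (0 : ℝ), ENNReal.ofReal (e ^ (-1 - m)) *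
      (Set.Iic (1 : ℝ)).indicator (fun e => ENNReal.ofReal (e ^ p)) e
      = (Set.Iic (1 : ℝ)).indicator (fun e => ENNReal.ofReal (e ^ (p - m - 1))) e := by
    intro e he
    have he' : 0 < e := he
    by_cases h : e ∈ Set.Iic (1 : ℝ)
    · rw [Set.indicator_of_mem h, Set.indicator_of_mem h, ← ENNReal.ofReal_mul (by positivity),
        ← Real.rpow_add he']
      congr 2; ring
    · simp [h]
  rw [setLIntegral_congr_fun measurableSet_Ioi h1, lintegral_indicator measurableSet_Iic,
    Measure.restrict_restrict measurableSet_Iic, Set.inter_comm, Set.Ioi_inter_Iic]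
  have h2 : IntervalIntegrable (fun e : ℝ => e ^ (p - m - 1)) volume 0 1 :=
    intervalIntegral.intervalIntegrable_rpow' (by linarith)
  rw [intervalIntegrable_iff_integrableOn_Ioc_of_le zero_le_one] at h2
  exact h2.lintegral_lt_top.ne

lemma lintegral_powerIntensity_Ioi_ne_top {m p : ℝ} (hp : p < m) :
    ∫⁻ e, (Set.Ioi (1 : ℝ)).indicator (fun e => ENNReal.ofReal (e ^ p)) e ∂(powerIntensity m)
      ≠ ⊤ := by
  rw [lintegral_powerIntensity _ ((measurable_ofReal_rpow p).indicator measurableSet_Ioi)]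
  have h1 : ∀ e ∈ Set.Ioi (0 : ℝ), ENNReal.ofReal (e ^ (-1 - m)) *
      (Set.Ioi (1 : ℝ)).indicator (fun e => ENNReal.ofReal (e ^ p)) e
      = (Set.Ioi (1 : ℝ)).indicator (fun e => ENNReal.ofReal (e ^ (p - m - 1))) e := by
    intro e he
    have he' : 0 < e := he
    by_cases h : e ∈ Set.Ioi (1 : ℝ)
    · rw [Set.indicator_of_mem h, Set.indicator_of_mem h, ← ENNReal.ofReal_mul (by positivity),
        ← Real.rpow_add he']
      congr 2; ring
    · simp [h]
  rw [setLIntegral_congr_fun measurableSet_Ioi h1, lintegral_indicator measurableSet_Ioi,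
    Measure.restrict_restrict measurableSet_Ioi, Set.Ioi_inter_Ioi]
  have h2 : IntegrableOn (fun e : ℝ => e ^ (p - m - 1)) (Set.Ioi (1 ⊔ 0)) volume := by
    rw [max_eq_left zero_le_one]
    exact integrableOn_Ioi_rpow_of_lt (by linarith) one_pos
  exact h2.lintegral_lt_top.ne

/-! ### Recursive trees -/

/-- A tree of depth `j`: a sequence of weights at the root, and for each child of the root a mark
in `X` together with a tree of depth `j - 1`. -/
def Tree (X : Type) : ℕ → Type
  | 0 => Unit
  | j + 1 => (ℕ → ℝ) × (ℕ → X × Tree X j)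

instance instMeasurableSpaceTree (X : Type) [MeasurableSpace X] : ∀ j, MeasurableSpace (Tree X j)
  | 0 => inferInstanceAs (MeasurableSpace Unit)
  | j + 1 =>
    letI := instMeasurableSpaceTree X j
    inferInstanceAs (MeasurableSpace ((ℕ → ℝ) × (ℕ → X × Tree X j)))

variable {X : Type} [MeasurableSpace X]

/-- The law of a tree with weights of law `ρ`, marks of law `ζ` and subtrees of laws `M n`. -/
def nodeLaw {j : ℕ} (ρ : Measure (ℕ → ℝ)) (ζ : Measure X) (M : ℕ → Measure (Tree X j)) :
    Measure (Tree X (j + 1)) :=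
  ρ.prod (Measure.infinitePi fun n => ζ.prod (M n))

/-- The law of a tree of depth `j` whose weights are Poisson processes of intensity
`e ^ (-1 - θ) de`, with independent marks. -/
def TreeLaw (θ : ℕ → ℝ) (ζ : ℕ → Measure X) : ∀ j, Measure (Tree X j) → Prop
  | 0, L => IsProbabilityMeasure L
  | j + 1, L => ∃ (ρ : Measure (ℕ → ℝ)) (M : ℕ → Measure (Tree X j)),
      IsMecke (powerIntensity (θ (j + 1))) ρ ∧ (∀ n, TreeLaw θ ζ j (M n)) ∧
      L = nodeLaw ρ (ζ j) M

lemma TreeLaw.isProbabilityMeasure {θ : ℕ → ℝ} {ζ : ℕ → Measure X}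
    [∀ j, IsProbabilityMeasure (ζ j)] :
    ∀ {j : ℕ} {L : Measure (Tree X j)}, TreeLaw θ ζ j L → IsProbabilityMeasure L
  | 0, _, h => h
  | j + 1, L, h => by
    obtain ⟨ρ, M, hρ, hM, rfl⟩ := h
    have := hρ.prob
    have := fun n => (hM n).isProbabilityMeasure
    exact inferInstanceAs (IsProbabilityMeasure (ρ.prod (Measure.infinitePi fun n => (ζ j).prod (M n))))

variable [Add X] [MeasurableAdd₂ X]

/-- `∑ u_n ^ b A(x + mark_n, subtree_n)`. -/
def lift {j : ℕ} (b : ℕ) (A : X → Tree X j → ℝ≥0∞) (x : X) (t : Tree X (j + 1)) : ℝ≥0∞ :=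
  ∑' n, ENNReal.ofReal (t.1 n) ^ b * A (x + (t.2 n).1) (t.2 n).2

/-- The weighted sum of `F` over the leaves. -/
def treeSum (F : X → ℝ≥0∞) : ∀ j, X → Tree X j → ℝ≥0∞
  | 0 => fun x _ => F x
  | j + 1 => lift 1 (treeSum F j)

/-- The sum over the nodes at depth `d` of the squares of the weights of their subtrees. -/
def treeSq (F : X → ℝ≥0∞) : ∀ (_ j : ℕ), X → Tree X j → ℝ≥0∞
  | 0, j => fun x t => treeSum F j x t * treeSum F j x t
  | _ + 1, 0 => 0
  | d + 1, j + 1 => lift 2 (treeSq F d j)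

lemma measurable_lift_summand {j : ℕ} {A : X → Tree X j → ℝ≥0∞}
    (hA : Measurable (Function.uncurry A)) (b n : ℕ) :
    Measurable fun p : X × Tree X (j + 1) =>
      ENNReal.ofReal (p.2.1 n) ^ b * A (p.1 + (p.2.2 n).1) (p.2.2 n).2 := by
  have h1 : Measurable fun t : Tree X (j + 1) => t.1 n := (measurable_pi_apply n).comp measurable_fst
  have h2 : Measurable fun t : Tree X (j + 1) => t.2 n := (measurable_pi_apply n).comp measurable_snd
  have h3 : Measurable fun p : X × Tree X (j + 1) => p.2.2 n := h2.comp measurable_snd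
  refine ((ENNReal.measurable_ofReal.comp (h1.comp measurable_snd)).pow_const b).mul
    (hA.comp (Measurable.prodMk ?_ (measurable_snd.comp h3)))
  exact measurable_fst.add (measurable_fst.comp h3)

lemma measurable_lift {j : ℕ} (b : ℕ) {A : X → Tree X j → ℝ≥0∞}
    (hA : Measurable (Function.uncurry A)) : Measurable (Function.uncurry (lift b A)) :=
  Measurable.tsum fun n => measurable_lift_summand hA b n

lemma measurable_treeSum {F : X → ℝ≥0∞} (hF : Measurable F) :
    ∀ j, Measurable (Function.uncurry (treeSum F j))
  | 0 => hF.comp measurable_fst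
  | j + 1 => measurable_lift 1 (measurable_treeSum hF j)

lemma measurable_treeSq {F : X → ℝ≥0∞} (hF : Measurable F) :
    ∀ d j, Measurable (Function.uncurry (treeSq F d j))
  | 0, j => (measurable_treeSum hF j).mul (measurable_treeSum hF j)
  | _ + 1, 0 => measurable_const
  | d + 1, j + 1 => measurable_lift 2 (measurable_treeSq hF d j)

end

/-! ### Independence of the choice of tree law -/

section

variable {X : Type} [MeasurableSpace X] [Add X] [MeasurableAdd₂ X]

lemma mul_treeSum_succ {X : Type} [Add X] {F : X → ℝ≥0∞} {j : ℕ} (s : ℝ≥0∞) (x : X)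
    (t : Tree X (j + 1)) :
    s * treeSum F (j + 1) x t
      = ∑' n, s * ENNReal.ofReal (t.1 n) * treeSum F j (x + (t.2 n).1) (t.2 n).2 := by
  simp only [treeSum, lift, pow_one]
  rw [← ENNReal.tsum_mul_left]
  simp_rw [mul_assoc]

/-- The expectations of `A exp (- s S)` are determined by the intensities and the laws of the
marks. -/
def LawInvariant (θ : ℕ → ℝ) (ζ : ℕ → Measure X) (F : X → ℝ≥0∞) (j : ℕ)
    (A : X → Tree X j → ℝ≥0∞) : Prop :=
  ∀ L L', TreeLaw θ ζ j L → TreeLaw θ ζ j L' → ∀ x s, s ≠ 0 → s ≠ ⊤ →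
    ∫⁻ t, A x t * nexp (s * treeSum F j x t) ∂L = ∫⁻ t, A x t * nexp (s * treeSum F j x t) ∂L'

variable {θ : ℕ → ℝ} {ζ : ℕ → Measure X} [∀ j, IsProbabilityMeasure (ζ j)] {F : X → ℝ≥0∞}

/-- Invariance for every starting state passes to a random first mark by conditioning on it. This
supplies the equality over `n` that the marked formulas require. -/
lemma LawInvariant.lintegral_mark {j : ℕ} {A : X → Tree X j → ℝ≥0∞} (hF : Measurable F)
    (h : LawInvariant θ ζ F j A) (hA : Measurable (Function.uncurry A)) {M M' : Measure (Tree X j)}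
    (hM : TreeLaw θ ζ j M) (hM' : TreeLaw θ ζ j M') (x : X) {s : ℝ≥0∞} (hs : s ≠ 0)
    (hs' : s ≠ ⊤) :
    ∫⁻ y, A (x + y.1) y.2 * nexp (s * treeSum F j (x + y.1) y.2) ∂((ζ j).prod M)
      = ∫⁻ y, A (x + y.1) y.2 * nexp (s * treeSum F j (x + y.1) y.2) ∂((ζ j).prod M') := by
  have := hM.isProbabilityMeasure
  have := hM'.isProbabilityMeasure
  have hm : Measurable fun y : X × Tree X j => (x + y.1, y.2) :=
    (measurable_fst.const_add x).prodMk measurable_snd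
  have hmeas : Measurable fun y : X × Tree X j =>
      A (x + y.1) y.2 * nexp (s * treeSum F j (x + y.1) y.2) :=
    (hA.comp hm).mul (measurable_nexp.comp (((measurable_treeSum hF j).comp hm).const_mul s))
  rw [lintegral_prod _ hmeas.aemeasurable, lintegral_prod _ hmeas.aemeasurable]
  exact lintegral_congr fun z => h M M' hM hM' (x + z) s hs hs'

section Step

variable {j : ℕ} {ρ : Measure (ℕ → ℝ)} {M : ℕ → Measure (Tree X j)}

lemma lintegral_nexp_treeSum_succ (hF : Measurable F)
    (hρ : IsMecke (powerIntensity (θ (j + 1))) ρ) (hM : ∀ n, TreeLaw θ ζ j (M n))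
    (h1 : LawInvariant θ ζ F j (fun _ _ => 1)) (x : X) {s : ℝ≥0∞} (hs : s ≠ 0) (hs' : s ≠ ⊤) :
    ∫⁻ t, nexp (s * treeSum F (j + 1) x t)
        ∂(nodeLaw ρ (ζ j) M)
      = nexp (∫⁻ e, 1 - ∫⁻ y, nexp (s * ENNReal.ofReal e * treeSum F j (x + y.1) y.2)
        ∂((ζ j).prod (M 0)) ∂(powerIntensity (θ (j + 1)))) := by
  have := fun n => (hM n).isProbabilityMeasure
  have hm : Measurable fun p : ℝ × (X × Tree X j) => (x + p.2.1, p.2.2) :=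
    ((measurable_fst.comp measurable_snd).const_add x).prodMk
      (measurable_snd.comp measurable_snd)
  have key := hρ.lintegral_marked_nexp (ν := fun n => (ζ j).prod (M n))
    (g := fun e y => s * ENNReal.ofReal e * treeSum F j (x + y.1) y.2)
    (((ENNReal.measurable_ofReal.comp measurable_fst).const_mul s).mul
      ((measurable_treeSum hF j).comp hm))
    (h := fun e => ∫⁻ y, nexp (s * ENNReal.ofReal e * treeSum F j (x + y.1) y.2)
        ∂((ζ j).prod (M 0))) ?_
  · rw [← key]
    refine lintegral_congr fun t => ?_
    rw [mul_treeSum_succ]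
  · intro n e
    -- `LawInvariant` needs a nonzero parameter. For `e ≤ 0`, where `ENNReal.ofReal e = 0`, both
    -- sides equal `1`.
    by_cases he : 0 < e
    · have := h1.lintegral_mark hF measurable_const (hM n) (hM 0) x
        (s := s * ENNReal.ofReal e) (by simp [hs, he]) (ENNReal.mul_ne_top hs' ENNReal.ofReal_ne_top)
      simpa using this
    · simp [ENNReal.ofReal_of_nonpos (not_lt.1 he)]

/-- Mecke formula at the root. The condition `b ≠ 0` makes the weight `ENNReal.ofReal e ^ b` vanish
for `e ≤ 0`, where invariance is not available. -/
lemma lintegral_lift_mul_nexp (hF : Measurable F)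
    (hρ : IsMecke (powerIntensity (θ (j + 1))) ρ) (hM : ∀ n, TreeLaw θ ζ j (M n))
    (h1 : LawInvariant θ ζ F j (fun _ _ => 1)) {A : X → Tree X j → ℝ≥0∞}
    (hA : Measurable (Function.uncurry A)) (hA' : LawInvariant θ ζ F j A)
    {b : ℕ} (hb : b ≠ 0) (x : X) {s : ℝ≥0∞} (hs : s ≠ 0) (hs' : s ≠ ⊤) :
    ∫⁻ t, lift b A x t * nexp (s * treeSum F (j + 1) x t)
        ∂(nodeLaw ρ (ζ j) M)
      = (∫⁻ e, ENNReal.ofReal e ^ b * ∫⁻ y, A (x + y.1) y.2 *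
          nexp (s * ENNReal.ofReal e * treeSum F j (x + y.1) y.2)
          ∂((ζ j).prod (M 0)) ∂(powerIntensity (θ (j + 1))))
        * ∫⁻ t, nexp (s * treeSum F (j + 1) x t)
          ∂(nodeLaw ρ (ζ j) M) := by
  have := fun n => (hM n).isProbabilityMeasure
  have hm : Measurable fun p : ℝ × (X × Tree X j) => (x + p.2.1, p.2.2) :=
    ((measurable_fst.comp measurable_snd).const_add x).prodMk
      (measurable_snd.comp measurable_snd)
  have hm' : ∀ e : ℝ, Measurable fun y : X × Tree X j =>
      A (x + y.1) y.2 * nexp (s * ENNReal.ofReal e * treeSum F j (x + y.1) y.2) := fun e =>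
    (hA.comp (hm.comp (measurable_prodMk_left (x := e)))).mul (measurable_nexp.comp
      (((measurable_treeSum hF j).comp (hm.comp (measurable_prodMk_left (x := e)))).const_mul _))
  have key := hρ.lintegral_marked_mul_nexp (ν := fun n => (ζ j).prod (M n))
    (f := fun e y => ENNReal.ofReal e ^ b * A (x + y.1) y.2)
    (g := fun e y => s * ENNReal.ofReal e * treeSum F j (x + y.1) y.2)
    (((ENNReal.measurable_ofReal.comp measurable_fst).pow_const b).mul (hA.comp hm))
    (((ENNReal.measurable_ofReal.comp measurable_fst).const_mul s).mul
      ((measurable_treeSum hF j).comp hm))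
    (h := fun e => ∫⁻ y, nexp (s * ENNReal.ofReal e * treeSum F j (x + y.1) y.2)
        ∂((ζ j).prod (M 0)))
    (k := fun e => ENNReal.ofReal e ^ b * ∫⁻ y, A (x + y.1) y.2 *
          nexp (s * ENNReal.ofReal e * treeSum F j (x + y.1) y.2) ∂((ζ j).prod (M 0))) ?_ ?_
  · simp_rw [mul_treeSum_succ]
    exact key
  · intro n e
    by_cases he : 0 < e
    · have := h1.lintegral_mark hF measurable_const (hM n) (hM 0) x
        (s := s * ENNReal.ofReal e) (by simp [hs, he]) (ENNReal.mul_ne_top hs' ENNReal.ofReal_ne_top)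
      simpa using this
    · simp [ENNReal.ofReal_of_nonpos (not_lt.1 he)]
  · intro n e
    simp_rw [mul_assoc (ENNReal.ofReal e ^ b)]
    rw [lintegral_const_mul _ (hm' e)]
    by_cases he : 0 < e
    · rw [hA'.lintegral_mark hF hA (hM n) (hM 0) x
        (s := s * ENNReal.ofReal e) (by simp [hs, he]) (ENNReal.mul_ne_top hs' ENNReal.ofReal_ne_top)]
    · simp [ENNReal.ofReal_of_nonpos (not_lt.1 he), hb]

end Step

/-- Induction on the depth: the Laplace transform at the root is a function of the intensity, the
mark law and the Laplace transform of one subtree. -/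
lemma lawInvariant_one (hF : Measurable F) : ∀ j, LawInvariant θ ζ F j (fun _ _ => 1)
  | 0 => by
    intro L L' (hL : IsProbabilityMeasure L) (hL' : IsProbabilityMeasure L') x s _ _
    simp [treeSum]
  | j + 1 => by
    rintro L L' ⟨ρ, M, hρ, hM, rfl⟩ ⟨ρ', M', hρ', hM', rfl⟩ x s hs hs'
    have h1 := lawInvariant_one hF j
    simp_rw [one_mul]
    refine (lintegral_nexp_treeSum_succ hF hρ hM h1 x hs hs').trans
      (Eq.trans ?_ (lintegral_nexp_treeSum_succ hF hρ' hM' h1 x hs hs').symm)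
    congr 1
    refine lintegral_congr fun e => ?_
    by_cases he : 0 < e
    · have := h1.lintegral_mark hF measurable_const (hM 0) (hM' 0) x
        (s := s * ENNReal.ofReal e) (by simp [hs, he]) (ENNReal.mul_ne_top hs' ENNReal.ofReal_ne_top)
      simp only [one_mul] at this
      rw [this]
    · have := (hM 0).isProbabilityMeasure
      have := (hM' 0).isProbabilityMeasure
      simp [ENNReal.ofReal_of_nonpos (not_lt.1 he)]

lemma LawInvariant.lift (hF : Measurable F) {j : ℕ} {A : X → Tree X j → ℝ≥0∞}
    (hA : Measurable (Function.uncurry A)) (hA' : LawInvariant θ ζ F j A) {b : ℕ} (hb : b ≠ 0) :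
    LawInvariant θ ζ F (j + 1) (lift b A) := by
  intro L L' hL hL' x s hs hs'
  have h1 := lawInvariant_one (θ := θ) (ζ := ζ) hF j
  have h2 := lawInvariant_one (θ := θ) (ζ := ζ) hF (j + 1) L L' hL hL' x s hs hs'
  obtain ⟨ρ, M, hρ, hM, rfl⟩ := hL
  obtain ⟨ρ', M', hρ', hM', rfl⟩ := hL'
  simp_rw [one_mul] at h2
  refine (lintegral_lift_mul_nexp hF hρ hM h1 hA hA' hb x hs hs').trans
    (Eq.trans ?_ (lintegral_lift_mul_nexp hF hρ' hM' h1 hA hA' hb x hs hs').symm)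
  congr 1
  refine lintegral_congr fun e => ?_
  by_cases he : 0 < e
  · rw [hA'.lintegral_mark hF hA (hM 0) (hM' 0) x
        (s := s * ENNReal.ofReal e) (by simp [hs, he]) (ENNReal.mul_ne_top hs' ENNReal.ofReal_ne_top)]
  · simp [ENNReal.ofReal_of_nonpos (not_lt.1 he), hb]

/-! ### Differentiation of Laplace transforms -/

lemma mul_one_sub_nexp_div_le (n : ℕ) (y : ℝ≥0∞) :
    ((n : ℝ≥0∞) + 1) * (1 - nexp (y / (n + 1))) ≤ y := by
  rcases eq_or_ne y ⊤ with rfl | hy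
  · simp
  lift y to NNReal using hy
  have hn : (0 : ℝ) < n + 1 := by positivity
  have e1 : (y : ℝ≥0∞) / (n + 1) = ENNReal.ofReal ((y : ℝ) / (n + 1)) := by
    rw [ENNReal.ofReal_div_of_pos hn, ENNReal.ofReal_add (by positivity) zero_le_one]
    simp
  have e2 : ((n : ℝ≥0∞) + 1) = ENNReal.ofReal (n + 1) := by
    rw [ENNReal.ofReal_add (by positivity) zero_le_one]; simp
  rw [e1, nexp_ofReal (by positivity), e2, ← ENNReal.ofReal_one, ← ENNReal.ofReal_sub _
    (Real.exp_pos _).le, ← ENNReal.ofReal_mul hn.le, ← ENNReal.ofReal_coe_nnreal (p := y)]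
  refine ENNReal.ofReal_le_ofReal ?_
  have := Real.add_one_le_exp (-((y : ℝ) / (n + 1)))
  calc ((n : ℝ) + 1) * (1 - Real.exp (-((y : ℝ) / (n + 1))))
      ≤ (n + 1) * ((y : ℝ) / (n + 1)) := by
        gcongr; linarith
    _ = y := by field_simp

lemma tendsto_mul_one_sub_nexp_div (y : ℝ≥0∞) :
    Filter.Tendsto (fun n : ℕ => ((n : ℝ≥0∞) + 1) * (1 - nexp (y / (n + 1)))) Filter.atTop
      (nhds y) := by
  rcases eq_or_ne y ⊤ with rfl | hy
  · have : ∀ n : ℕ, ((n : ℝ≥0∞) + 1) * (1 - nexp (⊤ / (n + 1))) = ((n + 1 : ℕ) : ℝ≥0∞) := by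
      intro n
      rw [ENNReal.top_div_of_ne_top (by finiteness)]
      simp
    simp_rw [this]
    exact ENNReal.tendsto_nat_nhds_top.comp (Filter.tendsto_add_atTop_nat 1)
  lift y to NNReal using hy
  have lower : ∀ n : ℕ, ENNReal.ofReal ((y : ℝ) / (1 + y * (1 / ((n : ℝ) + 1))))
      ≤ ((n : ℝ≥0∞) + 1) * (1 - nexp (y / (n + 1))) := by
    intro n
    have hn : (0 : ℝ) < n + 1 := by positivity
    have e1 : (y : ℝ≥0∞) / (n + 1) = ENNReal.ofReal ((y : ℝ) / (n + 1)) := by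
      rw [ENNReal.ofReal_div_of_pos hn, ENNReal.ofReal_add (by positivity) zero_le_one]
      simp
    have e2 : ((n : ℝ≥0∞) + 1) = ENNReal.ofReal (n + 1) := by
      rw [ENNReal.ofReal_add (by positivity) zero_le_one]; simp
    rw [e1, nexp_ofReal (by positivity), e2, ← ENNReal.ofReal_one, ← ENNReal.ofReal_sub _
      (Real.exp_pos _).le, ← ENNReal.ofReal_mul hn.le]
    refine ENNReal.ofReal_le_ofReal ?_
    have h1 := Real.add_one_le_exp ((y : ℝ) / (n + 1))
    have h2 : Real.exp (-((y : ℝ) / (n + 1))) ≤ ((y : ℝ) / (n + 1) + 1)⁻¹ := by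
      rw [Real.exp_neg]
      exact inv_anti₀ (by positivity) h1
    calc (y : ℝ) / (1 + y * (1 / ((n : ℝ) + 1)))
        = (n + 1) * (1 - ((y : ℝ) / (n + 1) + 1)⁻¹) := by field_simp; ring
      _ ≤ _ := by gcongr
  refine tendsto_of_tendsto_of_tendsto_of_le_of_le ?_ tendsto_const_nhds lower
    (fun n => mul_one_sub_nexp_div_le n y)
  have h3 : Filter.Tendsto (fun n : ℕ => (y : ℝ) / (1 + y * (1 / ((n : ℝ) + 1)))) Filter.atTop
      (nhds ((y : ℝ) / (1 + y * 0))) :=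
    tendsto_const_nhds.div (tendsto_const_nhds.add
      (tendsto_one_div_add_atTop_nhds_zero_nat.const_mul (y : ℝ))) (by simp)
  have := ENNReal.tendsto_ofReal h3
  simpa using this

lemma mul_nexp_le_one (y : ℝ≥0∞) : y * nexp y ≤ 1 := by
  rcases eq_or_ne y ⊤ with rfl | hy
  · simp
  lift y to NNReal using hy
  rw [← ENNReal.ofReal_coe_nnreal, nexp_ofReal y.coe_nonneg, ← ENNReal.ofReal_mul y.coe_nonneg,
    ← ENNReal.ofReal_one]
  refine ENNReal.ofReal_le_ofReal ?_
  rw [Real.exp_neg, mul_inv_le_iff₀ (Real.exp_pos _), one_mul]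
  linarith [Real.add_one_le_exp (y : ℝ)]

lemma mul_nexp_mul_le {s : ℝ≥0∞} (hs : s ≠ 0) (hs' : s ≠ ⊤) (y : ℝ≥0∞) :
    y * nexp (s * y) ≤ s⁻¹ := by
  have := mul_le_mul_right (mul_nexp_le_one (s * y)) s⁻¹
  rwa [← mul_assoc, ← mul_assoc, ENNReal.inv_mul_cancel hs hs', one_mul, mul_one] at this

lemma mul_mul_nexp_mul_le {s : ℝ≥0∞} (hs : s ≠ 0) (hs' : s ≠ ⊤) (y : ℝ≥0∞) :
    y * y * nexp (s * y) ≤ (s / 2)⁻¹ * (s / 2)⁻¹ := by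
  have h0 : s / 2 ≠ 0 := by simp [hs]
  have h1 : s / 2 ≠ ⊤ := ENNReal.div_ne_top hs' (by simp)
  have h2 : nexp (s * y) = nexp (s / 2 * y) * nexp (s / 2 * y) := by
    rw [← nexp_add, ← add_mul, ENNReal.add_halves]
  rw [h2, mul_mul_mul_comm]
  exact mul_le_mul' (mul_nexp_mul_le h0 h1 y) (mul_nexp_mul_le h0 h1 y)

/-- Differentiation under the integral sign for Laplace transforms. -/
lemma lintegral_mul_nexp_eq_of_forall {α : Type*} [MeasurableSpace α] {P P' : Measure α}
    {a S : α → ℝ≥0∞} (ha : Measurable a) (hS : Measurable S)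
    (h : ∀ s, s ≠ 0 → s ≠ ⊤ → ∫⁻ t, a t * nexp (s * S t) ∂P = ∫⁻ t, a t * nexp (s * S t) ∂P')
    {s : ℝ≥0∞} (hs : s ≠ 0) (hs' : s ≠ ⊤)
    (hf : ∫⁻ t, a t * nexp (s * S t) ∂P ≠ ⊤) (hf1 : ∫⁻ t, a t * S t * nexp (s * S t) ∂P ≠ ⊤)
    (hf2 : ∫⁻ t, a t * S t * nexp (s * S t) ∂P' ≠ ⊤) :
    ∫⁻ t, a t * S t * nexp (s * S t) ∂P = ∫⁻ t, a t * S t * nexp (s * S t) ∂P' := by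
  have hm : ∀ r : ℝ≥0∞, Measurable fun t => a t * nexp (r * S t) := fun r =>
    ha.mul (measurable_nexp.comp (hS.const_mul r))
  have hle : ∀ (r : ℝ≥0∞) t, s ≤ r → a t * nexp (r * S t) ≤ a t * nexp (s * S t) :=
    fun r t hr => mul_le_mul_right (nexp_antitone (mul_le_mul_left hr _)) _
  have main : ∀ Q : Measure α, ∫⁻ t, a t * nexp (s * S t) ∂Q ≠ ⊤ →
      ∫⁻ t, a t * S t * nexp (s * S t) ∂Q ≠ ⊤ →
      Filter.Tendsto (fun n : ℕ => ((n : ℝ≥0∞) + 1) * (∫⁻ t, a t * nexp (s * S t) ∂Q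
        - ∫⁻ t, a t * nexp ((s + (n + 1 : ℝ≥0∞)⁻¹) * S t) ∂Q)) Filter.atTop
        (nhds (∫⁻ t, a t * S t * nexp (s * S t) ∂Q)) := by
    intro Q hQ hQ1
    have e1 : ∀ n : ℕ, ((n : ℝ≥0∞) + 1) * (∫⁻ t, a t * nexp (s * S t) ∂Q
        - ∫⁻ t, a t * nexp ((s + (n + 1 : ℝ≥0∞)⁻¹) * S t) ∂Q)
        -- The difference quotient with step `1 / (n + 1)`. Its last factor tends to `S` and stays
        -- below it, which gives the dominating function.
        = ∫⁻ t, (a t * nexp (s * S t)) * (((n : ℝ≥0∞) + 1) * (1 - nexp (S t / (n + 1)))) ∂Q := by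
      intro n
      rw [← lintegral_sub (hm _) (ne_top_of_le_ne_top hQ (lintegral_mono fun t => hle _ t (by simp)))
        (Filter.Eventually.of_forall fun t => hle _ t (by simp)), ← lintegral_const_mul _
        (f := fun t => a t * nexp (s * S t) - a t * nexp ((s + (n + 1 : ℝ≥0∞)⁻¹) * S t))
        ((hm _).sub (hm _))]
      refine lintegral_congr_ae ?_
      filter_upwards [ae_lt_top (hm s) hQ] with t ht
      have e2 : a t * nexp ((s + (n + 1 : ℝ≥0∞)⁻¹) * S t)
          = (a t * nexp (s * S t)) * nexp (S t / (n + 1)) := by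
        rw [add_mul, nexp_add, mul_assoc, div_eq_mul_inv, mul_comm (S t)]
      rw [e2, mul_left_comm, ENNReal.mul_sub (fun _ _ => ht.ne), mul_one]
    simp_rw [e1]
    refine tendsto_lintegral_of_dominated_convergence (fun t => a t * S t * nexp (s * S t))
      (fun n => ?_) (fun n => ?_) hQ1 ?_
    · exact (hm s).mul ((measurable_const.sub
        (measurable_nexp.comp (hS.div_const _))).const_mul _)
    · refine Filter.Eventually.of_forall fun t => ?_
      simp only
      rw [mul_right_comm (a t) (S t)]
      exact mul_le_mul_right (mul_one_sub_nexp_div_le n (S t)) _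
    · filter_upwards [ae_lt_top (hm s) hQ] with t ht
      rw [mul_right_comm (a t) (S t)]
      exact ENNReal.Tendsto.const_mul (tendsto_mul_one_sub_nexp_div (S t)) (Or.inr ht.ne)
  refine tendsto_nhds_unique (main P hf hf1) ((main P' (h s hs hs' ▸ hf) hf2).congr fun n => ?_)
  rw [h s hs hs', h _ (by simp [hs]) (by finiteness)]

/-- Derivative of the Laplace transform in `s`. The bound `y exp(-sy) ≤ 1/s` gives finiteness
without any moment of `S`. -/
lemma lawInvariant_treeSum (hF : Measurable F) (j : ℕ) :
    LawInvariant θ ζ F j (treeSum F j) := by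
  intro L L' hL hL' x s hs hs'
  have := hL.isProbabilityMeasure
  have := hL'.isProbabilityMeasure
  have hS : Measurable (treeSum F j x) := (measurable_treeSum hF j).comp measurable_prodMk_left
  have hfin : ∀ (Q : Measure (Tree X j)), IsProbabilityMeasure Q →
      ∫⁻ t, 1 * treeSum F j x t * nexp (s * treeSum F j x t) ∂Q ≠ ⊤ := by
    intro Q _
    refine ne_top_of_le_ne_top (ENNReal.inv_ne_top.2 hs)
      ((lintegral_mono (g := fun _ => s⁻¹) fun t => ?_).trans (by simp))
    rw [one_mul]
    exact mul_nexp_mul_le hs hs' _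
  have := lintegral_mul_nexp_eq_of_forall (P := L) (P' := L') (a := fun _ => 1)
    measurable_const hS (fun s hs hs' => lawInvariant_one hF j L L' hL hL' x s hs hs') hs hs'
    (ne_top_of_le_ne_top ENNReal.one_ne_top (by simpa using lintegral_nexp_le_one L _))
    (hfin L inferInstance) (hfin L' inferInstance)
  simpa using this

/-- Second derivative of the Laplace transform. Splitting `exp(-sy)` into two factors at `s / 2`
bounds `y² exp(-sy)`. -/
lemma lawInvariant_treeSum_sq (hF : Measurable F) (j : ℕ) :
    LawInvariant θ ζ F j (fun x t => treeSum F j x t * treeSum F j x t) := by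
  intro L L' hL hL' x s hs hs'
  have := hL.isProbabilityMeasure
  have := hL'.isProbabilityMeasure
  have hS : Measurable (treeSum F j x) := (measurable_treeSum hF j).comp measurable_prodMk_left
  have h0 : s / 2 ≠ 0 := by simp [hs]
  have hfin : ∀ (Q : Measure (Tree X j)), IsProbabilityMeasure Q →
      ∫⁻ t, treeSum F j x t * treeSum F j x t * nexp (s * treeSum F j x t) ∂Q ≠ ⊤ := by
    intro Q _
    refine ne_top_of_le_ne_top
      (ENNReal.mul_ne_top (ENNReal.inv_ne_top.2 h0) (ENNReal.inv_ne_top.2 h0))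
      ((lintegral_mono (g := fun _ => (s / 2)⁻¹ * (s / 2)⁻¹) fun t => ?_).trans (by simp))
    exact mul_mul_nexp_mul_le hs hs' _
  refine lintegral_mul_nexp_eq_of_forall hS hS
    (fun s hs hs' => lawInvariant_treeSum hF j L L' hL hL' x s hs hs') hs hs' ?_
    (hfin L inferInstance) (hfin L' inferInstance)
  refine ne_top_of_le_ne_top (ENNReal.inv_ne_top.2 hs)
      ((lintegral_mono (g := fun _ => s⁻¹) fun t => ?_).trans (by simp))
  exact mul_nexp_mul_le hs hs' _

lemma lawInvariant_treeSq (hF : Measurable F) :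
    ∀ d j, LawInvariant θ ζ F j (treeSq F d j)
  | 0, j => lawInvariant_treeSum_sq hF j
  | _ + 1, 0 => by intro L L' _ _ x s _ _; simp [treeSq]
  | d + 1, j + 1 => (lawInvariant_treeSq hF d j).lift hF (measurable_treeSq hF d j) two_ne_zero

end

section

variable {X : Type} [MeasurableSpace X] [Add X] [MeasurableAdd₂ X]
  {θ : ℕ → ℝ} {ζ : ℕ → Measure X} [∀ j, IsProbabilityMeasure (ζ j)] {F : X → ℝ≥0∞}

/-! ### Moments of the form `E[A S ^ (p - b)]` -/

section Power

variable {j : ℕ} {ρ : Measure (ℕ → ℝ)} {M : ℕ → Measure (Tree X j)}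

/-- By Tonelli the weight `e` is integrated first. Scaling of the power intensity then separates the
dependence on `l` from that on the subtree. -/
lemma lintegral_lift_mul_nexp_eq (hF : Measurable F)
    (hρ : IsMecke (powerIntensity (θ (j + 1))) ρ) (hM : ∀ n, TreeLaw θ ζ j (M n))
    {A : X → Tree X j → ℝ≥0∞}
    (hA : Measurable (Function.uncurry A)) (hA' : LawInvariant θ ζ F j A)
    {b : ℕ} (hb : b ≠ 0) (hθ : θ (j + 1) < b) (x : X) {l : ℝ} (hl : 0 < l) :
    ∫⁻ t, lift b A x t * nexp (ENNReal.ofReal l * treeSum F (j + 1) x t) ∂(nodeLaw ρ (ζ j) M)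
      = ENNReal.ofReal (Real.Gamma (b - θ (j + 1))) * ENNReal.ofReal (l ^ (θ (j + 1) - b))
        * (∫⁻ y, A (x + y.1) y.2 * treeSum F j (x + y.1) y.2 ^ (θ (j + 1) - b)
          ∂((ζ j).prod (M 0)))
        * ∫⁻ t, nexp (ENNReal.ofReal l * treeSum F (j + 1) x t) ∂(nodeLaw ρ (ζ j) M) := by
  have := (hM 0).isProbabilityMeasure
  have := sigmaFinite_powerIntensity (θ (j + 1))
  rw [lintegral_lift_mul_nexp hF hρ hM (lawInvariant_one hF j) hA hA' hb x (by simpa using hl)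
    ENNReal.ofReal_ne_top]
  congr 1
  have hm : Measurable fun y : X × Tree X j => (x + y.1, y.2) :=
    (measurable_fst.const_add x).prodMk measurable_snd
  have hAm : Measurable fun y : X × Tree X j => A (x + y.1) y.2 := hA.comp hm
  have hSm : Measurable fun y : X × Tree X j => treeSum F j (x + y.1) y.2 :=
    (measurable_treeSum hF j).comp hm
  have hjoint : Measurable fun p : ℝ × (X × Tree X j) => ENNReal.ofReal p.1 ^ b *
      (A (x + p.2.1) p.2.2 *
        nexp (ENNReal.ofReal l * ENNReal.ofReal p.1 * treeSum F j (x + p.2.1) p.2.2)) :=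
    ((ENNReal.measurable_ofReal.comp measurable_fst).pow_const b).mul
      ((hAm.comp measurable_snd).mul (measurable_nexp.comp
        (((ENNReal.measurable_ofReal.comp measurable_fst).const_mul _).mul
          (hSm.comp measurable_snd))))
  calc ∫⁻ e, ENNReal.ofReal e ^ b * ∫⁻ y, A (x + y.1) y.2 *
          nexp (ENNReal.ofReal l * ENNReal.ofReal e * treeSum F j (x + y.1) y.2)
          ∂((ζ j).prod (M 0)) ∂(powerIntensity (θ (j + 1)))
      = ∫⁻ e, ∫⁻ y, ENNReal.ofReal e ^ b * (A (x + y.1) y.2 *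
          nexp (ENNReal.ofReal l * ENNReal.ofReal e * treeSum F j (x + y.1) y.2))
          ∂((ζ j).prod (M 0)) ∂(powerIntensity (θ (j + 1))) := by
        refine lintegral_congr fun e => ?_
        rw [lintegral_const_mul]
        exact hAm.mul (measurable_nexp.comp (hSm.const_mul _))
    _ = ∫⁻ y, ∫⁻ e, ENNReal.ofReal e ^ b * (A (x + y.1) y.2 *
          nexp (ENNReal.ofReal l * ENNReal.ofReal e * treeSum F j (x + y.1) y.2))
          ∂(powerIntensity (θ (j + 1))) ∂((ζ j).prod (M 0)) :=
        lintegral_lintegral_swap hjoint.aemeasurable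
    _ = ∫⁻ y, ENNReal.ofReal (Real.Gamma (b - θ (j + 1))) *
          ENNReal.ofReal (l ^ (θ (j + 1) - b)) *
          (A (x + y.1) y.2 * treeSum F j (x + y.1) y.2 ^ (θ (j + 1) - b)) ∂((ζ j).prod (M 0)) := by
        refine lintegral_congr fun y => ?_
        simp_rw [mul_left_comm _ (A (x + y.1) y.2)]
        rw [lintegral_const_mul, lintegral_powerIntensity_nexp hθ hl]
        fun_prop
    _ = _ := by
        rw [lintegral_const_mul]
        exact hAm.mul (hSm.pow_const _)

/-- `Γ(b-p) S^(p-b)` is the integral of `l^(b-p-1) exp(-lS)`. The exponent `b` cancels in the power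
of `l`, so the middle factor on the right is the same for every `A` and `b`. -/
lemma gamma_mul_lintegral_lift (hF : Measurable F)
    (hρ : IsMecke (powerIntensity (θ (j + 1))) ρ) (hM : ∀ n, TreeLaw θ ζ j (M n))
    {A : X → Tree X j → ℝ≥0∞}
    (hA : Measurable (Function.uncurry A)) (hA' : LawInvariant θ ζ F j A)
    {b : ℕ} (hb : b ≠ 0) (hθ : θ (j + 1) < b) (x : X) {p : ℝ} (hp : p < b) :
    ENNReal.ofReal (Real.Gamma (b - p)) *
        ∫⁻ t, lift b A x t * treeSum F (j + 1) x t ^ (p - b) ∂(nodeLaw ρ (ζ j) M)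
      = ENNReal.ofReal (Real.Gamma (b - θ (j + 1)))
        * (∫⁻ l in Set.Ioi (0 : ℝ), ENNReal.ofReal (l ^ (θ (j + 1) - p - 1)) *
          ∫⁻ t, nexp (ENNReal.ofReal l * treeSum F (j + 1) x t) ∂(nodeLaw ρ (ζ j) M))
        * ∫⁻ y, A (x + y.1) y.2 * treeSum F j (x + y.1) y.2 ^ (θ (j + 1) - b)
          ∂((ζ j).prod (M 0)) := by
  have hprob : IsProbabilityMeasure (nodeLaw ρ (ζ j) M) :=
    TreeLaw.isProbabilityMeasure (θ := θ) (ζ := ζ) (j := j + 1) ⟨ρ, M, hρ, hM, rfl⟩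
  have hS : Measurable (treeSum F (j + 1) x) :=
    (measurable_treeSum hF (j + 1)).comp measurable_prodMk_left
  have hL : Measurable (lift b A x) := (measurable_lift b hA).comp measurable_prodMk_left
  have hjoint : Measurable fun q : Tree X (j + 1) × ℝ => lift b A x q.1 *
      (ENNReal.ofReal (q.2 ^ ((b : ℝ) - p - 1)) *
        nexp (ENNReal.ofReal q.2 * treeSum F (j + 1) x q.1)) :=
    (hL.comp measurable_fst).mul (((measurable_ofReal_rpow _).comp measurable_snd).mul
      (measurable_nexp.comp ((ENNReal.measurable_ofReal.comp measurable_snd).mul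
        (hS.comp measurable_fst))))
  have hφ : Measurable fun l : ℝ =>
      ∫⁻ t, nexp (ENNReal.ofReal l * treeSum F (j + 1) x t) ∂(nodeLaw ρ (ζ j) M) :=
    Measurable.lintegral_prod_right' (f := fun q : ℝ × Tree X (j + 1) =>
      nexp (ENNReal.ofReal q.1 * treeSum F (j + 1) x q.2)) (measurable_nexp.comp
      ((ENNReal.measurable_ofReal.comp measurable_fst).mul (hS.comp measurable_snd)))
  set MA := ∫⁻ y, A (x + y.1) y.2 * treeSum F j (x + y.1) y.2 ^ (θ (j + 1) - b)
          ∂((ζ j).prod (M 0)) with hMA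
  calc ENNReal.ofReal (Real.Gamma (b - p)) *
        ∫⁻ t, lift b A x t * treeSum F (j + 1) x t ^ (p - b) ∂(nodeLaw ρ (ζ j) M)
      = ∫⁻ t, ∫⁻ l in Set.Ioi (0 : ℝ), lift b A x t * (ENNReal.ofReal (l ^ ((b : ℝ) - p - 1)) *
          nexp (ENNReal.ofReal l * treeSum F (j + 1) x t)) ∂volume ∂(nodeLaw ρ (ζ j) M) := by
        have h1 : Measurable fun t => lift b A x t * treeSum F (j + 1) x t ^ (p - b) :=
          hL.mul (hS.pow_const _)
        rw [← lintegral_const_mul _ h1]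
        refine lintegral_congr fun t => ?_
        rw [lintegral_const_mul, lintegral_rpow_mul_nexp (by linarith), neg_sub]
        · ring
        · exact (measurable_ofReal_rpow _).mul (by fun_prop)
    _ = ∫⁻ l in Set.Ioi (0 : ℝ), ∫⁻ t, lift b A x t * (ENNReal.ofReal (l ^ ((b : ℝ) - p - 1)) *
          nexp (ENNReal.ofReal l * treeSum F (j + 1) x t)) ∂(nodeLaw ρ (ζ j) M) :=
        lintegral_lintegral_swap hjoint.aemeasurable
    _ = ∫⁻ l in Set.Ioi (0 : ℝ), ENNReal.ofReal (Real.Gamma (b - θ (j + 1))) * MA *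
          (ENNReal.ofReal (l ^ (θ (j + 1) - p - 1)) *
            ∫⁻ t, nexp (ENNReal.ofReal l * treeSum F (j + 1) x t) ∂(nodeLaw ρ (ζ j) M)) := by
        refine setLIntegral_congr_fun measurableSet_Ioi fun l hl => ?_
        have hl' : 0 < l := hl
        simp_rw [mul_left_comm _ (ENNReal.ofReal (l ^ ((b : ℝ) - p - 1)))]
        have h1 : Measurable fun t => lift b A x t *
            nexp (ENNReal.ofReal l * treeSum F (j + 1) x t) :=
          hL.mul (measurable_nexp.comp (hS.const_mul _))
        rw [lintegral_const_mul _ h1,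
          lintegral_lift_mul_nexp_eq hF hρ hM hA hA' hb hθ x hl', ← hMA]
        have : ENNReal.ofReal (l ^ ((b : ℝ) - p - 1)) * ENNReal.ofReal (l ^ (θ (j + 1) - b))
            = ENNReal.ofReal (l ^ (θ (j + 1) - p - 1)) := by
          rw [← ENNReal.ofReal_mul (by positivity), ← Real.rpow_add hl']
          congr 2; ring
        rw [← this]
        ring
    _ = _ := by
        have hJ : Measurable fun l : ℝ => ENNReal.ofReal (l ^ (θ (j + 1) - p - 1)) *
            ∫⁻ t, nexp (ENNReal.ofReal l * treeSum F (j + 1) x t) ∂(nodeLaw ρ (ζ j) M) :=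
          (measurable_ofReal_rpow _).mul hφ
        rw [lintegral_const_mul _ hJ]
        ring

end Power

/-- It holds at `0` and `∞` too, since `p < 1` makes both sides vanish there. The recursion
therefore needs no finiteness. -/
lemma mul_mul_rpow_sub_two (p : ℝ) (hp : p < 1) (s : ℝ≥0∞) :
    s * s * s ^ (p - (2 : ℕ)) = s * s ^ (p - (1 : ℕ)) := by
  rcases eq_or_ne s 0 with rfl | h0
  · simp
  rcases eq_or_ne s ⊤ with rfl | h1
  · rw [ENNReal.top_rpow_of_neg (by push_cast; linarith),
      ENNReal.top_rpow_of_neg (by push_cast; linarith)]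
    simp
  · have : s ^ (p - (1 : ℕ)) = s * s ^ (p - (2 : ℕ)) := by
      nth_rewrite 2 [← ENNReal.rpow_one s]
      rw [← ENNReal.rpow_add _ _ h0 h1]
      congr 1; push_cast; ring
    rw [this, mul_assoc]

/-- The expected sum of the squared weights of the subtrees at depth `d`. -/
lemma lintegral_treeSq_mul_rpow (hF : Measurable F) :
    ∀ (d j : ℕ), d ≤ j → (∀ i, 1 ≤ i → i ≤ j → θ i < 1) → ∀ L, TreeLaw θ ζ j L →
    ∀ (p : ℝ), p < 1 → ∀ x,
      ENNReal.ofReal (1 - p) * ∫⁻ t, treeSq F d j x t * treeSum F j x t ^ (p - (2 : ℕ)) ∂L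
      = ENNReal.ofReal (1 - if d = 0 then p else θ (j - d + 1)) *
        ∫⁻ t, treeSum F j x t * treeSum F j x t ^ (p - (1 : ℕ)) ∂L
  | 0, j, _, _, L, hL, p, hp, x => by
    simp only [treeSq, mul_mul_rpow_sub_two p hp, if_true]
  | d + 1, 0, h, _, L, hL, p, hp, x => by omega
  | d + 1, j + 1, h, hθ, L, hL, p, hp, x => by
    obtain ⟨ρ, M, hρ, hM, rfl⟩ := hL
    have hθj : θ (j + 1) < 1 := hθ (j + 1) (by omega) le_rfl
    have := (hM 0).isProbabilityMeasure
    -- The subtree is used with the exponent of the root process in place of `p`.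
    have ih := lintegral_treeSq_mul_rpow hF d j (by omega) (fun i hi hi' => hθ i hi (by omega))
      (M 0) (hM 0) (θ (j + 1)) hθj
    have e2 := gamma_mul_lintegral_lift hF hρ hM (measurable_treeSq hF d j)
      (lawInvariant_treeSq hF d j) two_ne_zero (by push_cast; linarith) x (p := p)
      (by push_cast; linarith)
    have e1 := gamma_mul_lintegral_lift hF hρ hM (measurable_treeSum hF j)
      (lawInvariant_treeSum hF j) one_ne_zero (by push_cast; linarith) x (p := p)
      (by push_cast; linarith)
    have hm : Measurable fun y : X × Tree X j => (x + y.1, y.2) :=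
      (measurable_fst.const_add x).prodMk measurable_snd
    have hSm : Measurable fun y : X × Tree X j => treeSum F j (x + y.1) y.2 :=
      (measurable_treeSum hF j).comp hm
    have hQm : Measurable fun y : X × Tree X j => treeSq F d j (x + y.1) y.2 :=
      (measurable_treeSq hF d j).comp hm
    have ih' : ENNReal.ofReal (1 - θ (j + 1)) *
        ∫⁻ y, treeSq F d j (x + y.1) y.2 * treeSum F j (x + y.1) y.2 ^ (θ (j + 1) - (2 : ℕ))
          ∂((ζ j).prod (M 0))
        = ENNReal.ofReal (1 - if d = 0 then θ (j + 1) else θ (j - d + 1)) *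
        ∫⁻ y, treeSum F j (x + y.1) y.2 * treeSum F j (x + y.1) y.2 ^ (θ (j + 1) - (1 : ℕ))
          ∂((ζ j).prod (M 0)) := by
      have hQ : Measurable fun y : X × Tree X j =>
          treeSq F d j (x + y.1) y.2 * treeSum F j (x + y.1) y.2 ^ (θ (j + 1) - (2 : ℕ)) :=
        hQm.mul (hSm.pow_const _)
      have hS : Measurable fun y : X × Tree X j =>
          treeSum F j (x + y.1) y.2 * treeSum F j (x + y.1) y.2 ^ (θ (j + 1) - (1 : ℕ)) :=
        hSm.mul (hSm.pow_const _)
      rw [lintegral_prod _ hQ.aemeasurable, lintegral_prod _ hS.aemeasurable,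
        ← lintegral_const_mul _ hQ.lintegral_prod_right',
        ← lintegral_const_mul _ hS.lintegral_prod_right']
      exact lintegral_congr fun z => ih (x + z)
    have hG : ∀ r : ℝ, r < 1 → ENNReal.ofReal (Real.Gamma ((2 : ℕ) - r))
        = ENNReal.ofReal (1 - r) * ENNReal.ofReal (Real.Gamma ((1 : ℕ) - r)) := by
      intro r hr
      rw [← ENNReal.ofReal_mul (by linarith)]
      congr 1
      have := Real.Gamma_add_one (s := 1 - r) (by linarith)
      push_cast
      rw [← this]
      congr 1; ring
    rw [hG p hp, hG _ hθj] at e2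
    -- When the induction reaches `d = 0` the running exponent is `θ (j + 1)`, which is the value of
    -- the general formula at one level higher.
    have hidx : (if d = 0 then θ (j + 1) else θ (j - d + 1))
        = if d + 1 = 0 then p else θ (j + 1 - (d + 1) + 1) := by
      rw [if_neg (Nat.succ_ne_zero d), Nat.add_sub_add_right]
      split_ifs with h0
      · rw [h0, Nat.sub_zero]
      · rfl
    rw [hidx] at ih'
    -- Only the positive finite factor `Γ(1-p)` is cancelled. The common integral over `l`, which
    -- may be infinite, is never divided out.
    have hGp : ENNReal.ofReal (Real.Gamma ((1 : ℕ) - p)) ≠ 0 := by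
      have : 0 < Real.Gamma ((1 : ℕ) - p) := Real.Gamma_pos_of_pos (by push_cast; linarith)
      simpa using this
    refine (ENNReal.mul_right_inj hGp ENNReal.ofReal_ne_top).1 ?_
    change _ * (_ * ∫⁻ t, lift 2 (treeSq F d j) x t * _ ∂_)
      = _ * (_ * ∫⁻ t, lift 1 (treeSum F j) x t * _ ∂_)
    rw [← mul_assoc, mul_comm (ENNReal.ofReal (Real.Gamma _)), e2,
      mul_left_comm (ENNReal.ofReal (Real.Gamma _)), e1]
    rw [mul_left_comm, ← ih']
    ring

end

section

/-! ### Finiteness of fractional moments -/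

lemma rpow_tsum_le_tsum_rpow (a : ℕ → ℝ≥0∞) {p : ℝ} (hp : 0 < p) (hp1 : p ≤ 1) :
    (∑' n, a n) ^ p ≤ ∑' n, a n ^ p := by
  have hfin : ∀ s : ℕ, (∑ n ∈ Finset.range s, a n) ^ p ≤ ∑ n ∈ Finset.range s, a n ^ p := by
    intro s
    induction s with
    | zero => simp [hp]
    | succ s ih =>
      rw [Finset.sum_range_succ, Finset.sum_range_succ]
      exact (ENNReal.rpow_add_le_add_rpow _ _ hp.le hp1).trans (by gcongr)
  refine le_of_tendsto' (((ENNReal.continuous_rpow_const (y := p)).tendsto _).comp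
    (ENNReal.tendsto_nat_tsum a)) fun s => ?_
  exact (hfin s).trans (ENNReal.sum_le_tsum _)

lemma rpow_le_one_add_rpow (y : ℝ≥0∞) {p p' : ℝ} (hp : 0 < p) (hpp : p ≤ p') :
    y ^ p ≤ 1 + y ^ p' := by
  rcases le_total y 1 with h | h
  · exact (ENNReal.rpow_le_one h hp.le).trans le_self_add
  · exact (ENNReal.rpow_le_rpow_of_exponent_le h hpp).trans le_add_self

lemma ofReal_mul_rpow_le (e : ℝ) (y : ℝ≥0∞) {p : ℝ} (hp : 0 < p) :
    (ENNReal.ofReal e * y) ^ p ≤ ENNReal.ofReal (e ^ p) * y ^ p := by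
  rw [ENNReal.mul_rpow_of_nonneg _ _ hp.le]
  rcases le_or_gt e 0 with h | h
  · simp [ENNReal.ofReal_of_nonpos h, hp]
  · rw [ENNReal.ofReal_rpow_of_pos h]

/-- Splitting the sum according to whether the weight is at most `1`. -/
lemma rpow_tsum_weight_le (u : ℕ → ℝ) (a : ℕ → ℝ≥0∞) {p p' : ℝ} (hp : 0 < p) (hpp : p ≤ p')
    (hp' : p' ≤ 1) :
    (∑' n, ENNReal.ofReal (u n) * a n) ^ p ≤
      1 + ∑' n, (Set.Iic (1 : ℝ)).indicator (fun e => ENNReal.ofReal (e ^ p')) (u n) * a n ^ p'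
        + ∑' n, (Set.Ioi (1 : ℝ)).indicator (fun e => ENNReal.ofReal (e ^ p)) (u n) * a n ^ p := by
  have h0 : ∑' n, ENNReal.ofReal (u n) * a n
      = ∑' n, (Set.Iic (1 : ℝ)).indicator ENNReal.ofReal (u n) * a n
        + ∑' n, (Set.Ioi (1 : ℝ)).indicator ENNReal.ofReal (u n) * a n := by
    rw [← ENNReal.tsum_add]
    refine tsum_congr fun n => ?_
    rcases le_or_gt (u n) 1 with h | h
    · simp [h]
    · simp [h]
  have hs : ∀ (s : Set ℝ) (r : ℝ), 0 < r → ∀ n, (s.indicator ENNReal.ofReal (u n) * a n) ^ r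
      ≤ s.indicator (fun e => ENNReal.ofReal (e ^ r)) (u n) * a n ^ r := by
    intro s r hr n
    by_cases h : u n ∈ s
    · simpa [h] using ofReal_mul_rpow_le (u n) (a n) hr
    · simp [h, hr]
  rw [h0]
  have hp0' : 0 < p' := hp.trans_le hpp
  refine (ENNReal.rpow_add_le_add_rpow _ _ hp.le (hpp.trans hp')).trans ?_
  refine add_le_add ((rpow_le_one_add_rpow _ hp hpp).trans (add_le_add le_rfl ?_)) ?_
  · exact (rpow_tsum_le_tsum_rpow _ hp0' hp').trans (ENNReal.tsum_le_tsum (hs _ _ hp0'))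
  · exact (rpow_tsum_le_tsum_rpow _ hp (hpp.trans hp')).trans (ENNReal.tsum_le_tsum (hs _ _ hp))

variable {X : Type} [MeasurableSpace X] [Add X] [MeasurableAdd₂ X]
  {θ : ℕ → ℝ} {ζ : ℕ → Measure X} [∀ j, IsProbabilityMeasure (ζ j)] {F W : X → ℝ≥0∞}

/-- Subadditivity of `y ↦ y^p` moves the power inside the sum, and Campbell's inequality bounds the
result. Weights above `1` are integrable to a power below `θ (j + 1)`, weights at most `1` to a
power above it. Since the exponents decrease towards the root, both powers lie below `θ j`, where
the subtree is controlled. The weight `W` absorbs the dependence on the starting state. -/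
lemma lintegral_treeSum_rpow_le (hF : Measurable F) (hW : Measurable W) (hFW : ∀ x, F x ≤ W x)
    (h1W : ∀ x, 1 ≤ W x) (hWζ : ∀ j, ∃ K, K ≠ ⊤ ∧ ∀ x, ∫⁻ z, W (x + z) ∂(ζ j) ≤ K * W x) (J : ℕ)
    (hθ1 : ∀ i ≤ J, θ i ≤ 1) (hθ : ∀ i < J, θ (i + 1) < θ i) :
    ∀ j ≤ J, ∀ p, 0 < p → p < θ j → ∃ C, C ≠ ⊤ ∧ ∀ L, TreeLaw θ ζ j L → ∀ x,
      ∫⁻ t, treeSum F j x t ^ p ∂L ≤ C * W x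
  | 0, h0, p, hp, hp1 => by
    refine ⟨1, ENNReal.one_ne_top, fun L (hL : IsProbabilityMeasure L) x => ?_⟩
    simp only [treeSum, lintegral_const, measure_univ, mul_one, one_mul]
    calc F x ^ p ≤ W x ^ p := ENNReal.rpow_le_rpow (hFW x) hp.le
      _ ≤ W x ^ (1 : ℝ) := ENNReal.rpow_le_rpow_of_exponent_le (h1W x) (hp1.le.trans (hθ1 0 h0))
      _ = W x := ENNReal.rpow_one _
  | j + 1, hj, p, hp, hp1 => by
    have hj' : j ≤ J := by omega
    have hlt := hθ j (by omega)
    -- Any power strictly between the two exponents would do for the small weights.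
    set p' := (θ (j + 1) + θ j) / 2 with hp'
    have ha : p < p' := by rw [hp']; linarith
    have hb : p' < θ j := by rw [hp']; linarith
    obtain ⟨C, hC, hCb⟩ := lintegral_treeSum_rpow_le hF hW hFW h1W hWζ J hθ1 hθ j hj' p hp
      (ha.trans hb)
    obtain ⟨C', hC', hCb'⟩ := lintegral_treeSum_rpow_le hF hW hFW h1W hWζ J hθ1 hθ j hj' p'
      (hp.trans ha) hb
    obtain ⟨K, hK, hKb⟩ := hWζ j
    set I := ∫⁻ e, (Set.Ioi (1 : ℝ)).indicator (fun e => ENNReal.ofReal (e ^ p)) e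
      ∂(powerIntensity (θ (j + 1)))
    set I' := ∫⁻ e, (Set.Iic (1 : ℝ)).indicator (fun e => ENNReal.ofReal (e ^ p')) e
      ∂(powerIntensity (θ (j + 1)))
    have hI : I ≠ ⊤ := lintegral_powerIntensity_Ioi_ne_top hp1
    have hI' : I' ≠ ⊤ := lintegral_powerIntensity_Iic_ne_top (by rw [hp']; linarith)
    refine ⟨1 + I' * (C' * K) + I * (C * K), by finiteness, ?_⟩
    rintro L ⟨ρ, M, hρ, hM, rfl⟩ x
    have := hρ.prob
    have := fun n => (hM n).isProbabilityMeasure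
    have hprob : IsProbabilityMeasure (nodeLaw ρ (ζ j) M) :=
      TreeLaw.isProbabilityMeasure (θ := θ) (ζ := ζ) (j := j + 1) ⟨ρ, M, hρ, hM, rfl⟩
    have hSm : Measurable fun y : X × Tree X j => treeSum F j (x + y.1) y.2 :=
      (measurable_treeSum hF j).comp ((measurable_fst.const_add x).prodMk measurable_snd)
    have hmark : ∀ (r : ℝ) (D : ℝ≥0∞), (∀ L, TreeLaw θ ζ j L → ∀ x,
        ∫⁻ t, treeSum F j x t ^ r ∂L ≤ D * W x) →
        ∀ n, ∫⁻ y, treeSum F j (x + y.1) y.2 ^ r ∂((ζ j).prod (M n)) ≤ D * K * W x := by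
      intro r D hD n
      rw [lintegral_prod _ (hSm.pow_const r).aemeasurable]
      calc ∫⁻ z, ∫⁻ t, treeSum F j (x + z) t ^ r ∂(M n) ∂(ζ j)
          ≤ ∫⁻ z, D * W (x + z) ∂(ζ j) := lintegral_mono fun z => hD (M n) (hM n) (x + z)
        _ = D * ∫⁻ z, W (x + z) ∂(ζ j) :=
            lintegral_const_mul _ (hW.comp (measurable_id.const_add x))
        _ ≤ D * (K * W x) := mul_le_mul_right (hKb x) _
        _ = _ := (mul_assoc _ _ _).symm
    have b1 := hρ.lintegral_marked_tsum_le (ν := fun n => (ζ j).prod (M n))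
      ((measurable_ofReal_rpow p).indicator (measurableSet_Ioi (a := (1 : ℝ)))) (hSm.pow_const p) (hmark p C hCb)
    have b2 := hρ.lintegral_marked_tsum_le (ν := fun n => (ζ j).prod (M n))
      ((measurable_ofReal_rpow p').indicator (measurableSet_Iic (a := (1 : ℝ)))) (hSm.pow_const p')
      (hmark p' C' hCb')
    have hm1 : ∀ (s : Set ℝ), MeasurableSet s → ∀ r : ℝ, Measurable fun t : Tree X (j + 1) =>
        ∑' n, s.indicator (fun e => ENNReal.ofReal (e ^ r)) (t.1 n)
          * treeSum F j (x + (t.2 n).1) (t.2 n).2 ^ r := by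
      intro s hs r
      refine Measurable.tsum fun n => ?_
      exact (((measurable_ofReal_rpow r).indicator hs).comp
        ((measurable_pi_apply n).comp measurable_fst)).mul
        ((hSm.comp ((measurable_pi_apply n).comp measurable_snd)).pow_const r)
    calc ∫⁻ t, treeSum F (j + 1) x t ^ p ∂(nodeLaw ρ (ζ j) M)
        ≤ ∫⁻ t, (1 + ∑' n, (Set.Iic (1 : ℝ)).indicator (fun e => ENNReal.ofReal (e ^ p')) (t.1 n)
            * treeSum F j (x + (t.2 n).1) (t.2 n).2 ^ p'
          + ∑' n, (Set.Ioi (1 : ℝ)).indicator (fun e => ENNReal.ofReal (e ^ p)) (t.1 n)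
            * treeSum F j (x + (t.2 n).1) (t.2 n).2 ^ p) ∂(nodeLaw ρ (ζ j) M) := by
          refine lintegral_mono fun t => ?_
          simp only [treeSum, lift, pow_one]
          exact rpow_tsum_weight_le t.1 _ hp ha.le (hb.le.trans (hθ1 j hj'))
      _ = 1 + ∫⁻ t, ∑' n, (Set.Iic (1 : ℝ)).indicator (fun e => ENNReal.ofReal (e ^ p')) (t.1 n)
            * treeSum F j (x + (t.2 n).1) (t.2 n).2 ^ p' ∂(nodeLaw ρ (ζ j) M)
          + ∫⁻ t, ∑' n, (Set.Ioi (1 : ℝ)).indicator (fun e => ENNReal.ofReal (e ^ p)) (t.1 n)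
            * treeSum F j (x + (t.2 n).1) (t.2 n).2 ^ p ∂(nodeLaw ρ (ζ j) M) := by
          rw [lintegral_add_right _ (hm1 _ measurableSet_Ioi p),
            lintegral_add_right _ (hm1 _ measurableSet_Iic p')]
          simp
      _ ≤ 1 + I' * (C' * K * W x) + I * (C * K * W x) :=
          add_le_add (add_le_add le_rfl b2) b1
      _ ≤ W x + I' * (C' * K * W x) + I * (C * K * W x) := by gcongr; exact h1W x
      _ = _ := by ring

lemma ae_treeSum_lt_top (hF : Measurable F) (hW : Measurable W) (hFW : ∀ x, F x ≤ W x)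
    (h1W : ∀ x, 1 ≤ W x) (hWζ : ∀ j, ∃ K, K ≠ ⊤ ∧ ∀ x, ∫⁻ z, W (x + z) ∂(ζ j) ≤ K * W x) {J : ℕ}
    (hθ1 : ∀ i ≤ J, θ i ≤ 1) (hθ : ∀ i < J, θ (i + 1) < θ i) (hθ0 : 0 < θ J)
    {L : Measure (Tree X J)} (hL : TreeLaw θ ζ J L) (x : X) (hx : W x ≠ ⊤) :
    ∀ᵐ t ∂L, treeSum F J x t < ⊤ := by
  obtain ⟨C, hC, hb⟩ := lintegral_treeSum_rpow_le hF hW hFW h1W hWζ J hθ1 hθ J le_rfl (θ J / 2)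
    (by linarith) (by linarith)
  have hS : Measurable fun t => treeSum F J x t ^ (θ J / 2) :=
    ((measurable_treeSum hF J).comp measurable_prodMk_left).pow_const _
  filter_upwards [ae_lt_top hS (ne_top_of_le_ne_top (ENNReal.mul_ne_top hC hx) (hb L hL x))]
    with t ht
  by_contra hcon
  rw [not_lt_top_iff.1 hcon, ENNReal.top_rpow_of_pos (by linarith)] at ht
  exact lt_irrefl _ ht

end

section

/-! ### Independence of blocks of σ-algebras -/

/-- Induction on the finite set of blocks: one block is independent of the union of the others. -/
lemma iIndep_iSup_of_pairwise_disjoint {Ω ι κ : Type*} {mΩ : MeasurableSpace Ω} {μ : Measure Ω}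
    {m : ι → MeasurableSpace Ω} (h_le : ∀ i, m i ≤ mΩ) (h : iIndep m μ) {S : κ → Set ι}
    (hS : ∀ k l, k ≠ l → Disjoint (S k) (S l)) :
    iIndep (fun k => ⨆ i ∈ S k, m i) μ := by
  classical
  have hprob := h.isProbabilityMeasure
  rw [iIndep_iff]
  intro s f hf
  induction s using Finset.induction_on with
  | empty => simp
  | insert a s ha ih =>
    rw [Finset.set_biInter_insert, Finset.prod_insert ha,
      ← ih fun i hi => hf i (Finset.mem_insert_of_mem hi)]
    have hd : Disjoint (S a) (⋃ k ∈ s, S k) := by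
      simp only [Set.disjoint_iUnion_right]
      intro k hk
      exact hS a k fun e => ha (e ▸ hk)
    refine (Indep_iff _ _ _).1 (indep_iSup_of_disjoint h_le h hd) _ _
      (hf a (Finset.mem_insert_self _ _)) ?_
    refine Finset.measurableSet_biInter _ fun k hk => ?_
    refine (?_ : (⨆ i ∈ S k, m i) ≤ ⨆ i ∈ ⋃ k ∈ s, S k, m i) _
      (hf k (Finset.mem_insert_of_mem hk))
    exact biSup_mono fun i hi => Set.mem_biUnion (Finset.mem_coe.2 hk) hi

lemma iIndep_sumElim {Ω ι κ : Type*} {mΩ : MeasurableSpace Ω} {μ : Measure Ω}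
    {m₁ : ι → MeasurableSpace Ω} {m₂ : κ → MeasurableSpace Ω} (h₁ : iIndep m₁ μ)
    (h₂ : iIndep m₂ μ) (h : Indep (⨆ i, m₁ i) (⨆ i, m₂ i) μ) :
    iIndep (Sum.elim m₁ m₂) μ := by
  classical
  rw [iIndep_iff]
  intro s f hf
  have e1 : (⋂ i ∈ s, f i) = (⋂ i ∈ s.toLeft, f (Sum.inl i)) ∩ ⋂ i ∈ s.toRight, f (Sum.inr i) := by
    ext ω
    simp only [Set.mem_iInter, Set.mem_inter_iff, Finset.mem_toLeft, Finset.mem_toRight]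
    constructor
    · exact fun h => ⟨fun i hi => h _ hi, fun i hi => h _ hi⟩
    · rintro ⟨h1, h2⟩ (i | i) hi
      exacts [h1 i hi, h2 i hi]
  rw [e1, Finset.prod_sum_eq_prod_toLeft_mul_prod_toRight,
    ← (iIndep_iff _ _).1 h₁ s.toLeft fun i hi => hf (Sum.inl i) (Finset.mem_toLeft.1 hi),
    ← (iIndep_iff _ _).1 h₂ s.toRight fun i hi => hf (Sum.inr i) (Finset.mem_toRight.1 hi)]
  refine (Indep_iff _ _ _).1 h _ _ ?_ ?_
  · refine Finset.measurableSet_biInter _ fun i hi => ?_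
    exact le_iSup m₁ i _ (hf (Sum.inl i) (Finset.mem_toLeft.1 hi))
  · refine Finset.measurableSet_biInter _ fun i hi => ?_
    exact le_iSup m₂ i _ (hf (Sum.inr i) (Finset.mem_toRight.1 hi))

/-! ### The tree attached to weights and marks on the nodes -/

/-- The tree of depth `j` below the node `a`, with weights `U` and marks `V`. -/
def mkTree {X : Type} (U : List ℕ → ℕ → ℝ) (V : List ℕ → X) : ∀ j, List ℕ → Tree X j
  | 0, _ => ()
  | j + 1, a => (U a, fun n => (V (a ++ [n]), mkTree U V j (a ++ [n])))

/-- The node of an index of the family of weights (left) and marks (right). -/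
def nodeOf : List ℕ ⊕ List ℕ → List ℕ := Sum.elim id id

/-- The weights and marks on which the tree below `a` depends. -/
def treeIndex (a : List ℕ) : Set (List ℕ ⊕ List ℕ) :=
  {i | i = Sum.inl a ∨ ∃ n, a ++ [n] <+: nodeOf i}

/-- The weights and marks at the nodes below `a`, including `a`. -/
def belowIndex (a : List ℕ) : Set (List ℕ ⊕ List ℕ) := {i | a <+: nodeOf i}

lemma treeIndex_subset (a : List ℕ) (n : ℕ) : treeIndex (a ++ [n]) ⊆ belowIndex (a ++ [n]) := by
  rintro i (rfl | ⟨m, hm⟩)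
  · exact List.prefix_rfl
  · exact (List.prefix_append _ _).trans hm

lemma belowIndex_subset (a : List ℕ) (n : ℕ) : belowIndex (a ++ [n]) ⊆ treeIndex a :=
  fun _ hi => Or.inr ⟨n, hi⟩

lemma disjoint_belowIndex (a : List ℕ) {n m : ℕ} (h : n ≠ m) :
    Disjoint (belowIndex (a ++ [n])) (belowIndex (a ++ [m])) := by
  refine Set.disjoint_left.2 fun i hi hi' => h ?_
  have := List.prefix_of_prefix_length_le hi hi' (by simp)
  simpa using this.eq_of_length (by simp)

lemma inl_notMem_belowIndex (a : List ℕ) (n : ℕ) : Sum.inl a ∉ belowIndex (a ++ [n]) := by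
  intro h
  have := h.length_le
  simp [nodeOf] at this

lemma inr_notMem_treeIndex (a : List ℕ) : Sum.inr a ∉ treeIndex a := by
  rintro (h | ⟨n, h⟩)
  · cases h
  · have := h.length_le
    simp [nodeOf] at this

lemma measurable_of_forall_eval {α ι Y : Type*} {m : MeasurableSpace α} [MeasurableSpace Y]
    {f : α → ι → Y} (h : ∀ i, Measurable[m] fun ω => f ω i) : Measurable[m] f :=
  measurable_pi_lambda f h

section Law

variable {Ω : Type*} {mΩ : MeasurableSpace Ω} {X : Type} [MeasurableSpace X]
  {U : List ℕ → Ω → ℕ → ℝ} {V : List ℕ → Ω → X}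

/-- The σ-algebras generated by the weights and by the marks. -/
abbrev nodeSigma (U : List ℕ → Ω → ℕ → ℝ) (V : List ℕ → Ω → X) :
    List ℕ ⊕ List ℕ → MeasurableSpace Ω :=
  Sum.elim (fun a => MeasurableSpace.comap (U a) inferInstance)
    (fun a => MeasurableSpace.comap (V a) inferInstance)

/-- Measurability for the small σ-algebra, not only the ambient one: independence of sibling
subtrees is read off from disjoint index sets. -/
lemma measurable_mkTree_iSup : ∀ (j : ℕ) (a : List ℕ),
    Measurable[⨆ i ∈ treeIndex a, nodeSigma U V i]
      fun ω => mkTree (fun b => U b ω) (fun b => V b ω) j a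
  | 0, a => measurable_const
  | j + 1, a => by
    have hle : ∀ n, (⨆ i ∈ belowIndex (a ++ [n]), nodeSigma U V i)
        ≤ ⨆ i ∈ treeIndex a, nodeSigma U V i := fun n =>
      biSup_mono fun i hi => belowIndex_subset a n hi
    have h1 : Measurable[⨆ i ∈ treeIndex a, nodeSigma U V i] (U a) := by
      refine Measurable.mono (comap_measurable (U a)) ?_ le_rfl
      have hm : Sum.inl a ∈ treeIndex a := Or.inl rfl
      exact le_biSup (nodeSigma U V) hm
    have h2 : ∀ n, Measurable[⨆ i ∈ treeIndex a, nodeSigma U V i] (V (a ++ [n])) := by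
      intro n
      refine Measurable.mono (comap_measurable (V (a ++ [n]))) ?_ le_rfl
      have hm : Sum.inr (a ++ [n]) ∈ treeIndex a := Or.inr ⟨n, List.prefix_rfl⟩
      exact le_biSup (nodeSigma U V) hm
    have h3 : ∀ n, Measurable[⨆ i ∈ treeIndex a, nodeSigma U V i]
        fun ω => mkTree (fun b => U b ω) (fun b => V b ω) j (a ++ [n]) := by
      intro n
      refine Measurable.mono (measurable_mkTree_iSup j (a ++ [n])) ?_ le_rfl
      exact (biSup_mono fun i hi => treeIndex_subset a n hi).trans (hle n)
    exact Measurable.prodMk h1 (measurable_of_forall_eval fun n => (h2 n).prodMk (h3 n))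

lemma nodeSigma_le (hU : ∀ a, Measurable (U a)) (hV : ∀ a, Measurable (V a)) (i) :
    nodeSigma U V i ≤ mΩ := by
  rcases i with a | a
  exacts [(hU a).comap_le, (hV a).comap_le]

lemma measurable_mkTree (hU : ∀ a, Measurable (U a)) (hV : ∀ a, Measurable (V a)) (j : ℕ)
    (a : List ℕ) : Measurable fun ω => mkTree (fun b => U b ω) (fun b => V b ω) j a :=
  (measurable_mkTree_iSup j a).mono (iSup₂_le fun i _ => nodeSigma_le hU hV i) le_rfl

variable {P : Measure Ω}

lemma indepFun_mark_mkTree (hU : ∀ a, Measurable (U a)) (hV : ∀ a, Measurable (V a))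
    (hind : iIndep (nodeSigma U V) P) (j : ℕ) (a : List ℕ) :
    IndepFun (V a) (fun ω => mkTree (fun b => U b ω) (fun b => V b ω) j a) P := by
  rw [IndepFun_iff_Indep]
  refine indep_of_indep_of_le (indep_iSup_of_disjoint (nodeSigma_le hU hV) hind
    (S := {Sum.inr a}) (T := treeIndex a) ?_) ?_ ?_
  · exact Set.disjoint_singleton_left.2 (inr_notMem_treeIndex a)
  · exact le_biSup (nodeSigma U V) (Set.mem_singleton (Sum.inr a))
  · exact (measurable_mkTree_iSup j a).comap_le

/-- The tree below a node is distributed according to `TreeLaw`. -/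
theorem treeLaw_map_mkTree [IsProbabilityMeasure P] (hU : ∀ a, Measurable (U a))
    (hV : ∀ a, Measurable (V a)) (hind : iIndep (nodeSigma U V) P) {θ : ℕ → ℝ}
    {ζ : ℕ → Measure X} [∀ j, IsProbabilityMeasure (ζ j)] {k : ℕ}
    (hUlaw : ∀ a j, a.length + (j + 1) = k →
      IsMecke (powerIntensity (θ (j + 1))) (P.map (U a)))
    (hVlaw : ∀ a j, a.length + j = k → a ≠ [] → P.map (V a) = ζ j) :
    ∀ j a, a.length + j = k →
      TreeLaw θ ζ j (P.map fun ω => mkTree (fun b => U b ω) (fun b => V b ω) j a)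
  | 0, a, _ => Measure.isProbabilityMeasure_map (measurable_mkTree hU hV 0 a).aemeasurable
  | j + 1, a, ha => by
    set T : List ℕ → Ω → Tree X j := fun b ω => mkTree (fun b => U b ω) (fun b => V b ω) j b with hT
    have hTm : ∀ b, Measurable (T b) := fun b => measurable_mkTree hU hV j b
    refine ⟨P.map (U a), fun n => P.map (T (a ++ [n])), hUlaw a j ha,
      fun n => treeLaw_map_mkTree hU hV hind hUlaw hVlaw j (a ++ [n])
        (by rw [List.length_append, List.length_singleton]; omega), ?_⟩
    have hpair : ∀ n, Measurable fun ω => (V (a ++ [n]) ω, T (a ++ [n]) ω) := fun n =>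
      (hV _).prodMk (hTm _)
    have hle : ∀ n, MeasurableSpace.comap (fun ω => (V (a ++ [n]) ω, T (a ++ [n]) ω)) inferInstance
        ≤ ⨆ i ∈ belowIndex (a ++ [n]), nodeSigma U V i := by
      intro n
      refine Measurable.comap_le (Measurable.prodMk ?_ ?_)
      · refine Measurable.mono (comap_measurable (V (a ++ [n]))) ?_ le_rfl
        have hm : Sum.inr (a ++ [n]) ∈ belowIndex (a ++ [n]) := List.prefix_rfl
        exact le_biSup (nodeSigma U V) hm
      · exact (measurable_mkTree_iSup j (a ++ [n])).mono
          (biSup_mono fun i hi => treeIndex_subset a n hi) le_rfl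
    -- Each child with its mark depends only on the nodes at or below it, and these sets are
    -- disjoint for different children. Together with `hroot` this gives the product form of
    -- `nodeLaw`.
    have hchild : iIndepFun (fun n ω => (V (a ++ [n]) ω, T (a ++ [n]) ω)) P :=
      (iIndepFun_iff_iIndep _ _ _).2 (iIndep_of_iIndep_of_le
        (iIndep_iSup_of_pairwise_disjoint (nodeSigma_le hU hV) hind
          fun n m h => disjoint_belowIndex a h) hle)
    have hroot : IndepFun (U a) (fun ω n => (V (a ++ [n]) ω, T (a ++ [n]) ω)) P := by
      rw [IndepFun_iff_Indep]
      refine indep_of_indep_of_le (indep_iSup_of_disjoint (nodeSigma_le hU hV) hind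
        (S := {Sum.inl a}) (T := ⋃ n, belowIndex (a ++ [n])) ?_) ?_ ?_
      · refine Set.disjoint_singleton_left.2 fun h => ?_
        obtain ⟨n, hn⟩ := Set.mem_iUnion.1 h
        exact inl_notMem_belowIndex a n hn
      · exact le_biSup (nodeSigma U V) (Set.mem_singleton (Sum.inl a))
      · refine Measurable.comap_le (measurable_of_forall_eval fun n => ?_)
        refine Measurable.mono (comap_measurable _) ((hle n).trans ?_) le_rfl
        exact biSup_mono fun i hi => Set.mem_iUnion.2 ⟨n, hi⟩
    have e1 := (indepFun_iff_map_prod_eq_prod_map_map (hU a).aemeasurable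
      (measurable_pi_lambda _ hpair).aemeasurable).1 hroot
    have e2 := hchild.map_fun_eq_infinitePi_map hpair
    have e3 : ∀ n, P.map (fun ω => (V (a ++ [n]) ω, T (a ++ [n]) ω))
        = (ζ j).prod (P.map (T (a ++ [n]))) := by
      intro n
      rw [(indepFun_iff_map_prod_eq_prod_map_map (hV _).aemeasurable (hTm _).aemeasurable).1
        (indepFun_mark_mkTree hU hV hind j (a ++ [n])), hVlaw (a ++ [n]) j
        (by rw [List.length_append, List.length_singleton]; omega) (by simp)]
    rw [e2] at e1
    simp_rw [e3] at e1
    exact e1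

end Law

end

section

/-! ### Sums over the leaves of a tree -/

lemma tsum_ite_append_prefix {a l : List ℕ} (h : a.length < l.length) (c : ℝ≥0∞) :
    ∑' n, (if a ++ [n] <+: l then c else 0) = if a <+: l then c else 0 := by
  split_ifs with hp
  · obtain ⟨t, rfl⟩ := hp
    cases t with
    | nil => simp at h
    | cons n t =>
      rw [tsum_eq_single n]
      · rw [if_pos]
        exact ⟨t, by simp⟩
      · intro m hm
        rw [if_neg]
        intro hpm
        rw [List.prefix_append_right_inj] at hpm
        simp only [List.cons_prefix_cons, List.nil_prefix, and_true] at hpm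
        exact hm hpm
  · simp only [ENNReal.tsum_eq_zero]
    intro n
    rw [if_neg]
    exact fun h => hp ((List.prefix_append _ _).trans h)

section Leaves

variable {X : Type} [AddCommMonoid X] (U : List ℕ → ℕ → ℝ) (V : List ℕ → X)

/-- The product of the weights along the path to the node `a`. -/
def nodeWeight (a : List ℕ) : ℝ≥0∞ :=
  ∏ i ∈ Finset.range a.length, ENNReal.ofReal (U (a.take i) (a.getD i 0))

/-- The sum of the marks along the path to the node `a`. -/
def nodeState (a : List ℕ) : X := ∑ i ∈ Finset.range (a.length + 1), V (a.take i)

lemma nodeWeight_append (a : List ℕ) (n : ℕ) :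
    nodeWeight U (a ++ [n]) = nodeWeight U a * ENNReal.ofReal (U a n) := by
  rw [nodeWeight, List.length_append, List.length_singleton, Finset.prod_range_succ]
  congr 1
  · refine Finset.prod_congr rfl fun i hi => ?_
    have hi' : i < a.length := Finset.mem_range.1 hi
    rw [List.take_append_of_le_length hi'.le, List.getD_append _ _ _ _ hi']
  · simp

lemma nodeState_append (a : List ℕ) (n : ℕ) :
    nodeState V (a ++ [n]) = nodeState V a + V (a ++ [n]) := by
  rw [nodeState, List.length_append, List.length_singleton, Finset.sum_range_succ]
  congr 1
  · refine Finset.sum_congr rfl fun i hi => ?_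
    have hi' : i < a.length + 1 := Finset.mem_range.1 hi
    rw [List.take_append_of_le_length (by omega)]
  · rw [List.take_of_length_le (by simp)]

variable (F : X → ℝ≥0∞) {k : ℕ}

/-- The weight of the leaf `α`, with the factor `F` evaluated at its state. -/
def leafMass (α : Fin k → ℕ) : ℝ≥0∞ :=
  nodeWeight U (List.ofFn α) * F (nodeState V (List.ofFn α))

/-- Unfolds the recursion into a sum over the leaves below `a`: such a leaf passes through exactly
one child of `a`. -/
lemma nodeWeight_mul_treeSum : ∀ (j : ℕ) (a : List ℕ), a.length + j = k →
    nodeWeight U a * treeSum F j (nodeState V a) (mkTree U V j a)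
      = ∑' α : Fin k → ℕ, if a <+: List.ofFn α then leafMass U V F α else 0
  | 0, a, h => by
    obtain rfl : a.length = k := h
    rw [tsum_eq_single (fun i => a.get i)]
    · rw [List.ofFn_get, if_pos List.prefix_rfl, leafMass, List.ofFn_get, treeSum]
    · intro α hα
      rw [if_neg]
      intro hp
      refine hα ?_
      have := hp.eq_of_length (by simp)
      exact List.ofFn_injective (by rw [← this, List.ofFn_get])
  | j + 1, a, h => by
    have step : ∀ n, nodeWeight U a * (ENNReal.ofReal (U a n) ^ 1 *
        treeSum F j (nodeState V a + V (a ++ [n])) (mkTree U V j (a ++ [n])))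
        = ∑' α : Fin k → ℕ, if a ++ [n] <+: List.ofFn α then leafMass U V F α else 0 := by
      intro n
      rw [← nodeWeight_mul_treeSum j (a ++ [n]) (by simp; omega), nodeWeight_append,
        nodeState_append, pow_one, mul_assoc]
    calc nodeWeight U a * treeSum F (j + 1) (nodeState V a) (mkTree U V (j + 1) a)
        = ∑' n, nodeWeight U a * (ENNReal.ofReal (U a n) ^ 1 *
            treeSum F j (nodeState V a + V (a ++ [n])) (mkTree U V j (a ++ [n]))) :=
          ENNReal.tsum_mul_left.symm
      _ = _ := by
          simp_rw [step]
          rw [ENNReal.tsum_comm]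
          exact tsum_congr fun α => tsum_ite_append_prefix (by simp; omega) _

/-- Both leaves of a pair agreeing further down pass through the same child, whence the square of
the weight at each step. -/
lemma nodeWeight_sq_mul_treeSq : ∀ (d j : ℕ) (a : List ℕ), d ≤ j → a.length + j = k →
    nodeWeight U a ^ 2 * treeSq F d j (nodeState V a) (mkTree U V j a)
      = ∑' (α : Fin k → ℕ) (β : Fin k → ℕ),
        if a <+: List.ofFn α ∧
          (List.ofFn α).take (a.length + d) = (List.ofFn β).take (a.length + d)
        then leafMass U V F α * leafMass U V F β else 0
  | 0, j, a, _, h => by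
    have h1 := nodeWeight_mul_treeSum U V F j a h
    rw [treeSq, pow_two, mul_mul_mul_comm, h1, ← ENNReal.tsum_mul_right]
    refine tsum_congr fun α => ?_
    rw [← ENNReal.tsum_mul_left]
    refine tsum_congr fun β => ?_
    by_cases hα : a <+: List.ofFn α
    · have e : (List.ofFn α).take a.length = a := (List.prefix_iff_eq_take.1 hα).symm
      simp only [hα, true_and, if_true, add_zero, e, mul_ite, mul_zero, List.prefix_iff_eq_take]
    · simp [hα]
  | d + 1, 0, a, h, _ => by omega
  | d + 1, j + 1, a, hd, h => by
    have step : ∀ n, nodeWeight U a ^ 2 * (ENNReal.ofReal (U a n) ^ 2 *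
        treeSq F d j (nodeState V a + V (a ++ [n])) (mkTree U V j (a ++ [n])))
        = ∑' (α : Fin k → ℕ) (β : Fin k → ℕ),
        if a ++ [n] <+: List.ofFn α then (if
          (List.ofFn α).take (a.length + (d + 1)) = (List.ofFn β).take (a.length + (d + 1))
        then leafMass U V F α * leafMass U V F β else 0) else 0 := by
      intro n
      have := nodeWeight_sq_mul_treeSq d j (a ++ [n]) (by omega) (by simp; omega)
      rw [nodeWeight_append, nodeState_append, mul_pow, mul_assoc, List.length_append,
        List.length_singleton, add_assoc, add_comm 1 d] at this
      rw [this]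
      simp_rw [ite_and]
    calc nodeWeight U a ^ 2 * treeSq F (d + 1) (j + 1) (nodeState V a) (mkTree U V (j + 1) a)
        = ∑' n, nodeWeight U a ^ 2 * (ENNReal.ofReal (U a n) ^ 2 *
            treeSq F d j (nodeState V a + V (a ++ [n])) (mkTree U V j (a ++ [n]))) :=
          ENNReal.tsum_mul_left.symm
      _ = _ := by
          simp_rw [step]
          rw [ENNReal.tsum_comm]
          refine tsum_congr fun α => ?_
          rw [ENNReal.tsum_comm]
          refine tsum_congr fun β => ?_
          rw [tsum_ite_append_prefix (by simp; omega), ite_and]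

lemma treeSum_mkTree_nil :
    treeSum F k (V []) (mkTree U V k []) = ∑' α : Fin k → ℕ, leafMass U V F α := by
  have := nodeWeight_mul_treeSum U V F (k := k) k [] (by simp)
  simpa [nodeWeight, nodeState] using this

lemma treeSq_mkTree_nil {d : ℕ} (hd : d ≤ k) :
    treeSq F d k (V []) (mkTree U V k [])
      = ∑' (α : Fin k → ℕ) (β : Fin k → ℕ),
        if (List.ofFn α).take d = (List.ofFn β).take d
        then leafMass U V F α * leafMass U V F β else 0 := by
  have := nodeWeight_sq_mul_treeSq U V F (k := k) d k [] hd (by simp)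
  simpa [nodeWeight, nodeState] using this

end Leaves

/-! ### The level of the last common ancestor -/

lemma take_ofFn_eq_iff {k : ℕ} (α β : Fin k → ℕ) (d : ℕ) :
    (List.ofFn α).take d = (List.ofFn β).take d ↔ ∀ i : Fin k, (i : ℕ) < d → α i = β i := by
  constructor
  · intro h i hi
    have := congrArg (fun l => l[(i : ℕ)]?) h
    simpa [List.getElem?_take, hi] using this
  · intro h
    refine List.ext_getElem (by simp) fun i h1 h2 => ?_
    simp only [List.length_take, List.length_ofFn, lt_min_iff] at h1
    simpa using h ⟨i, h1.2⟩ h1.1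

lemma wedge_eq_iff {k : ℕ} (α β : Fin k → ℕ) {r : ℕ} (h1 : 1 ≤ r) (hr : r ≤ k) :
    wedge α β = r ↔ (List.ofFn α).take (r - 1) = (List.ofFn β).take (r - 1) ∧
      ¬ (List.ofFn α).take r = (List.ofFn β).take r := by
  rw [take_ofFn_eq_iff, take_ofFn_eq_iff]
  by_cases hαβ : α = β
  · subst hαβ
    simp only [wedge, if_true, implies_true, not_true, and_false, iff_false]
    omega
  · have hne : {l : ℕ | ∃ i : Fin k, l = (i : ℕ) + 1 ∧ α i ≠ β i}.Nonempty := by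
      obtain ⟨i, hi⟩ := Function.ne_iff.1 hαβ
      exact ⟨_, i, rfl, hi⟩
    rw [wedge, if_neg hαβ]
    obtain ⟨i₀, hi₀, hne₀⟩ := Nat.sInf_mem hne
    have hmin : ∀ i : Fin k, α i ≠ β i → i₀ ≤ i := by
      intro i hi
      have hm : (i : ℕ) + 1 ∈ {l : ℕ | ∃ i : Fin k, l = (i : ℕ) + 1 ∧ α i ≠ β i} := ⟨i, rfl, hi⟩
      have := Nat.sInf_le hm
      exact Fin.le_def.2 (by omega)
    -- `i₀` is the first coordinate of disagreement, numbered from `0`, hence `wedge` is `i₀ + 1`.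
    rw [hi₀]
    constructor
    · intro h
      refine ⟨fun i hi => ?_, fun hcon => hne₀ (hcon i₀ (by omega))⟩
      by_contra hcon
      have := Fin.le_def.1 (hmin i hcon)
      omega
    · rintro ⟨ha, hb⟩
      push Not at hb
      obtain ⟨i, hi, hi'⟩ := hb
      have h2 := Fin.le_def.1 (hmin i hi')
      have h3 : ¬ (i₀ : ℕ) < r - 1 := fun h => hne₀ (ha i₀ h)
      omega

/-- The event that the two replicas agree on the first `d` levels. -/
def agreeEvent (N k d : ℕ) : Set ((Config N × (Fin k → ℕ)) × (Config N × (Fin k → ℕ))) :=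
  {p | (List.ofFn p.1.2).take d = (List.ofFn p.2.2).take d}

lemma overlapEvent_eq {N k r : ℕ} (h1 : 1 ≤ r) (hr : r ≤ k) :
    overlapEvent N k r = agreeEvent N k (r - 1) \ agreeEvent N k r := by
  ext p
  exact wedge_eq_iff p.1.2 p.2.2 h1 hr

lemma agreeEvent_subset {N k r : ℕ} : agreeEvent N k r ⊆ agreeEvent N k (r - 1) := by
  intro p hp
  have hp' := (take_ofFn_eq_iff _ _ _).1 hp
  exact (take_ofFn_eq_iff _ _ _).2 fun i hi => hp' i (by omega)

end

section

/-! ### The weights and marks of the interpolating Hamiltonian -/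

section Nodes

variable {Ω : Type*} {N k : ℕ}

/-- The weights of the cascade, indexed by all lists. -/
def nodeU (u : (l : Fin k) → (Fin l → ℕ) → ℕ → Ω → ℝ) (a : List ℕ) (ω : Ω) (n : ℕ) : ℝ :=
  if h : a.length < k then u ⟨a.length, h⟩ (fun i => a.getD i 0) n ω else 0

/-- The Gaussian variables on the tree, indexed by all lists. -/
def nodeZ (z : (l : Fin (k + 1)) → (Fin l → ℕ) → Fin N → Ω → ℝ) (a : List ℕ) (i : Fin N)
    (ω : Ω) : ℝ :=
  if h : a.length < k + 1 then z ⟨a.length, h⟩ (fun i => a.getD i 0) i ω else 0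

/-- The contribution of a node to the Hamiltonian. The one of the root includes `H_N`. -/
def nodeV (HN : Config N → Ω → ℝ) (z : (l : Fin (k + 1)) → (Fin l → ℕ) → Fin N → Ω → ℝ) (t : ℝ)
    (a : List ℕ) (ω : Ω) (σ : Config N) : ℝ :=
  (if a = [] then √t * HN σ ω else 0) + √(1 - t) * ∑ i, nodeZ z a i ω * spin (σ i)

lemma take_ofFn_getD {α : Fin k → ℕ} {l : ℕ} (h : l ≤ k) (i : Fin l) :
    ((List.ofFn α).take l).getD i 0 = pre α l h i := by
  have hi : (i : ℕ) < k := i.isLt.trans_le h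
  rw [List.getD_eq_getElem?_getD, List.getElem?_take, if_pos i.isLt, List.getElem?_ofFn,
    dif_pos hi]
  rfl

lemma nodeU_of_length (u : (l : Fin k) → (Fin l → ℕ) → ℕ → Ω → ℝ) {a : List ℕ} {l : ℕ}
    (hl : a.length = l) (h : l < k) (ω : Ω) (n : ℕ) :
    nodeU u a ω n = u ⟨l, h⟩ (fun i => a.getD i 0) n ω := by
  subst hl
  rw [nodeU, dif_pos h]

lemma nodeZ_of_length (z : (l : Fin (k + 1)) → (Fin l → ℕ) → Fin N → Ω → ℝ) {a : List ℕ} {l : ℕ}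
    (hl : a.length = l) (h : l < k + 1) (i : Fin N) (ω : Ω) :
    nodeZ z a i ω = z ⟨l, h⟩ (fun i => a.getD i 0) i ω := by
  subst hl
  rw [nodeZ, dif_pos h]

lemma nodeU_take (u : (l : Fin k) → (Fin l → ℕ) → ℕ → Ω → ℝ) (α : Fin k → ℕ) (l : Fin k) (ω : Ω)
    (n : ℕ) : nodeU u ((List.ofFn α).take l) ω n = u l (pre α l l.isLt.le) n ω := by
  rw [nodeU_of_length u (l := l) (by simp [l.isLt.le]) l.isLt]
  congr 1
  exact funext fun i => take_ofFn_getD l.isLt.le i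

lemma nodeZ_take (z : (l : Fin (k + 1)) → (Fin l → ℕ) → Fin N → Ω → ℝ) (α : Fin k → ℕ)
    (l : Fin (k + 1)) (i : Fin N) (ω : Ω) :
    nodeZ z ((List.ofFn α).take l) i ω = z l (pre α l (Nat.lt_succ_iff.mp l.isLt)) i ω := by
  rw [nodeZ_of_length z (l := l) (by simp [Nat.lt_succ_iff.mp l.isLt]) l.isLt]
  congr 1
  exact funext fun i => take_ofFn_getD (Nat.lt_succ_iff.mp l.isLt) i

lemma nodeWeight_ofFn {u : (l : Fin k) → (Fin l → ℕ) → ℕ → Ω → ℝ} {ω : Ω}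
    (hu : ∀ l a n, 0 < u l a n ω) (α : Fin k → ℕ) :
    nodeWeight (fun a => nodeU u a ω) (List.ofFn α) = ENNReal.ofReal (cascadeProd u α ω) := by
  rw [nodeWeight, List.length_ofFn, Finset.prod_range, cascadeProd,
    ENNReal.ofReal_prod_of_nonneg fun l _ => (hu _ _ _).le]
  refine Finset.prod_congr rfl fun l _ => ?_
  rw [nodeU_take]
  simp

/-- Only the empty prefix of the path is the root, so `H_N` enters the sum exactly once. -/
lemma nodeState_ofFn (HN : Config N → Ω → ℝ)
    (z : (l : Fin (k + 1)) → (Fin l → ℕ) → Fin N → Ω → ℝ) (t : ℝ) (σ : Config N) (α : Fin k → ℕ)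
    (ω : Ω) :
    nodeState (fun a => nodeV HN z t a ω) (List.ofFn α) σ = hamiltonian HN z t σ α ω := by
  rw [nodeState, Finset.sum_apply, List.length_ofFn, Finset.sum_range]
  simp_rw [nodeV, nodeZ_take]
  rw [Finset.sum_add_distrib, ← Finset.mul_sum, hamiltonian, Finset.sum_comm]
  congr 1
  · rw [Finset.sum_eq_single 0]
    · simp
    · intro l _ hl
      rw [if_neg]
      intro h
      have := congrArg List.length h
      simp only [List.length_take, List.length_ofFn, List.length_nil] at this
      have h2 : (l : ℕ) ≠ 0 := fun h => hl (Fin.ext h)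
      omega
    · simp
  · simp_rw [← Finset.sum_mul]
    rfl

end Nodes

/-- The partition function of a Hamiltonian on `Config N`. -/
def partition {N : ℕ} (h : Config N → ℝ) : ℝ≥0∞ := ∑ σ, ENNReal.ofReal (Real.exp (h σ))

/-! ### The Gibbs measure at a fixed environment -/

section Gibbs

variable {Ω : Type*} {N k : ℕ} (HN : Config N → Ω → ℝ)
  (z : (l : Fin (k + 1)) → (Fin l → ℕ) → Fin N → Ω → ℝ)
  (u : (l : Fin k) → (Fin l → ℕ) → ℕ → Ω → ℝ) (t : ℝ) (ω : Ω)

/-- The weight of the leaves of the cascade for the interpolating Hamiltonian. -/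
abbrev gibbsMass (α : Fin k → ℕ) : ℝ≥0∞ :=
  leafMass (fun a => nodeU u a ω) (fun a => nodeV HN z t a ω) partition α

variable {HN z u t ω}

lemma gibbsMass_eq (hu : ∀ l a n, 0 < u l a n ω) (α : Fin k → ℕ) :
    gibbsMass HN z u t ω α = ENNReal.ofReal (cascadeProd u α ω) *
      ∑ σ, ENNReal.ofReal (Real.exp (hamiltonian HN z t σ α ω)) := by
  rw [gibbsMass, leafMass, nodeWeight_ofFn hu, partition]
  simp_rw [nodeState_ofFn]

lemma cascadeProd_pos (hu : ∀ l a n, 0 < u l a n ω) (α : Fin k → ℕ) : 0 < cascadeProd u α ω :=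
  Finset.prod_pos fun _ _ => hu _ _ _

lemma tsum_gibbsMass_pos (hu : ∀ l a n, 0 < u l a n ω) :
    0 < ∑' α, gibbsMass HN z u t ω α := by
  refine lt_of_lt_of_le ?_ (ENNReal.le_tsum (fun _ => 0))
  rw [gibbsMass_eq hu]
  refine ENNReal.mul_pos (by simpa using cascadeProd_pos hu _) ?_
  have h : ENNReal.ofReal (Real.exp (hamiltonian HN z t (fun _ => true) (fun _ => 0) ω)) ≤
      ∑ σ, ENNReal.ofReal (Real.exp (hamiltonian HN z t σ (fun _ => 0) ω)) :=
    Finset.single_le_sum (f := fun σ =>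
      ENNReal.ofReal (Real.exp (hamiltonian HN z t σ (fun _ => 0) ω)))
      (fun _ _ => zero_le) (Finset.mem_univ _)
  exact (lt_of_lt_of_le (by simpa using Real.exp_pos _) h).ne'

lemma exists_normalization (hu : ∀ l a n, 0 < u l a n ω)
    (hv : ∑' α : Fin k → ℕ, nodeWeight (fun a => nodeU u a ω) (List.ofFn α) < ⊤) :
    ∃ κ : ℝ≥0∞, κ ≠ 0 ∧ κ ≠ ⊤ ∧ ∀ f : (Fin k → ℕ) → ℝ≥0∞,
    ∫⁻ x, f x.2 ∂(gibbsUnnormalized HN z u t ω) = κ * ∑' α, gibbsMass HN z u t ω α * f α := by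
  simp_rw [nodeWeight_ofFn hu] at hv
  have hs : Summable fun α => cascadeProd u α ω := by
    have := ENNReal.summable_toReal hv.ne
    simpa only [ENNReal.toReal_ofReal (cascadeProd_pos hu _).le] using this
  have hpos : 0 < ∑' α, cascadeProd u α ω :=
    hs.tsum_pos (fun α => (cascadeProd_pos hu α).le) (fun _ => 0) (cascadeProd_pos hu _)
  -- The constant is the normalization of the weights. Finiteness of the sum, from `hv`, keeps the
  -- real `tsum` away from its default value `0`.
  refine ⟨(ENNReal.ofReal (∑' α, cascadeProd u α ω))⁻¹, by simp, by simpa using hpos, fun f => ?_⟩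
  have hw : ∀ σ α, ENNReal.ofReal (cascadeWeight u α ω * Real.exp (hamiltonian HN z t σ α ω))
      = (ENNReal.ofReal (∑' α, cascadeProd u α ω))⁻¹ * (ENNReal.ofReal (cascadeProd u α ω) *
        ENNReal.ofReal (Real.exp (hamiltonian HN z t σ α ω))) := by
    intro σ α
    rw [cascadeWeight, ENNReal.ofReal_mul (div_nonneg (cascadeProd_pos hu α).le hpos.le),
      ENNReal.ofReal_div_of_pos hpos, div_eq_mul_inv, mul_comm (ENNReal.ofReal (cascadeProd u α ω)),
      mul_assoc]
  rw [gibbsUnnormalized, lintegral_sum_measure]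
  simp_rw [lintegral_smul_measure, lintegral_dirac, hw, smul_eq_mul, mul_assoc]
  rw [ENNReal.tsum_mul_left, ENNReal.tsum_prod (f := fun σ α => ENNReal.ofReal (cascadeProd u α ω) *
    (ENNReal.ofReal (Real.exp (hamiltonian HN z t σ α ω)) * f α))]
  congr 1
  rw [ENNReal.tsum_comm]
  refine tsum_congr fun α => ?_
  rw [gibbsMass_eq hu, mul_assoc, Finset.sum_mul, Finset.mul_sum, tsum_fintype]

lemma lintegral_gibbs (hu : ∀ l a n, 0 < u l a n ω)
    (hv : ∑' α : Fin k → ℕ, nodeWeight (fun a => nodeU u a ω) (List.ofFn α) < ⊤)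
    (f : (Fin k → ℕ) → ℝ≥0∞) :
    ∫⁻ x, f x.2 ∂(gibbs HN z u t ω)
      = (∑' α, gibbsMass HN z u t ω α)⁻¹ * ∑' α, gibbsMass HN z u t ω α * f α := by
  obtain ⟨κ, h0, h1, hκ⟩ := exists_normalization (HN := HN) (z := z) (t := t) hu hv
  have huniv : gibbsUnnormalized HN z u t ω Set.univ = κ * ∑' α, gibbsMass HN z u t ω α := by
    have := hκ (fun _ => 1)
    simpa using this
  rw [gibbs, lintegral_smul_measure, hκ, huniv, smul_eq_mul, ← mul_assoc]
  congr 1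
  rw [ENNReal.mul_inv (Or.inl h0) (Or.inl h1), mul_right_comm, ENNReal.inv_mul_cancel h0 h1,
    one_mul]

lemma isProbabilityMeasure_gibbs (hu : ∀ l a n, 0 < u l a n ω)
    (hv : ∑' α : Fin k → ℕ, nodeWeight (fun a => nodeU u a ω) (List.ofFn α) < ⊤)
    (hS : ∑' α, gibbsMass HN z u t ω α < ⊤) :
    IsProbabilityMeasure (gibbs HN z u t ω) := by
  constructor
  have := lintegral_gibbs (HN := HN) (z := z) (t := t) hu hv (fun _ => 1)
  simp only [lintegral_const, one_mul, mul_one] at this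
  rw [this]
  exact ENNReal.inv_mul_cancel (tsum_gibbsMass_pos hu).ne' hS.ne

lemma gibbsTwo_agreeEvent (hu : ∀ l a n, 0 < u l a n ω)
    (hv : ∑' α : Fin k → ℕ, nodeWeight (fun a => nodeU u a ω) (List.ofFn α) < ⊤)
    (hS : ∑' α, gibbsMass HN z u t ω α < ⊤)
    {d : ℕ} (hd : d ≤ k) :
    gibbsTwo HN z u t ω (agreeEvent N k d)
      = treeSq partition d k (nodeV HN z t [] ω)
          (mkTree (fun a => nodeU u a ω) (fun a => nodeV HN z t a ω) k [])
        * treeSum partition k (nodeV HN z t [] ω)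
          (mkTree (fun a => nodeU u a ω) (fun a => nodeV HN z t a ω) k []) ^ ((0 : ℝ) - (2 : ℕ)) := by
  have hprob := isProbabilityMeasure_gibbs (HN := HN) (z := z) (t := t) hu hv hS
  rw [treeSq_mkTree_nil (fun a => nodeU u a ω) (fun a => nodeV HN z t a ω) partition hd,
    treeSum_mkTree_nil (fun a => nodeU u a ω) (fun a => nodeV HN z t a ω) partition]
  -- The exponent is left as `0 - 2` to match the recursion at `p = 0`.
  have hpow : (∑' α, gibbsMass HN z u t ω α) ^ ((0 : ℝ) - (2 : ℕ))
      = (∑' α, gibbsMass HN z u t ω α)⁻¹ * (∑' α, gibbsMass HN z u t ω α)⁻¹ := by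
    rw [zero_sub, ENNReal.rpow_neg, ENNReal.rpow_natCast, pow_two,
      ENNReal.mul_inv (Or.inr hS.ne) (Or.inl hS.ne)]
  rw [hpow, gibbsTwo, Measure.prod_apply (Set.to_countable _).measurableSet]
  have hsec : ∀ x : Config N × (Fin k → ℕ),
      gibbs HN z u t ω (Prod.mk x ⁻¹' agreeEvent N k d)
      = (∑' α, gibbsMass HN z u t ω α)⁻¹ * ∑' β, gibbsMass HN z u t ω β *
        if (List.ofFn x.2).take d = (List.ofFn β).take d then 1 else 0 := by
    intro x
    rw [← lintegral_gibbs hu hv, ← lintegral_indicator_one (Set.to_countable _).measurableSet]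
    refine lintegral_congr fun y => ?_
    simp only [Set.indicator, agreeEvent, Set.mem_preimage, Set.mem_ofPred_eq, Pi.one_apply]
  simp_rw [hsec]
  have hsum : ∀ c : ℝ≥0∞, ∀ B : (Fin k → ℕ) → ℝ≥0∞,
      ∑' α, gibbsMass HN z u t ω α * (c * B α) = c * ∑' α, gibbsMass HN z u t ω α * B α := by
    intro c B
    rw [← ENNReal.tsum_mul_left]
    exact tsum_congr fun α => mul_left_comm _ _ _
  rw [lintegral_gibbs hu hv (fun α => (∑' α, gibbsMass HN z u t ω α)⁻¹ *
    ∑' β, gibbsMass HN z u t ω β * if (List.ofFn α).take d = (List.ofFn β).take d then 1 else 0),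
    hsum, ← mul_assoc, mul_comm]
  congr 1
  refine tsum_congr fun α => ?_
  rw [← ENNReal.tsum_mul_left]
  refine tsum_congr fun β => ?_
  split_ifs <;> simp

end Gibbs

end

section

/-! ### Independence of the weights and marks of the interpolating Hamiltonian -/

lemma measurable_nodeU {Ω : Type*} {mΩ : MeasurableSpace Ω} {k : ℕ}
    {u : (l : Fin k) → (Fin l → ℕ) → ℕ → Ω → ℝ} {a : List ℕ}
    (hu : ∀ h : a.length < k, Measurable fun ω n => u ⟨a.length, h⟩ (fun i => a.getD i 0) n ω) :
    Measurable (nodeU u a) := by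
  by_cases h : a.length < k
  · have e : nodeU u a = fun ω n => u ⟨a.length, h⟩ (fun i => a.getD i 0) n ω := by
      funext ω n
      rw [nodeU, dif_pos h]
    rw [e]
    exact hu h
  · have e : nodeU u a = fun _ _ => 0 := by
      funext ω n
      rw [nodeU, dif_neg h]
    rw [e]
    exact measurable_const

lemma measurable_nodeZ {Ω : Type*} {mΩ : MeasurableSpace Ω} {N k : ℕ}
    {z : (l : Fin (k + 1)) → (Fin l → ℕ) → Fin N → Ω → ℝ} {a : List ℕ} {i : Fin N}
    (hz : ∀ h : a.length < k + 1, Measurable (z ⟨a.length, h⟩ (fun i => a.getD i 0) i)) :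
    Measurable (nodeZ z a i) := by
  by_cases h : a.length < k + 1
  · have e : nodeZ z a i = z ⟨a.length, h⟩ (fun i => a.getD i 0) i := by
      funext ω
      rw [nodeZ, dif_pos h]
    rw [e]
    exact hz h
  · have e : nodeZ z a i = fun _ => 0 := by
      funext ω
      rw [nodeZ, dif_neg h]
    rw [e]
    exact measurable_const

lemma measurable_nodeV {Ω : Type*} {mΩ : MeasurableSpace Ω} {N k : ℕ} {HN : Config N → Ω → ℝ}
    {z : (l : Fin (k + 1)) → (Fin l → ℕ) → Fin N → Ω → ℝ} {t : ℝ} {a : List ℕ}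
    (hH : a = [] → ∀ σ, Measurable (HN σ))
    (hz : ∀ (h : a.length < k + 1) i, Measurable (z ⟨a.length, h⟩ (fun i => a.getD i 0) i)) :
    Measurable (nodeV HN z t a) := by
  refine measurable_pi_lambda _ fun σ => Measurable.add ?_ (Measurable.const_mul ?_ _)
  · by_cases h : a = []
    · simp only [h, if_true]
      exact (hH h σ).const_mul _
    · simp only [h, if_false]
      exact measurable_const
  · exact Finset.measurable_sum _ fun i _ => (measurable_nodeZ fun h => hz h i).mul_const _

section Independence

variable {Ω : Type*} {mΩ : MeasurableSpace Ω} {P : Measure Ω} {N k : ℕ}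
  {HN : Config N → Ω → ℝ} {z : (l : Fin (k + 1)) → (Fin l → ℕ) → Fin N → Ω → ℝ}
  {u : (l : Fin k) → (Fin l → ℕ) → ℕ → Ω → ℝ}

variable (HN z u) in
/-- The σ-algebras generated by the disorder, by the variables on the tree and by the weights. -/
abbrev sourceSigma : (Unit ⊕ (((l : Fin (k + 1)) × (Fin l → ℕ)) × Fin N)) ⊕
    ((l : Fin k) × (Fin l → ℕ)) → MeasurableSpace Ω :=
  Sum.elim
    (Sum.elim (fun _ => MeasurableSpace.comap (fun ω σ => HN σ ω) inferInstance)
      (fun p => MeasurableSpace.comap (z p.1.1 p.1.2 p.2) inferInstance))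
    (fun p => MeasurableSpace.comap (fun ω n => u p.1 p.2 n ω) inferInstance)

lemma iIndep_sourceSigma [IsProbabilityMeasure P]
    (hz : iIndepFun (fun (p : ((l : Fin (k + 1)) × (Fin l → ℕ)) × Fin N) => z p.1.1 p.1.2 p.2) P)
    (hu : iIndepFun (fun (p : (l : Fin k) × (Fin l → ℕ)) (ω : Ω) (n : ℕ) => u p.1 p.2 n ω) P)
    (hHz : IndepFun (fun ω σ => HN σ ω) (fun ω l a i => z l a i ω) P)
    (hHzu : IndepFun (fun ω => (fun σ => HN σ ω, fun l a i => z l a i ω))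
      (fun ω l a n => u l a n ω) P) :
    iIndep (sourceSigma HN z u) P := by
  refine iIndep_sumElim (iIndep_sumElim iIndep.of_subsingleton ((iIndepFun_iff_iIndep _ _ _).1 hz) ?_)
    ((iIndepFun_iff_iIndep _ _ _).1 hu) ?_
  · refine indep_of_indep_of_le ((IndepFun_iff_Indep _ _ _).1 hHz) (iSup_le fun _ => le_rfl)
      (iSup_le fun p => Measurable.comap_le ?_)
    have h := comap_measurable (m := inferInstance) (fun ω l a i => z l a i ω)
    exact (measurable_pi_apply p.2).comp ((measurable_pi_apply p.1.2).comp
      ((measurable_pi_apply p.1.1).comp h))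
  · refine indep_of_indep_of_le ((IndepFun_iff_Indep _ _ _).1 hHzu) (iSup_le ?_)
      (iSup_le fun p => Measurable.comap_le ?_)
    · have h := comap_measurable (m := inferInstance) (fun ω => (fun σ => HN σ ω, fun l a i => z l a i ω))
      rintro (_ | p)
      · exact (measurable_fst.comp h).comap_le
      · refine Measurable.comap_le ?_
        exact (measurable_pi_apply p.2).comp ((measurable_pi_apply p.1.2).comp
          ((measurable_pi_apply p.1.1).comp (measurable_snd.comp h)))
    · have h := comap_measurable (m := inferInstance) (fun ω l a n => u l a n ω)
      exact (measurable_pi_apply p.2).comp ((measurable_pi_apply p.1).comp h)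

/-- The node to which a source of randomness belongs. -/
def sourceNode : (Unit ⊕ (((l : Fin (k + 1)) × (Fin l → ℕ)) × Fin N)) ⊕
    ((l : Fin k) × (Fin l → ℕ)) → List ℕ ⊕ List ℕ :=
  Sum.elim (Sum.elim (fun _ => Sum.inr []) (fun p => Sum.inr (List.ofFn p.1.2)))
    (fun p => Sum.inl (List.ofFn p.2))

lemma ofFn_getD (a : List ℕ) : List.ofFn (fun i : Fin a.length => a.getD i 0) = a := by
  conv_rhs => rw [← List.ofFn_get a]
  congr 1
  funext i
  simp

lemma iIndep_nodeSigma (t : ℝ) (hHm : ∀ σ, Measurable (HN σ)) (hzm : ∀ l a i, Measurable (z l a i))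
    (hum : ∀ l a n, Measurable (u l a n)) (h : iIndep (sourceSigma HN z u) P) :
    iIndep (nodeSigma (nodeU u) (nodeV HN z t)) P := by
  have hle : ∀ i, sourceSigma HN z u i ≤ mΩ := by
    rintro ((_ | p) | p)
    · exact (measurable_pi_lambda _ hHm).comap_le
    · exact (hzm _ _ _).comap_le
    · exact (measurable_pi_lambda _ fun n => hum _ _ n).comap_le
  -- The sources are grouped by the node and the kind of variable they feed; the fibres of
  -- `sourceNode` are disjoint. The root mark collects both `H_N` and the common column.
  refine iIndep_of_iIndep_of_le (iIndep_iSup_of_pairwise_disjoint hle h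
    (S := fun c => {i | sourceNode i = c}) ?_) ?_
  · intro c d hcd
    exact Set.disjoint_left.2 fun i hi hi' => hcd (hi.symm.trans hi')
  · have hsrc : ∀ i, sourceSigma HN z u i
        ≤ ⨆ j ∈ {j | sourceNode j = sourceNode i}, sourceSigma HN z u j := fun i =>
      le_biSup (sourceSigma HN z u) (show i ∈ {j | sourceNode j = sourceNode i} from rfl)
    rintro (a | a)
    · refine Measurable.comap_le (measurable_nodeU fun hl => ?_)
      have h1 := hsrc (Sum.inr ⟨⟨a.length, hl⟩, fun i => a.getD i 0⟩)
      have e : sourceNode (N := N) (k := k) (Sum.inr ⟨⟨a.length, hl⟩, fun i => a.getD i 0⟩)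
          = Sum.inl a := congrArg Sum.inl (ofFn_getD a)
      rw [e] at h1
      exact Measurable.mono (comap_measurable _) h1 le_rfl
    · refine Measurable.comap_le (measurable_nodeV ?_ fun hl i => ?_)
      · rintro rfl σ
        exact (measurable_pi_apply σ).comp
          (Measurable.mono (comap_measurable _) (hsrc (Sum.inl (Sum.inl ()))) le_rfl)
      · have h1 := hsrc (Sum.inl (Sum.inr ⟨⟨⟨a.length, hl⟩, fun i => a.getD i 0⟩, i⟩))
        have e : sourceNode (N := N) (k := k)
            (Sum.inl (Sum.inr ⟨⟨⟨a.length, hl⟩, fun i => a.getD i 0⟩, i⟩))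
            = Sum.inr a := congrArg Sum.inr (ofFn_getD a)
        rw [e] at h1
        exact Measurable.mono (comap_measurable _) h1 le_rfl

end Independence

/-! ### The law of the marks -/

/-- The law of `√(1 - t) ∑ y_i σ_i` for independent centered Gaussian variables `y_i` of variance
`v`. -/
def markLaw (N : ℕ) (t : ℝ) (v : NNReal) : Measure (Config N → ℝ) :=
  (Measure.pi fun _ : Fin N => gaussianReal 0 v).map fun y σ => √(1 - t) * ∑ i, y i * spin (σ i)

lemma measurable_markMap (N : ℕ) (t : ℝ) :
    Measurable fun (y : Fin N → ℝ) (σ : Config N) => √(1 - t) * ∑ i, y i * spin (σ i) := by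
  refine measurable_pi_lambda _ fun σ => Measurable.const_mul ?_ _
  exact Finset.measurable_sum _ fun i _ => (measurable_pi_apply i).mul_const _

instance isProbabilityMeasure_markLaw (N : ℕ) (t : ℝ) (v : NNReal) :
    IsProbabilityMeasure (markLaw N t v) :=
  Measure.isProbabilityMeasure_map (measurable_markMap N t).aemeasurable

lemma map_nodeV {Ω : Type*} [MeasurableSpace Ω] {P : Measure Ω} [IsProbabilityMeasure P] {N k : ℕ}
    {ξ : ℝ → ℝ} {q : ℕ → ℝ} (HN : Config N → Ω → ℝ)
    {z : (l : Fin (k + 1)) → (Fin l → ℕ) → Fin N → Ω → ℝ} (hz : IsGaussianTree P ξ q z) (t : ℝ)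
    {a : List ℕ} (ha : a ≠ []) (hk : a.length ≤ k) :
    P.map (nodeV HN z t a)
      = markLaw N t (deriv ξ (q (a.length + 1)) - deriv ξ (q a.length)).toNNReal := by
  have hlt : a.length < k + 1 := by omega
  have hm : ∀ i, Measurable (z ⟨a.length, hlt⟩ (fun i => a.getD i 0) i) :=
    fun i => hz.measurable _ _ i
  have e : nodeV HN z t a = (fun (y : Fin N → ℝ) (σ : Config N) => √(1 - t) * ∑ i, y i * spin (σ i))
      ∘ fun ω i => z ⟨a.length, hlt⟩ (fun i => a.getD i 0) i ω := by
    funext ω σ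
    simp only [nodeV, if_neg ha, zero_add, Function.comp]
    simp_rw [nodeZ_of_length z rfl hlt]
  rw [e, ← Measure.map_map (measurable_markMap N t) (measurable_pi_lambda _ hm), markLaw]
  congr 1
  have hi : iIndepFun (fun i => z ⟨a.length, hlt⟩ (fun i => a.getD i 0) i) P :=
    hz.indep.precomp (g := fun i : Fin N =>
      ((⟨⟨a.length, hlt⟩, fun i => a.getD i 0⟩ : (l : Fin (k + 1)) × (Fin l → ℕ)), i))
      fun i j h => (Prod.ext_iff.1 h).2
  rw [(iIndepFun_iff_map_fun_eq_pi_map fun i => (hm i).aemeasurable).1 hi]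
  congr 1
  funext i
  exact (hz.law _ _ i).map_eq

lemma measurable_partition {N : ℕ} : Measurable (partition (N := N)) := by
  unfold partition
  exact Finset.measurable_sum _ fun σ _ =>
    (Real.measurable_exp.comp (measurable_pi_apply σ)).ennreal_ofReal

lemma lintegral_exp_markLaw_ne_top (N : ℕ) (t : ℝ) (v : NNReal) (σ : Config N) :
    ∫⁻ z, ENNReal.ofReal (Real.exp (z σ)) ∂(markLaw N t v) ≠ ⊤ := by
  have hm : Measurable fun z : Config N → ℝ => ENNReal.ofReal (Real.exp (z σ)) :=
    (Real.measurable_exp.comp (measurable_pi_apply σ)).ennreal_ofReal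
  rw [markLaw, lintegral_map hm (measurable_markMap N t)]
  have e : ∀ y : Fin N → ℝ, Real.exp (√(1 - t) * ∑ i, y i * spin (σ i))
      = ∏ i, Real.exp (√(1 - t) * spin (σ i) * y i) := by
    intro y
    rw [← Real.exp_sum, Finset.mul_sum]
    congr 1
    exact Finset.sum_congr rfl fun i _ => by ring
  simp_rw [e]
  have hint : Integrable (fun y : Fin N → ℝ => ∏ i, Real.exp (√(1 - t) * spin (σ i) * y i))
      (Measure.pi fun _ => gaussianReal 0 v) :=
    Integrable.fintype_prod fun i => integrable_exp_mul_gaussianReal _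
  exact (hint.lintegral_lt_top).ne

/-- The growth condition for `W = 1 + partition`: exponentials factor under addition of an
increment, and Gaussian exponential moments are finite. -/
lemma lintegral_one_add_partition_le (N : ℕ) (t : ℝ) (v : NNReal) :
    ∃ K : ℝ≥0∞, K ≠ ⊤ ∧ ∀ x : Config N → ℝ,
      ∫⁻ z, (1 + partition (x + z)) ∂(markLaw N t v) ≤ K * (1 + partition x) := by
  set I : Config N → ℝ≥0∞ := fun σ => ∫⁻ z, ENNReal.ofReal (Real.exp (z σ)) ∂(markLaw N t v) with hI
  refine ⟨1 + ∑ σ, I σ, by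
    simpa [ENNReal.sum_eq_top] using fun σ => lintegral_exp_markLaw_ne_top N t v σ, fun x => ?_⟩
  have hm : ∀ σ : Config N, Measurable fun z : Config N → ℝ => ENNReal.ofReal (Real.exp (z σ)) :=
    fun σ => (Real.measurable_exp.comp (measurable_pi_apply σ)).ennreal_ofReal
  have e : ∀ z, partition (x + z)
      = ∑ σ, ENNReal.ofReal (Real.exp (x σ)) * ENNReal.ofReal (Real.exp (z σ)) := by
    intro z
    rw [partition]
    refine Finset.sum_congr rfl fun σ _ => ?_
    rw [Pi.add_apply, Real.exp_add, ENNReal.ofReal_mul (Real.exp_pos _).le]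
  simp_rw [e]
  rw [lintegral_add_left measurable_const, lintegral_finsetSum _ fun σ _ => (hm σ).const_mul _]
  simp_rw [lintegral_const_mul _ (hm _)]
  rw [lintegral_one, measure_univ, partition, mul_add, mul_one]
  refine add_le_add le_self_add ?_
  rw [Finset.mul_sum]
  refine Finset.sum_le_sum fun σ _ => ?_
  rw [mul_comm]
  gcongr
  exact (Finset.single_le_sum (f := I) (fun _ _ => zero_le) (Finset.mem_univ σ)).trans le_add_self

end

section

/-! ### Random trees with an independent initial state -/

section RandomTree

variable {Ω : Type*} [MeasurableSpace Ω] {P : Measure Ω} [IsProbabilityMeasure P]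
  {X : Type} [MeasurableSpace X] [AddCommGroup X] [MeasurableAdd₂ X] {θ : ℕ → ℝ}
  {ζ : ℕ → Measure X} [∀ j, IsProbabilityMeasure (ζ j)] {F W : X → ℝ≥0∞} {k : ℕ}
  {x : Ω → X} {T : Ω → Tree X k}

lemma ae_treeSum_comp_lt_top (hF : Measurable F) (hW : Measurable W) (hFW : ∀ x, F x ≤ W x)
    (h1W : ∀ x, 1 ≤ W x) (hWt : ∀ x, W x ≠ ⊤)
    (hWζ : ∀ j, ∃ K, K ≠ ⊤ ∧ ∀ x, ∫⁻ z, W (x + z) ∂(ζ j) ≤ K * W x)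
    (hθ1 : ∀ i ≤ k, θ i ≤ 1) (hθ : ∀ i < k, θ (i + 1) < θ i) (hθ0 : 0 < θ k)
    (hx : Measurable x) (hT : Measurable T) (hxT : IndepFun x T P) (hL : TreeLaw θ ζ k (P.map T)) :
    ∀ᵐ ω ∂P, treeSum F k (x ω) (T ω) < ⊤ := by
  have hms : MeasurableSet {p : X × Tree X k | treeSum F k p.1 p.2 < ⊤} :=
    measurableSet_lt (measurable_treeSum hF k) measurable_const
  have hprod := (indepFun_iff_map_prod_eq_prod_map_map hx.aemeasurable hT.aemeasurable).1 hxT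
  have := hL.isProbabilityMeasure
  have hae : ∀ᵐ p ∂(P.map fun ω => (x ω, T ω)), treeSum F k p.1 p.2 < ⊤ := by
    rw [hprod, Measure.ae_prod_iff_ae_ae hms]
    exact Filter.Eventually.of_forall fun y =>
      ae_treeSum_lt_top hF hW hFW h1W hWζ hθ1 hθ hθ0 hL y (hWt y)
  exact ae_of_ae_map (hx.prodMk hT).aemeasurable hae

/-- The recursion at `p = 0` holds for every fixed starting state; independence allows integration
over the random one. -/
lemma lintegral_treeSq_mul_treeSum_comp (hF : Measurable F) {d : ℕ} (hd : d ≤ k)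
    (hθ : ∀ i, 1 ≤ i → i ≤ k → θ i < 1) (hx : Measurable x) (hT : Measurable T)
    (hxT : IndepFun x T P) (hL : TreeLaw θ ζ k (P.map T))
    (h0 : ∀ᵐ ω ∂P, treeSum F k (x ω) (T ω) ≠ 0) (ht : ∀ᵐ ω ∂P, treeSum F k (x ω) (T ω) < ⊤) :
    ∫⁻ ω, treeSq F d k (x ω) (T ω) * treeSum F k (x ω) (T ω) ^ ((0 : ℝ) - (2 : ℕ)) ∂P
      = ENNReal.ofReal (1 - if d = 0 then 0 else θ (k - d + 1)) := by
  have hprod := (indepFun_iff_map_prod_eq_prod_map_map hx.aemeasurable hT.aemeasurable).1 hxT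
  have := hL.isProbabilityMeasure
  have hxTm : Measurable fun ω => (x ω, T ω) := hx.prodMk hT
  have hS : Measurable fun p : X × Tree X k => treeSum F k p.1 p.2 := measurable_treeSum hF k
  have hQ : Measurable fun p : X × Tree X k => treeSq F d k p.1 p.2 := measurable_treeSq hF d k
  have key : ∀ f : X × Tree X k → ℝ≥0∞, Measurable f →
      ∫⁻ ω, f (x ω, T ω) ∂P = ∫⁻ y, ∫⁻ s, f (y, s) ∂(P.map T) ∂(P.map x) := by
    intro f hf
    rw [← lintegral_map hf hxTm, hprod, lintegral_prod _ hf.aemeasurable]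
  have hm1 : Measurable fun p : X × Tree X k =>
      treeSum F k p.1 p.2 * treeSum F k p.1 p.2 ^ ((0 : ℝ) - (1 : ℕ)) := hS.mul (hS.pow_const _)
  -- Positivity and finiteness of the sum enter here: `S S⁻¹ = 1` fails at `0` and `∞`.
  have hone : ∫⁻ y, ∫⁻ s, treeSum F k y s * treeSum F k y s ^ ((0 : ℝ) - (1 : ℕ)) ∂(P.map T)
      ∂(P.map x) = 1 := by
    rw [← key _ hm1]
    have e : (fun ω => treeSum F k (x ω) (T ω) * treeSum F k (x ω) (T ω) ^ ((0 : ℝ) - (1 : ℕ)))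
        =ᵐ[P] fun _ => 1 := by
      filter_upwards [h0, ht] with ω hω0 hωt
      rw [zero_sub, Nat.cast_one, ENNReal.rpow_neg_one, ENNReal.mul_inv_cancel hω0 hωt.ne]
    rw [lintegral_congr_ae e, lintegral_one, measure_univ]
  have hm2 : Measurable fun p : X × Tree X k =>
      treeSq F d k p.1 p.2 * treeSum F k p.1 p.2 ^ ((0 : ℝ) - (2 : ℕ)) := hQ.mul (hS.pow_const _)
  rw [key _ hm2]
  have hrec : ∀ y, ∫⁻ s, treeSq F d k y s * treeSum F k y s ^ ((0 : ℝ) - (2 : ℕ)) ∂(P.map T)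
      = ENNReal.ofReal (1 - if d = 0 then 0 else θ (k - d + 1)) *
        ∫⁻ s, treeSum F k y s * treeSum F k y s ^ ((0 : ℝ) - (1 : ℕ)) ∂(P.map T) := by
    intro y
    have := lintegral_treeSq_mul_rpow hF d k hd hθ _ hL 0 one_pos y
    rwa [sub_zero, ENNReal.ofReal_one, one_mul] at this
  simp_rw [hrec]
  rw [lintegral_const_mul _ hm1.lintegral_prod_right', hone, mul_one]

end RandomTree

/-! ### The cascade and its Gibbs measure -/

/-- The exponents of the Poisson processes, numbered from the leaves. -/
def levelExponent (m : ℕ → ℝ) (k i : ℕ) : ℝ := if i = 0 then 1 else m (k + 1 - i)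

/-- The laws of the marks, numbered from the leaves. -/
def levelLaw (ξ : ℝ → ℝ) (q : ℕ → ℝ) (N k : ℕ) (t : ℝ) (j : ℕ) : Measure (Config N → ℝ) :=
  markLaw N t (deriv ξ (q (k - j + 1)) - deriv ξ (q (k - j))).toNNReal

instance isProbabilityMeasure_levelLaw (ξ : ℝ → ℝ) (q : ℕ → ℝ) (N k : ℕ) (t : ℝ) (j : ℕ) :
    IsProbabilityMeasure (levelLaw ξ q N k t j) := isProbabilityMeasure_markLaw _ _ _

section Exponents

variable {m : ℕ → ℝ} {k : ℕ}

lemma levelExponent_succ_lt (hm : ∀ l < k, m l < m (l + 1)) (hmk : m k < 1) :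
    ∀ i < k, levelExponent m k (i + 1) < levelExponent m k i := by
  intro i hi
  rcases Nat.eq_zero_or_pos i with rfl | h
  · simpa [levelExponent] using hmk
  · rw [levelExponent, levelExponent, if_neg (by omega), if_neg (by omega)]
    have := hm (k + 1 - (i + 1)) (by omega)
    rwa [show k + 1 - (i + 1) + 1 = k + 1 - i by omega] at this

lemma levelExponent_le_one (hm : ∀ l < k, m l < m (l + 1)) (hmk : m k < 1) :
    ∀ i ≤ k, levelExponent m k i ≤ 1
  | 0, _ => by simp [levelExponent]
  | i + 1, h => ((levelExponent_succ_lt hm hmk i h).trans_le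
      (levelExponent_le_one hm hmk i (by omega))).le

lemma levelExponent_lt_one (hm : ∀ l < k, m l < m (l + 1)) (hmk : m k < 1) :
    ∀ i, 1 ≤ i → i ≤ k → levelExponent m k i < 1 := by
  rintro (_ | i) h1 h
  · omega
  · exact (levelExponent_succ_lt hm hmk i h).trans_le (levelExponent_le_one hm hmk i (by omega))

lemma levelExponent_self_pos (hk : 1 ≤ k) (hm0 : m 0 = 0) (hm : ∀ l < k, m l < m (l + 1)) :
    0 < levelExponent m k k := by
  have := hm 0 (by omega)
  rw [levelExponent, if_neg (by omega), show k + 1 - k = 0 + 1 by omega]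
  linarith

/-- Translates the numbering from the leaves back to the one from the root; `m 0 = 0` matches the
starting exponent `p = 0`. -/
lemma levelExponent_sub (hm0 : m 0 = 0) {d : ℕ} (hd : d ≤ k) :
    (if d = 0 then 0 else levelExponent m k (k - d + 1)) = m d := by
  split_ifs with h
  · rw [h, hm0]
  · rw [levelExponent, if_neg (by omega), show k + 1 - (k - d + 1) = d by omega]

end Exponents

section Cascade

variable {Ω : Type*} [MeasurableSpace Ω] {P : Measure Ω} {N k : ℕ}
  {m : ℕ → ℝ} {q : ℕ → ℝ} {ξ : ℝ → ℝ} {HN : Config N → Ω → ℝ}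
  {z : (l : Fin (k + 1)) → (Fin l → ℕ) → Fin N → Ω → ℝ}
  {u : (l : Fin k) → (Fin l → ℕ) → ℕ → Ω → ℝ}

lemma IsCascade.ae_pos [IsProbabilityMeasure P] (hu : IsCascade P m u) : ∀ᵐ ω ∂P, ∀ l a n, 0 < u l a n ω := by
  simp only [ae_all_iff]
  intro l a
  have := sigmaFinite_powerIntensity (m ((l : ℕ) + 1))
  have h := (hu.poisson l a).isMecke_map.ae_forall_notMem measurableSet_Iic
    (powerIntensity_Iic_zero (m ((l : ℕ) + 1)))
  have h2 := ae_of_ae_map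
    (measurable_pi_lambda _ fun n => (hu.poisson l a).measurable n).aemeasurable h
  rw [← ae_all_iff]
  filter_upwards [h2] with ω hω n
  simpa using hω n

lemma measurable_nodeU_cascade (hu : IsCascade P m u) (a : List ℕ) : Measurable (nodeU u a) :=
  measurable_nodeU fun _ => measurable_pi_lambda _ fun n => (hu.poisson _ _).measurable n

lemma measurable_nodeV_gaussian (hH : IsGaussianHamiltonian P ξ HN) (hz : IsGaussianTree P ξ q z)
    (t : ℝ) (a : List ℕ) : Measurable (nodeV HN z t a) :=
  measurable_nodeV (fun _ => hH.measurable) fun _ => hz.measurable _ _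

lemma treeLaw_map_cascade [IsProbabilityMeasure P] (hH : IsGaussianHamiltonian P ξ HN)
    (hz : IsGaussianTree P ξ q z) (hu : IsCascade P m u) (t : ℝ)
    (hind : iIndep (nodeSigma (nodeU u) (nodeV HN z t)) P) :
    TreeLaw (levelExponent m k) (levelLaw ξ q N k t) k
      (P.map fun ω => mkTree (fun b => nodeU u b ω) (fun b => nodeV HN z t b ω) k []) := by
  refine treeLaw_map_mkTree (k := k) (measurable_nodeU_cascade hu) (measurable_nodeV_gaussian hH hz t) hind
    (fun a j h => ?_) (fun a j h ha => ?_) k [] (by simp)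
  · have hl : a.length < k := by omega
    have e : nodeU u a = fun ω n => u ⟨a.length, hl⟩ (fun i => a.getD i 0) n ω := by
      funext ω n
      exact nodeU_of_length u rfl hl ω n
    have := sigmaFinite_powerIntensity (m (a.length + 1))
    rw [e, levelExponent, if_neg (by omega), show k + 1 - (j + 1) = a.length + 1 by omega]
    exact (hu.poisson ⟨a.length, hl⟩ _).isMecke_map
  · rw [map_nodeV HN hz t ha (by omega), levelLaw, show k - j = a.length by omega]

lemma ae_treeSum_cascade_lt_top [IsProbabilityMeasure P] (hH : IsGaussianHamiltonian P ξ HN)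
    (hz : IsGaussianTree P ξ q z) (hu : IsCascade P m u) (t : ℝ)
    (hind : iIndep (nodeSigma (nodeU u) (nodeV HN z t)) P) (hk : 1 ≤ k) (hm0 : m 0 = 0)
    (hm : ∀ l < k, m l < m (l + 1)) (hmk : m k < 1) {F : (Config N → ℝ) → ℝ≥0∞}
    (hF : Measurable F) (hFW : ∀ h, F h ≤ 1 + partition h) :
    ∀ᵐ ω ∂P, treeSum F k (nodeV HN z t [] ω)
      (mkTree (fun b => nodeU u b ω) (fun b => nodeV HN z t b ω) k []) < ⊤ := by
  have hU := measurable_nodeU_cascade hu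
  have hV := measurable_nodeV_gaussian hH hz t
  exact ae_treeSum_comp_lt_top hF (measurable_const.add measurable_partition) hFW
    (fun _ => le_self_add) (fun h => by simp [partition, ENNReal.sum_eq_top])
    (fun j => lintegral_one_add_partition_le N t _) (levelExponent_le_one hm hmk)
    (levelExponent_succ_lt hm hmk) (levelExponent_self_pos hk hm0 hm) (hV [])
    (measurable_mkTree hU hV k []) (indepFun_mark_mkTree hU hV hind k [])
    (treeLaw_map_cascade hH hz hu t hind)

end Cascade

end

end

end RuelleCascade

/-! ### The main theorem -/

open RuelleCascade in
theorem mainTheorem3 {Ω : Type*} [MeasurableSpace Ω] (P : Measure Ω) [IsProbabilityMeasure P]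
    (N k : ℕ) (hN : 1 ≤ N) (hk : 1 ≤ k)
    (m : ℕ → ℝ) (hm0 : m 0 = 0) (hm : ∀ l < k, m l < m (l + 1)) (hmk : m k < 1)
    (q : ℕ → ℝ) (hq0 : q 0 = 0) (hq : ∀ l ≤ k, q l < q (l + 1)) (hqk : q (k + 1) = 1)
    (ξ : ℝ → ℝ) (hξ_smooth : ∀ x ∈ Set.Icc (-1 : ℝ) 1, ContDiffAt ℝ ((⊤ : ℕ∞) : WithTop ℕ∞) ξ x)
    (hξ_convex : ConvexOn ℝ (Set.Icc (-1 : ℝ) 1) ξ) (hξ0 : ξ 0 = 0)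
    (HN : Config N → Ω → ℝ) (hHN : IsGaussianHamiltonian P ξ HN)
    (z : (l : Fin (k + 1)) → (Fin l → ℕ) → Fin N → Ω → ℝ) (hz : IsGaussianTree P ξ q z)
    (u : (l : Fin k) → (Fin l → ℕ) → ℕ → Ω → ℝ) (hu : IsCascade P m u)
    (hHz : IndepFun (fun ω σ => HN σ ω) (fun ω l a i => z l a i ω) P)
    (hHzu : IndepFun
      (fun ω => (fun σ => HN σ ω, fun l a i => z l a i ω))
      (fun ω l a n => u l a n ω) P)
    (t : ℝ) (ht0 : 0 ≤ t) (ht1 : t ≤ 1) :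
    (∀ᵐ ω ∂P, IsProbabilityMeasure (gibbs HN z u t ω)) ∧
    ∀ r : ℕ, 1 ≤ r → r ≤ k →
      Integrable (fun ω => (gibbsTwo HN z u t ω).real (overlapEvent N k r)) P ∧
      ∫ ω, (∫ p, (overlapEvent N k r).indicator (fun _ => (1 : ℝ)) p ∂(gibbsTwo HN z u t ω)) ∂P
        = ∫ ω, (gibbsTwo HN z u t ω).real (overlapEvent N k r) ∂P ∧
      ∫ ω, (gibbsTwo HN z u t ω).real (overlapEvent N k r) ∂P = m r - m (r - 1) := by
  have hind : iIndep (nodeSigma (nodeU u) (nodeV HN z t)) P :=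
    iIndep_nodeSigma t hHN.measurable hz.measurable (fun l a n => (hu.poisson l a).measurable n)
      (iIndep_sourceSigma hz.indep hu.indep hHz hHzu)
  have hU := measurable_nodeU_cascade hu
  have hV := measurable_nodeV_gaussian hHN hz t
  have hfin : ∀ F : (Config N → ℝ) → ENNReal, Measurable F → (∀ h, F h ≤ 1 + partition h) →
      ∀ᵐ ω ∂P, ∑' α : Fin k → ℕ,
        leafMass (fun a => nodeU u a ω) (fun a => nodeV HN z t a ω) F α < ⊤ := by
    intro F hF hFW
    filter_upwards [ae_treeSum_cascade_lt_top hHN hz hu t hind hk hm0 hm hmk hF hFW] with ω hω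
    rwa [treeSum_mkTree_nil (fun a => nodeU u a ω) (fun a => nodeV HN z t a ω) F] at hω
  have hvt : ∀ᵐ ω ∂P,
      ∑' α : Fin k → ℕ, nodeWeight (fun a => nodeU u a ω) (List.ofFn α) < ⊤ := by
    -- The leaf function `F = 1` gives the sum of the bare weights `v_α`.
    filter_upwards [hfin (fun _ => 1) measurable_const fun _ => le_self_add] with ω hω
    simpa only [leafMass, mul_one] using hω
  have hSt := hfin partition measurable_partition fun _ => le_add_self
  have hprob : ∀ᵐ ω ∂P, IsProbabilityMeasure (gibbs HN z u t ω) := by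
    filter_upwards [hu.ae_pos, hvt, hSt] with ω h1 h2 h3
    exact isProbabilityMeasure_gibbs h1 h2 h3
  refine ⟨hprob, fun r hr1 hrk => ?_⟩
  set T : Ω → Tree (Config N → ℝ) k := fun ω =>
    mkTree (fun b => nodeU u b ω) (fun b => nodeV HN z t b ω) k [] with hT
  have hTm : Measurable T := measurable_mkTree hU hV k []
  have hS0 : ∀ᵐ ω ∂P, treeSum partition k (nodeV HN z t [] ω) (T ω) ≠ 0 := by
    filter_upwards [hu.ae_pos] with ω h1
    rw [hT, treeSum_mkTree_nil (fun a => nodeU u a ω) (fun a => nodeV HN z t a ω) partition]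
    exact (tsum_gibbsMass_pos h1).ne'
  have hagree : ∀ d ≤ k, Integrable (fun ω => (gibbsTwo HN z u t ω).real (agreeEvent N k d)) P ∧
      ∫ ω, (gibbsTwo HN z u t ω).real (agreeEvent N k d) ∂P = 1 - m d := by
    intro d hd
    -- A measurable function of the disorder that equals the Gibbs probability almost surely;
    -- measurability and integrability are obtained through it.
    set A : Ω → ENNReal := fun ω => treeSq partition d k (nodeV HN z t [] ω) (T ω) *
      treeSum partition k (nodeV HN z t [] ω) (T ω) ^ ((0 : ℝ) - (2 : ℕ)) with hA
    have hVT : Measurable fun ω => (nodeV HN z t [] ω, T ω) := (hV []).prodMk hTm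
    have hAm : Measurable A := ((measurable_treeSq measurable_partition d k).comp hVT).mul
      (((measurable_treeSum measurable_partition k).comp hVT).pow_const _)
    have hAint : ∫⁻ ω, A ω ∂P = ENNReal.ofReal (1 - m d) := by
      rw [← levelExponent_sub hm0 hd]
      exact lintegral_treeSq_mul_treeSum_comp measurable_partition hd
        (levelExponent_lt_one hm hmk) (hV []) hTm (indepFun_mark_mkTree hU hV hind k [])
        (treeLaw_map_cascade hHN hz hu t hind) hS0
        (ae_treeSum_cascade_lt_top hHN hz hu t hind hk hm0 hm hmk measurable_partition
          fun _ => le_add_self)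
    have hAe : (fun ω => (gibbsTwo HN z u t ω).real (agreeEvent N k d))
        =ᵐ[P] fun ω => (A ω).toReal := by
      filter_upwards [hu.ae_pos, hvt, hSt] with ω h1 h2 h3
      rw [measureReal_def, gibbsTwo_agreeEvent h1 h2 h3 hd]
    have hAne : ∫⁻ ω, A ω ∂P ≠ ⊤ := by
      rw [hAint]
      exact ENNReal.ofReal_ne_top
    have hmd : m d ≤ 1 := by
      rw [← levelExponent_sub hm0 hd]
      split_ifs with h
      · exact zero_le_one
      · exact levelExponent_le_one hm hmk _ (by omega)
    refine ⟨(integrable_toReal_of_lintegral_ne_top hAm.aemeasurable hAne).congr hAe.symm, ?_⟩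
    rw [integral_congr_ae hAe, integral_toReal hAm.aemeasurable (ae_lt_top hAm hAne), hAint,
      ENNReal.toReal_ofReal (by linarith)]
  -- First disagreement at level `r` means agreement on `r - 1` levels but not on `r`.
  have hdiff : (fun ω => (gibbsTwo HN z u t ω).real (overlapEvent N k r)) =ᵐ[P] fun ω =>
      (gibbsTwo HN z u t ω).real (agreeEvent N k (r - 1))
        - (gibbsTwo HN z u t ω).real (agreeEvent N k r) := by
    filter_upwards [hprob] with ω hω
    have : IsProbabilityMeasure (gibbsTwo HN z u t ω) := by
      unfold gibbsTwo
      infer_instance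
    rw [overlapEvent_eq hr1 hrk,
      measureReal_sdiff agreeEvent_subset (Set.to_countable _).measurableSet]
  obtain ⟨hi1, he1⟩ := hagree (r - 1) (by omega)
  obtain ⟨hi2, he2⟩ := hagree r hrk
  refine ⟨(hi1.sub hi2).congr hdiff.symm, ?_, ?_⟩
  · refine integral_congr_ae (Filter.Eventually.of_forall fun ω => ?_)
    simp only
    rw [integral_indicator_const _ (Set.to_countable _).measurableSet, smul_eq_mul, mul_one]
  · rw [integral_congr_ae hdiff, integral_sub hi1 hi2, he1, he2]
    ring
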